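/- Let $\Sigma$ be a finite alphabet. A decision problem is a set $\mathcal P$ of pairs $\langle D,P\rangle$ of strings $D,P\in\Sigma^*$, where $D$ is called the data part and $P$ the problem part. A random-access Turing machine (RATM) is a multitape Turing machine with a read-only input tape and finitely many work tapes, each equipped with a binary index tape; when the machine enters its random access state, the head of the input tape and of every work tape moves in one step to the cell whose number is written on the respective index tape. A pair of strings $(x,y)$ is given to it on the two tracks of the input tape. A function $g:\Sigma^*\times\Sigma^*\to\Sigma^*$ is PPL computable if some RATM computes $g(x,y)$ from $(x,y)$, for all $x,y$, in at most $T(|x|)$ steps, where $T(n)=O(\log^k n)$ for some $k$; the time is thus measured in the length of the first argument (the data part). A function $f:\Sigma^*\to\Sigma^*$ is NC computable if it is computed by a logspace-uniform family of Boolean circuits of fan-in two, of polynomial size and polylogarithmic depth. The class $\mathsf{PsPL}$ consists of the problems $\mathcal P$ for which there are a finite alphabet $\Gamma$, a polynomial-time computable preprocessing function $\Pi:\Sigma^*\to\Gamma^*$ and a RATM that, for all $D,P\in\Sigma^*$, given $(\Pi(D),P)$, decides whether $\langle D,P\rangle\in\mathcal P$ in at most $T(|D|)$ steps, where $T(n)=O(\log^k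 n)$ for some $k$. A problem $\mathcal P_1$ is pseudo-polylog-time reducible to a problem $\mathcal P_2$, written $\mathcal P_1\le^{\mathsf{PsPL}}_m\mathcal P_2$, if there are NC computable functions $f_1,f_2:\Sigma^*\to\Sigma^*$ and a PPL computable function $g:\Sigma^*\times\Sigma^*\to\Sigma^*$ such that for all $D,P\in\Sigma^*$ $$\langle D,P\rangle\in\mathcal P_1\iff\langle f_1(D),\,g(f_2(D),P)\rangle\in\mathcal P_2 .$$ Theorem. The class $\mathsf{PsPL}$ is closed under $\le^{\mathsf{PsPL}}_m$: if $\mathcal P_1\le^{\mathsf{PsPL}}_m\mathcal P_2$ and $\mathcal P_2\in\mathsf{PsPL}$, then $\mathcal P_1\in\mathsf{PsPL}$. -/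

import Mathlib

namespace PseudoPolylog

/-! ### Resource bounds -/

/-- `T(n) = O(polylog n)`: `T(n) = O(log^k n)` for some `k`. -/
def IsPolylog (T : ℕ → ℕ) : Prop :=
  ∃ k : ℕ, (fun n : ℕ => (T n : ℝ)) =O[Filter.atTop] (fun n : ℕ => Real.log (n : ℝ) ^ k)

/-- `s(n) = O(log n)`. -/
def IsLogarithmic (s : ℕ → ℕ) : Prop :=
  (fun n : ℕ => (s n : ℝ)) =O[Filter.atTop] (fun n : ℕ => Real.log (n : ℝ))

/-- `p` is bounded by a polynomial. -/
def IsPolyBounded (p : ℕ → ℕ) : Prop :=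
  ∃ q : Polynomial ℕ, ∀ n, p n ≤ q.eval n

/-! ### Runs of deterministic machines -/

/-- The run of a deterministic machine from `c` halts in the configuration `c'` after at
most `t` steps. -/
def HaltsWithin {C : Type} (step : C → Option C) (c c' : C) (t : ℕ) : Prop :=
  Nonempty (StateTransition.EvalsToInTime step c (some c') t) ∧ step c' = none

/-- Head movements on a tape whose cells are numbered `0, 1, 2, …`. -/
inductive Move
  | left
  | stay
  | right

/-- The new head position; a head on cell `0` cannot move further to the left. -/
def Move.apply : Move → ℕ → ℕ
  | .left, p => p - 1
  | .stay, p => p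
  | .right, p => p + 1

/-! ### Random-access Turing machines -/

/-- What a random-access Turing machine does in one step. -/
structure RATMAction (Q A K O : Type) where
  /-- the next state -/
  next : Q
  /-- the movement of the head of the input tape -/
  inMove : Move
  /-- the symbols written on the work tapes -/
  workWrite : K → A
  /-- the movements of the heads of the work tapes -/
  workMove : K → Move
  /-- the symbols written on the index tapes -/
  idxWrite : Option K → Option Bool
  /-- the movements of the heads of the index tapes -/
  idxMove : Option K → Move
  /-- the symbol, if any, appended to the output -/
  emit : Option O

/-- A random-access Turing machine. It has a read-only input tape whose cells hold symbols
from `I` (which includes the blank), work tapes indexed by the finite type `K`, and one binary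
index tape for each of these tapes: `none` indexes the index tape of the input tape, `some k` that
of the work tape `k`. A cell of an index tape is `some false`, `some true`, or blank (`none`).
The machine halts when `δ` returns `none`. Machines that compute functions write their output, a
string over `O`, symbol by symbol on a write-only output tape; machines that decide accept or
reject according to the state in which they halt. -/
structure RATM (I O : Type) where
  /-- states -/
  Q : Type
  [finQ : Finite Q]
  /-- alphabet of the work tapes -/
  A : Type
  [finA : Finite A]
  /-- the blank of the work tapes -/
  blank : A
  /-- index type of the work tapes -/
  K : Type
  [finK : Finite K]
  /-- the initial state -/
  start : Q
  /-- the random access state -/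
  ra : Q
  /-- the accepting states -/
  acc : Set Q
  /-- the transition function -/
  δ : Q → I → (K → A) → (Option K → Option Bool) → Option (RATMAction Q A K O)

/-- The number described by an index tape: the cell `i` holds the binary digit of weight `2 ^ i`,
a blank counting as the digit `0`. -/
noncomputable def indexValue (t : ℕ → Option Bool) : ℕ :=
  ∑ᶠ (i : ℕ) (_ : t i = some true), 2 ^ i

namespace RATM

variable {I O : Type}

/-- Configurations: the state, and the content and head position of each tape. -/
structure Cfg (M : RATM I O) where
  state : M.Q
  inPos : ℕ
  work : M.K → ℕ → M.A
  workPos : M.K → ℕ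
  idx : Option M.K → ℕ → Option Bool
  idxPos : Option M.K → ℕ
  out : List O

/-- The initial configuration: all tapes but the input tape are blank. -/
def init (M : RATM I O) : M.Cfg where
  state := M.start
  inPos := 0
  work := fun _ _ => M.blank
  workPos := fun _ => 0
  idx := fun _ _ => none
  idxPos := fun _ => 0
  out := []

open Classical in
/-- One step on the input tape `x`. When the random access state is entered, the heads of the input
tape and of all work tapes move to the cells described by their index tapes. -/
noncomputable def step (M : RATM I O) (x : ℕ → I) (c : M.Cfg) : Option M.Cfg :=
  (M.δ c.state (x c.inPos) (fun k => c.work k (c.workPos k))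
      (fun j => c.idx j (c.idxPos j))).map fun a =>
    let idx' : Option M.K → ℕ → Option Bool :=
      fun j => Function.update (c.idx j) (c.idxPos j) (a.idxWrite j)
    { state := a.next
      inPos := if a.next = M.ra then indexValue (idx' none) else a.inMove.apply c.inPos
      work := fun k => Function.update (c.work k) (c.workPos k) (a.workWrite k)
      workPos := fun k =>
        if a.next = M.ra then indexValue (idx' (some k)) else (a.workMove k).apply (c.workPos k)
      idx := idx'
      idxPos := fun j => (a.idxMove j).apply (c.idxPos j)
      out := c.out ++ a.emit.toList }

/-- On the input tape `x`, the machine halts after at most `t` steps, and it accepts if and only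
if `p` holds. -/
def DecidesWithin (M : RATM I O) (x : ℕ → I) (p : Prop) (t : ℕ) : Prop :=
  ∃ c : M.Cfg, HaltsWithin (M.step x) M.init c t ∧ (c.state ∈ M.acc ↔ p)

/-- On the input tape `x`, the machine halts after at most `t` steps with output `w`. -/
def OutputsWithin (M : RATM I O) (x : ℕ → I) (w : List O) (t : ℕ) : Prop :=
  ∃ c : M.Cfg, HaltsWithin (M.step x) M.init c t ∧ c.out = w

end RATM

/-- The input tape that holds a pair of strings, on two tracks: the cell `i` holds the `i`-th
symbol of `x` and the `i`-th symbol of `y`, where `none` is the blank. -/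
def pairTape {G S : Type} (x : List G) (y : List S) : ℕ → Option G × Option S :=
  fun i => (x[i]?, y[i]?)

/-! ### Logarithmic space -/

/-- A cell of a read-only input tape with end markers. -/
inductive InputCell (I : Type)
  | leftEnd
  | sym (a : I)
  | rightEnd

/-- The input tape that holds `x`: the left end marker in cell `0`, then `x`, then the right end
marker. -/
def inputCell {I : Type} (x : List I) (p : ℕ) : InputCell I :=
  if p = 0 then .leftEnd else
    match x[p - 1]? with
    | some a => .sym a
    | none => .rightEnd

/-- A Turing transducer with a read-only input tape, one work tape, and a write-only output tape.
It halts when `δ` returns `none`; otherwise `δ` returns the next state, the movement of the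
input head, the symbol written on the work tape, the movement of the work head, and the symbol, if
any, appended to the output. -/
structure Transducer (I O : Type) where
  /-- states -/
  Q : Type
  [finQ : Finite Q]
  /-- alphabet of the work tape -/
  A : Type
  [finA : Finite A]
  /-- the blank of the work tape -/
  blank : A
  /-- the initial state -/
  start : Q
  /-- the transition function -/
  δ : Q → InputCell I → A → Option (Q × Move × A × Move × Option O)

namespace Transducer

variable {I O : Type}

/-- Configurations of a transducer. -/
structure Cfg (M : Transducer I O) where
  state : M.Q
  inPos : ℕ
  work : ℕ → M.A
  workPos : ℕ
  out : List O

/-- The initial configuration. -/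
def init (M : Transducer I O) : M.Cfg where
  state := M.start
  inPos := 0
  work := fun _ => M.blank
  workPos := 0
  out := []

/-- One step on input `x`. The input head does not move beyond the end markers. -/
def step (M : Transducer I O) (x : List I) (c : M.Cfg) : Option M.Cfg :=
  (M.δ c.state (inputCell x c.inPos) (c.work c.workPos)).map fun
    | (q, inMove, a, workMove, o) =>
      { state := q
        inPos := min (inMove.apply c.inPos) (x.length + 1)
        work := Function.update c.work c.workPos a
        workPos := workMove.apply c.workPos
        out := c.out ++ o.toList }

end Transducer

/-- `f` is computable in logarithmic space. -/
def LogspaceComputable {I O : Type} (f : List I → List O) : Prop :=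
  ∃ (M : Transducer I O) (s : ℕ → ℕ), IsLogarithmic s ∧ ∀ x : List I,
    (∀ c, StateTransition.Reaches (M.step x) M.init c → c.workPos ≤ s x.length) ∧
    ∃ c, StateTransition.Reaches (M.step x) M.init c ∧ M.step x c = none ∧ c.out = f x

/-! ### Boolean circuits and `NC` -/

/-- Gates of a circuit that reads strings over `S`. The arguments of a logical gate are indices of
earlier gates. -/
inductive Gate (S : Type)
  /-- is the symbol at position `i` of the input equal to `a`? -/
  | inp (i : ℕ) (a : S)
  | const (b : Bool)
  | not (r : ℕ)
  | and (r s : ℕ)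
  | or (r s : ℕ)

open Classical in
/-- The value of a gate on input `x`, given the values of all earlier gates. -/
noncomputable def Gate.eval {S : Type} (x : List S) (v : List Bool) : Gate S → Bool
  | .inp i a => decide (x[i]? = some a)
  | .const b => b
  | .not r => !(v.getD r false)
  | .and r s => v.getD r false && v.getD s false
  | .or r s => v.getD r false || v.getD s false

/-- The depth of a gate, given the depths of all earlier gates. -/
def Gate.depth {S : Type} (d : List ℕ) : Gate S → ℕ
  | .inp _ _ => 0
  | .const _ => 0
  | .not r => d.getD r 0 + 1
  | .and r s => max (d.getD r 0) (d.getD s 0) + 1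
  | .or r s => max (d.getD r 0) (d.getD s 0) + 1

/-- A Boolean circuit of fan-in two, with its gates in topological order. An output port `(a, r)`
consists of a symbol `a` and the index `r` of a gate. The output of the circuit consists of the
symbols of those ports whose gates have value `true`, in the order of the ports. (So a string that
may have length at most `m` is output in the usual one-hot form, with `m` blocks of ports, one port
of each block for each symbol.) -/
structure Circuit (S : Type) where
  gates : List (Gate S)
  ports : List (S × ℕ)

namespace Circuit

variable {S : Type}

/-- The values of all gates on input `x`. -/
noncomputable def values (C : Circuit S) (x : List S) : List Bool :=
  C.gates.foldl (fun v g => v ++ [g.eval x v]) []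

/-- The output of the circuit on input `x`. -/
noncomputable def eval (C : Circuit S) (x : List S) : List S :=
  (C.ports.filter fun p => (C.values x).getD p.2 false).map Prod.fst

/-- The number of gates and output ports. -/
def size (C : Circuit S) : ℕ :=
  C.gates.length + C.ports.length

/-- The maximal depth of a gate. -/
def depth (C : Circuit S) : ℕ :=
  (C.gates.foldl (fun d g => d ++ [g.depth d]) []).foldr max 0

end Circuit

/-- The alphabet in which circuits over `S` are described. -/
inductive DescSymbol (S : Type)
  | tick
  | sep
  | inp (a : S)
  | const (b : Bool)
  | not
  | and
  | or
  | port (a : S)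

/-- A number in unary. -/
def ticks {S : Type} (n : ℕ) : List (DescSymbol S) :=
  List.replicate n .tick

/-- The description of a gate. -/
def Gate.describe {S : Type} : Gate S → List (DescSymbol S)
  | .inp i a => .inp a :: ticks i
  | .const b => [.const b]
  | .not r => .not :: ticks r
  | .and r s => .and :: (ticks r ++ .sep :: ticks s)
  | .or r s => .or :: (ticks r ++ .sep :: ticks s)

/-- The description of a circuit: its gates, then its output ports. -/
def Circuit.describe {S : Type} (C : Circuit S) : List (DescSymbol S) :=
  C.gates.flatMap Gate.describe ++ C.ports.flatMap fun p => .port p.1 :: ticks p.2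

/-- `f` is `NC` computable: it is computed by a logspace-uniform family of Boolean circuits of
fan-in two, of polynomial size and polylogarithmic depth. Here `C n` is the circuit for inputs of
length `n`, and its description is computed from `n` in unary. -/
def NCComputable {S : Type} (f : List S → List S) : Prop :=
  ∃ C : ℕ → Circuit S,
    LogspaceComputable (fun u : List Unit => (C u.length).describe) ∧
    IsPolyBounded (fun n => (C n).size) ∧
    IsPolylog (fun n => (C n).depth) ∧
    ∀ x : List S, (C x.length).eval x = f x

/-! ### The classes and the reduction -/

/-- `f` is computable in polynomial time. -/
def PTIMEComputable {S G : Type} (f : List S → List G) : Prop :=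
  Nonempty (Turing.TM2ComputableInPolyTime (id : List S → List S) (id : List G → List G) f)

/-- `g` is `PPL` computable: it is computed by a random-access Turing machine in time
polylogarithmic in the length of the data part, which is the first argument. -/
def PPLComputable {S : Type} (g : List S → List S → List S) : Prop :=
  ∃ (M : RATM (Option S × Option S) S) (T : ℕ → ℕ), IsPolylog T ∧
    ∀ x y : List S, M.OutputsWithin (pairTape x y) (g x y) (T x.length)

/-- The class `PsPL` of the problems (binary relations between a data part `D` and a problem part
`P`) that a random-access Turing machine decides in time polylogarithmic in the length of `D`, given
`P` and the result of a polynomial-time preprocessing of `D`. The latter is a string over any finite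
alphabet `G`. -/
def PsPL (S : Type) : Set (Set (List S × List S)) :=
  {X | ∃ (G : Type) (_ : Finite G) (pre : List S → List G), PTIMEComputable pre ∧
    ∃ (M : RATM (Option G × Option S) Empty) (T : ℕ → ℕ), IsPolylog T ∧
      ∀ D P : List S, M.DecidesWithin (pairTape (pre D) P) ((D, P) ∈ X) (T D.length)}

/-- Pseudo-polylog-time reducibility of `X` to `Y`. -/
def PsPLReducible {S : Type} (X Y : Set (List S × List S)) : Prop :=
  ∃ (f₁ f₂ : List S → List S) (g : List S → List S → List S),
    NCComputable f₁ ∧ NCComputable f₂ ∧ PPLComputable g ∧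
    ∀ D P : List S, (D, P) ∈ X ↔ (f₁ D, g (f₂ D) P) ∈ Y

end PseudoPolylog

/-! Preprocess `D` for the first problem by zipping, on two tracks, the string `pre (f₁ D)` that the
decider `M₂` of the second problem expects with the string `f₂ D` that the machine `M₁` for `g`
expects. Online, run `M₁` on the track of `f₂ D` together with `P`, keep its output `z = g (f₂ D)
P`, and run `M₂` on the other track together with `z`. The lengths of `f₁ D` and `f₂ D` are
polynomial in the length of `D`, and the logarithm of a polynomial is `O(log n)`, so both runs are
polylogarithmic in the length of `D` (`IsPolylog.sup_comp`).

The online part is `RATM.comp_decidesWithin`. The difficulty is that a random access moves the heads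
of all work tapes at once, so no work tape head of the composition can simply wait at the end of the
output written so far. Heads of index tapes are not affected by random accesses. The output of `M₁`
is therefore recorded in one-hot form on the index tapes of spare tapes, one for each symbol, and a
further index tape counts the steps of `M₁`. When `M₁` halts, three sweeps whose length is that
count rewind the record, copy it to a work tape `out`, and erase the index tape of the input. A
random access then brings the relevant heads to cell `0`. From then on the index tape of `out`
duplicates that of the input, so the head of `out` always stands in the same column as the input
head and `M₂` finds `z` on its second track.

The preprocessing is polynomial-time because `NC` computable functions are
(`NCComputable.ptimeComputable`) and because polynomial time is closed under composition and zipping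
(`PTIMEComputable.comp`, `PTIMEComputable.zipWithAll`). For the first point, the logspace transducer
is run on the unary length of the input. A halting run never repeats a configuration, so it is
polynomially long (`Transducer.steps_le_of_space`) and writes a polynomially long description. The
circuit is evaluated while its description is read from left to right (`EvalState.foldl_describe`).
The stack machines are assembled from program fragments with Hoare-style statements `Frag.Runs`. -/

namespace PseudoPolylog

/-! ### Counting steps -/

/-- `StepsIn step n c c'`: exactly `n` steps lead from `c` to `c'`. -/
inductive StepsIn {C : Type*} (step : C → Option C) : ℕ → C → C → Prop
  | zero (c : C) : StepsIn step 0 c c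
  | head {n : ℕ} {c c₁ c₂ : C} (h : step c = some c₁) (h' : StepsIn step n c₁ c₂) :
      StepsIn step (n + 1) c c₂

namespace StepsIn

variable {C C' : Type*} {step : C → Option C} {step' : C' → Option C'}

theorem single {c c' : C} (h : step c = some c') : StepsIn step 1 c c' :=
  head h (zero c')

theorem trans {m n : ℕ} {a b c : C} (h : StepsIn step m a b) (h' : StepsIn step n b c) :
    StepsIn step (m + n) a c := by
  induction h with
  | zero => simpa using h'
  | head h _ ih => rw [Nat.add_right_comm]; exact head h (ih h')

theorem tail {n : ℕ} {a b c : C} (h : StepsIn step n a b) (h' : step b = some c) :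
    StepsIn step (n + 1) a c :=
  h.trans (single h')

/-- Connects the inductive predicate, which suits induction on runs, with the iteration on options
underlying `EvalsTo`. A run that has reached `none` stays there, so an iterate with value `some c'`
consists of genuine steps. -/
theorem iff_iterate {n : ℕ} {c c' : C} :
    StepsIn step n c c' ↔ (flip bind step)^[n] (some c) = some c' := by
  have none_iter : ∀ n, (flip bind step)^[n] (none : Option C) = none := by
    intro n
    induction n with
    | zero => rfl
    | succ n ih => rw [Function.iterate_succ_apply]; exact ih
  induction n generalizing c with
  | zero =>
    constructor
    · rintro ⟨⟩; rfl
    · intro h; cases h; exact zero _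
  | succ n ih =>
    rw [Function.iterate_succ_apply]
    constructor
    · rintro (_ | ⟨h, h'⟩)
      have e : flip bind step (some c) = step c := rfl
      rw [e, h]
      exact ih.1 h'
    · intro h
      have e : flip bind step (some c) = step c := rfl
      rw [e] at h
      cases hs : step c with
      | none => rw [hs, none_iter] at h; cases h
      | some c₁ => rw [hs] at h; exact head hs (ih.2 h)

theorem nonempty_evalsToInTime_iff {c c' : C} {t : ℕ} :
    Nonempty (StateTransition.EvalsToInTime step c (some c') t) ↔
      ∃ n ≤ t, StepsIn step n c c' :=
  ⟨fun ⟨h⟩ => ⟨h.steps, h.steps_le_m, iff_iterate.2 h.evals_in_steps⟩,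
    fun ⟨n, hn, h⟩ => ⟨⟨⟨n, iff_iterate.1 h⟩, hn⟩⟩⟩

theorem exists_of_reaches {c c' : C} (h : StateTransition.Reaches step c c') :
    ∃ n, StepsIn step n c c' := by
  induction h with
  | refl => exact ⟨0, zero _⟩
  | tail _ h ih => obtain ⟨n, hn⟩ := ih; exact ⟨n + 1, hn.tail h⟩

theorem reaches {n : ℕ} {c c' : C} (h : StepsIn step n c c') :
    StateTransition.Reaches step c c' := by
  induction h with
  | zero => exact .refl
  | head h _ ih => exact .head h ih

/-- A relation preserved by single steps, with a step counter, is preserved by runs. -/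
theorem simulate {R : ℕ → C → C' → Prop}
    (hR : ∀ i a b a', R i a b → step a = some a' → ∃ b', step' b = some b' ∧ R (i + 1) a' b')
    {n i : ℕ} {a a' : C} {b : C'} (hab : R i a b) (h : StepsIn step n a a') :
    ∃ b', StepsIn step' n b b' ∧ R (i + n) a' b' := by
  induction h generalizing i b with
  | zero => exact ⟨b, zero b, hab⟩
  | head h _ ih =>
    obtain ⟨b₁, hb₁, hR₁⟩ := hR _ _ _ _ hab h
    obtain ⟨b', hb', hR'⟩ := ih hR₁
    exact ⟨b', head hb₁ hb', by rwa [Nat.add_assoc, Nat.add_comm 1] at hR'⟩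

theorem map {f : C → C'} (hf : ∀ a a', step a = some a' → step' (f a) = some (f a'))
    {n : ℕ} {a a' : C} (h : StepsIn step n a a') : StepsIn step' n (f a) (f a') := by
  induction h with
  | zero => exact zero _
  | head h _ ih => exact head (hf _ _ h) ih

/-- For sweeps of a known length `n`: the invariant at time `i < n` itself guarantees that a next
step exists. -/
theorem of_invariant {P : ℕ → C → Prop} {n : ℕ}
    (hP : ∀ i < n, ∀ c, P i c → ∃ c', step c = some c' ∧ P (i + 1) c') {c : C} (hc : P 0 c) :
    ∃ c', StepsIn step n c c' ∧ P n c' := by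
  induction n with
  | zero => exact ⟨c, zero c, hc⟩
  | succ n ih =>
    obtain ⟨c₁, h₁, hP₁⟩ := ih fun i hi => hP i (by omega)
    obtain ⟨c₂, h₂, hP₂⟩ := hP n (by omega) c₁ hP₁
    exact ⟨c₂, h₁.tail h₂, hP₂⟩

end StepsIn

theorem haltsWithin_iff {C : Type} {step : C → Option C} {c c' : C} {t : ℕ} :
    HaltsWithin step c c' t ↔ (∃ n ≤ t, StepsIn step n c c') ∧ step c' = none := by
  rw [HaltsWithin, StepsIn.nonempty_evalsToInTime_iff]

/-! ### Polynomial and polylogarithmic bounds -/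

theorem eval_le_eval_of_le (q : Polynomial ℕ) {m n : ℕ} (h : m ≤ n) : q.eval m ≤ q.eval n := by
  induction q using Polynomial.induction_on' with
  | add p q hp hq => simpa using Nat.add_le_add hp hq
  | monomial d a => simpa using Nat.mul_le_mul_left a (Nat.pow_le_pow_left h d)

namespace IsPolyBounded

variable {p q : ℕ → ℕ}

theorem mono (hq : IsPolyBounded q) (h : ∀ n, p n ≤ q n) : IsPolyBounded p := by
  obtain ⟨r, hr⟩ := hq
  exact ⟨r, fun n => (h n).trans (hr n)⟩

theorem const (a : ℕ) : IsPolyBounded fun _ => a :=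
  ⟨.C a, fun n => by simp⟩

theorem id : IsPolyBounded fun n => n :=
  ⟨.X, fun n => by simp⟩

theorem add (hp : IsPolyBounded p) (hq : IsPolyBounded q) : IsPolyBounded fun n => p n + q n := by
  obtain ⟨r, hr⟩ := hp
  obtain ⟨s, hs⟩ := hq
  exact ⟨r + s, fun n => by simpa using Nat.add_le_add (hr n) (hs n)⟩

theorem mul (hp : IsPolyBounded p) (hq : IsPolyBounded q) : IsPolyBounded fun n => p n * q n := by
  obtain ⟨r, hr⟩ := hp
  obtain ⟨s, hs⟩ := hq
  exact ⟨r * s, fun n => by simpa using Nat.mul_le_mul (hr n) (hs n)⟩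

theorem pow (hp : IsPolyBounded p) (d : ℕ) : IsPolyBounded fun n => p n ^ d := by
  induction d with
  | zero => simpa using const 1
  | succ d ih => simpa [pow_succ] using ih.mul hp

theorem eval (r : Polynomial ℕ) : IsPolyBounded fun n => r.eval n :=
  ⟨r, fun _ => le_rfl⟩

theorem comp (hq : IsPolyBounded q) (hp : IsPolyBounded p) : IsPolyBounded fun n => q (p n) := by
  obtain ⟨r, hr⟩ := hp
  obtain ⟨s, hs⟩ := hq
  refine ⟨s.comp r, fun n => (hs _).trans ?_⟩
  rw [Polynomial.eval_comp]
  exact eval_le_eval_of_le s (hr n)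

/-- Finitely many exceptions do not matter. -/
theorem of_eventually (hq : IsPolyBounded q) (N : ℕ) (h : ∀ n, N ≤ n → p n ≤ q n) :
    IsPolyBounded p := by
  refine ((const (∑ i ∈ Finset.range N, p i)).add hq).mono fun n => ?_
  by_cases hn : N ≤ n
  · exact (h n hn).trans (Nat.le_add_left _ _)
  · exact (Finset.single_le_sum (f := p) (fun _ _ => Nat.zero_le _)
      (Finset.mem_range.2 (not_le.1 hn))).trans (Nat.le_add_right _ _)

/-- For `n ≥ 2` a coefficient `a < 2 ^ a ≤ n ^ a` is absorbed into the exponent, and the factor `2`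
of a sum costs one more power of `n`. -/
theorem exists_le_pow (hp : IsPolyBounded p) : ∃ d : ℕ, ∀ n, 2 ≤ n → p n ≤ n ^ d := by
  obtain ⟨r, hr⟩ := hp
  suffices h : ∃ d : ℕ, ∀ n, 2 ≤ n → r.eval n ≤ n ^ d by
    obtain ⟨d, hd⟩ := h
    exact ⟨d, fun n hn => (hr n).trans (hd n hn)⟩
  clear hr
  induction r using Polynomial.induction_on' with
  | add r s hr hs =>
    obtain ⟨d, hd⟩ := hr
    obtain ⟨e, he⟩ := hs
    refine ⟨max d e + 1, fun n hn => ?_⟩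
    have h₁ : n ^ d ≤ n ^ max d e := Nat.pow_le_pow_right (by omega) (le_max_left _ _)
    have h₂ : n ^ e ≤ n ^ max d e := Nat.pow_le_pow_right (by omega) (le_max_right _ _)
    have h₃ : n ^ max d e * 2 ≤ n ^ max d e * n := Nat.mul_le_mul_left _ hn
    have := hd n hn
    have := he n hn
    rw [Polynomial.eval_add, pow_succ]
    omega
  | monomial d a =>
    refine ⟨a + d, fun n hn => ?_⟩
    rw [Polynomial.eval_monomial, pow_add]
    exact Nat.mul_le_mul_right _ (a.lt_two_pow_self.le.trans (Nat.pow_le_pow_left hn a))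

end IsPolyBounded

/-- With `1 + log n` in place of `log n` the bound can hold for every `n`, including `0` and `1`.
The finitely many exceptions are paid for by adding their values to the constant, since the power is
at least `1`. -/
theorem IsPolylog.exists_bound {T : ℕ → ℕ} (hT : IsPolylog T) :
    ∃ (k : ℕ) (C : ℝ), 0 ≤ C ∧ ∀ n, (T n : ℝ) ≤ C * (1 + Real.log n) ^ k := by
  obtain ⟨k, h⟩ := hT
  obtain ⟨c, hc, h⟩ := h.exists_pos
  rw [Asymptotics.isBigOWith_iff, Filter.eventually_atTop] at h
  obtain ⟨N, h⟩ := h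
  have hlog : ∀ n : ℕ, 0 ≤ Real.log n := fun n => Real.log_natCast_nonneg n
  refine ⟨k, c + ∑ i ∈ Finset.range N, (T i : ℝ),
    add_nonneg hc.le (Finset.sum_nonneg fun _ _ => Nat.cast_nonneg _), fun n => ?_⟩
  rw [add_mul]
  have hs : 0 ≤ ∑ i ∈ Finset.range N, (T i : ℝ) := Finset.sum_nonneg fun _ _ => Nat.cast_nonneg _
  have h1 : 1 ≤ (1 + Real.log n) ^ k := one_le_pow₀ (by linarith [hlog n])
  by_cases hn : N ≤ n
  · have := h n hn
    rw [Real.norm_of_nonneg (Nat.cast_nonneg _), Real.norm_of_nonneg (pow_nonneg (hlog n) k)]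
      at this
    have h2 : Real.log n ^ k ≤ (1 + Real.log n) ^ k :=
      pow_le_pow_left₀ (hlog n) (by linarith) k
    have := mul_le_mul_of_nonneg_left h2 hc.le
    have := mul_nonneg hs (zero_le_one.trans h1)
    linarith
  · have h3 : (T n : ℝ) ≤ ∑ i ∈ Finset.range N, (T i : ℝ) :=
      Finset.single_le_sum (f := fun i => (T i : ℝ)) (fun _ _ => Nat.cast_nonneg _)
        (Finset.mem_range.2 (not_le.1 hn))
    have := mul_le_mul_of_nonneg_left h1 hs
    have := mul_nonneg hc.le (zero_le_one.trans h1)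
    linarith

/-- A bound of the form `C * (1 + log n) ^ k` for `n ≥ 2` suffices. -/
theorem isPolylog_of_bound {T : ℕ → ℕ} (k : ℕ) (C : ℝ) (hC : 0 ≤ C)
    (h : ∀ n, 3 ≤ n → (T n : ℝ) ≤ C * (1 + Real.log n) ^ k) : IsPolylog T := by
  refine ⟨k, Asymptotics.IsBigO.of_bound (C * 2 ^ k) ?_⟩
  -- As `e < 3`, here `log n ≥ 1` and hence `1 + log n ≤ 2 * log n`; this is the source of the
  -- factor `2 ^ k`.
  filter_upwards [Filter.eventually_ge_atTop 3] with n hn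
  have h1 : 1 ≤ Real.log n := by
    rw [Real.le_log_iff_exp_le (by positivity)]
    have : (3 : ℝ) ≤ n := by exact_mod_cast hn
    linarith [Real.exp_one_lt_three]
  rw [Real.norm_of_nonneg (Nat.cast_nonneg _),
    Real.norm_of_nonneg (pow_nonneg (by linarith) k), mul_assoc, ← mul_pow]
  exact (h n hn).trans (mul_le_mul_of_nonneg_left
    (pow_le_pow_left₀ (by linarith) (by linarith) k) hC)

namespace IsPolylog

variable {T U : ℕ → ℕ}

theorem const (a : ℕ) : IsPolylog fun _ => a :=
  isPolylog_of_bound 0 a (Nat.cast_nonneg _) fun n _ => by simp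

theorem add (hT : IsPolylog T) (hU : IsPolylog U) : IsPolylog fun n => T n + U n := by
  obtain ⟨k, C, hC, hT⟩ := hT.exists_bound
  obtain ⟨l, D, hD, hU⟩ := hU.exists_bound
  refine isPolylog_of_bound (max k l) (C + D) (add_nonneg hC hD) fun n _ => ?_
  have h1 : 1 ≤ 1 + Real.log n := by linarith [Real.log_natCast_nonneg n]
  have h2 := mul_le_mul_of_nonneg_left (pow_le_pow_right₀ h1 (le_max_left k l)) hC
  have h3 := mul_le_mul_of_nonneg_left (pow_le_pow_right₀ h1 (le_max_right k l)) hD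
  push_cast
  linarith [hT n, hU n]

theorem const_mul (hT : IsPolylog T) (a : ℕ) : IsPolylog fun n => a * T n := by
  obtain ⟨k, C, hC, hT⟩ := hT.exists_bound
  refine isPolylog_of_bound k (a * C) (by positivity) fun n _ => ?_
  push_cast
  rw [mul_assoc]
  exact mul_le_mul_of_nonneg_left (hT n) (by positivity)

/-- Polylogarithmic time in a polynomially bounded quantity is polylogarithmic time. -/
theorem sup_comp (hT : IsPolylog T) {p : ℕ → ℕ} (hp : IsPolyBounded p) :
    IsPolylog fun n => (Finset.range (p n + 1)).sup T := by
  obtain ⟨k, C, hC, hT⟩ := hT.exists_bound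
  obtain ⟨d, hd⟩ := hp.exists_le_pow
  refine isPolylog_of_bound k (C * (1 + d) ^ k) (by positivity) fun n hn => ?_
  -- `T` need not be monotone, so the supremum over all lengths up to `p n` is taken. It is attained
  -- at some `m ≤ n ^ d`, where `log m ≤ d * log n`.
  obtain ⟨m, hm, e⟩ := Finset.exists_mem_eq_sup (Finset.range (p n + 1)) (by simp) T
  rw [e]
  refine (hT m).trans ?_
  rw [mul_assoc, ← mul_pow]
  have hlog : 0 ≤ Real.log n := Real.log_natCast_nonneg n
  refine mul_le_mul_of_nonneg_left (pow_le_pow_left₀ ?_ ?_ k) hC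
  · linarith [Real.log_natCast_nonneg m]
  · have hm' : m ≤ n ^ d := (Nat.lt_succ_iff.1 (Finset.mem_range.1 hm)).trans (hd n (by omega))
    have : Real.log m ≤ d * Real.log n := by
      rcases Nat.eq_zero_or_pos m with rfl | hpos
      · simpa using mul_nonneg (Nat.cast_nonneg d) hlog
      · rw [← Real.log_pow]
        exact Real.log_le_log (by exact_mod_cast hpos) (by exact_mod_cast hm')
    nlinarith [Nat.cast_nonneg (α := ℝ) d]

end IsPolylog

theorem IsLogarithmic.isPolyBounded {s : ℕ → ℕ} (hs : IsLogarithmic s) :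
    IsPolyBounded s := by
  obtain ⟨c, hc, h⟩ := Asymptotics.IsBigO.exists_pos hs
  rw [Asymptotics.isBigOWith_iff, Filter.eventually_atTop] at h
  obtain ⟨N, h⟩ := h
  refine ((IsPolyBounded.const ⌈c⌉₊).mul .id).of_eventually N fun n hn => ?_
  have := h n hn
  rw [Real.norm_of_nonneg (Nat.cast_nonneg _),
    Real.norm_of_nonneg (Real.log_natCast_nonneg n)] at this
  have h2 : (s n : ℝ) ≤ ⌈c⌉₊ * n :=
    this.trans (mul_le_mul (Nat.le_ceil c) (Real.log_le_self (Nat.cast_nonneg n))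
      (Real.log_natCast_nonneg n) (Nat.cast_nonneg _))
  exact_mod_cast h2

/-- The identity behind this is `a ^ (c * log n) = n ^ (c * log a)`. The base `a + 1` is used in the
estimate so that its logarithm is nonnegative also for `a = 0`. -/
theorem IsLogarithmic.isPolyBounded_pow {s : ℕ → ℕ} (hs : IsLogarithmic s) (a : ℕ) :
    IsPolyBounded fun n => a ^ s n := by
  obtain ⟨c, hc, h⟩ := Asymptotics.IsBigO.exists_pos hs
  rw [Asymptotics.isBigOWith_iff, Filter.eventually_atTop] at h
  obtain ⟨N, h⟩ := h
  refine (IsPolyBounded.id.pow ⌈Real.log (a + 1) * c⌉₊).of_eventually (N + 1) fun n hn => ?_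
  have := h n (by omega)
  rw [Real.norm_of_nonneg (Nat.cast_nonneg _),
    Real.norm_of_nonneg (Real.log_natCast_nonneg n)] at this
  have hn0 : (0 : ℝ) < n := by exact_mod_cast (by omega : 0 < n)
  have hla : 0 ≤ Real.log ((a : ℝ) + 1) := Real.log_nonneg (by linarith [Nat.cast_nonneg (α := ℝ) a])
  have key : ((a : ℝ) + 1) ^ s n ≤ (n : ℝ) ^ ⌈Real.log (a + 1) * c⌉₊ := by
    rw [← Real.log_le_log_iff (by positivity) (by positivity), Real.log_pow, Real.log_pow]
    calc (s n : ℝ) * Real.log (a + 1) ≤ c * Real.log n * Real.log (a + 1) :=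
          mul_le_mul_of_nonneg_right this hla
      _ = Real.log (a + 1) * c * Real.log n := by ring
      _ ≤ _ := mul_le_mul_of_nonneg_right (Nat.le_ceil _) (Real.log_natCast_nonneg n)
  have : (a + 1) ^ s n ≤ n ^ ⌈Real.log (a + 1) * c⌉₊ := by exact_mod_cast key
  exact (Nat.pow_le_pow_left (Nat.le_succ a) _).trans this

end PseudoPolylog

namespace PseudoPolylog

/-! ### Composition of random-access Turing machines

The second machine starts on an input tape whose second track is the output of the first machine.
The index tapes of some additional work tapes serve as a storage that random accesses do not affect:
they keep the phase, the number of steps, and the output of the first machine. -/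

/-- A random access sends the head of a tape with blank index tape to cell `0`. This makes accesses
harmless for tapes that are not yet in use, and serves to reset heads. -/
theorem indexValue_of_blank {t : ℕ → Option Bool} (h : ∀ i, t i = none) : indexValue t = 0 := by
  simp [indexValue, h]

theorem RATM.step_of_some {I O : Type} {M : RATM I O} {x : ℕ → I} {c : M.Cfg}
    {a : RATMAction M.Q M.A M.K O}
    (h : M.δ c.state (x c.inPos) (fun k => c.work k (c.workPos k))
      (fun j => c.idx j (c.idxPos j)) = some a) :
    ∃ c' : M.Cfg, M.step x c = some c' ∧ c'.state = a.next ∧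
      (c'.inPos = open Classical in if a.next = M.ra then indexValue (c'.idx none)
        else a.inMove.apply c.inPos) ∧
      (∀ k, c'.work k = Function.update (c.work k) (c.workPos k) (a.workWrite k)) ∧
      (∀ k, c'.workPos k = open Classical in if a.next = M.ra then indexValue (c'.idx (some k))
        else (a.workMove k).apply (c.workPos k)) ∧
      (∀ j, c'.idx j = Function.update (c.idx j) (c.idxPos j) (a.idxWrite j)) ∧
      (∀ j, c'.idxPos j = (a.idxMove j).apply (c.idxPos j)) ∧
      c'.out = c.out ++ a.emit.toList := by
  refine ⟨_, by rw [RATM.step, h, Option.map_some], rfl, rfl, fun _ => rfl, fun _ => rfl,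
    fun _ => rfl, fun _ => rfl, rfl⟩

/-- The action that enters the state `q` and leaves everything else unchanged. -/
@[simps]
def RATMAction.keep {Q A K O : Type} (q : Q) (w : K → A) (x : Option K → Option Bool) :
    RATMAction Q A K O where
  next := q
  inMove := .stay
  workWrite := w
  workMove := fun _ => .stay
  idxWrite := x
  idxMove := fun _ => .stay
  emit := none

/-- The additional tapes of a composition. -/
inductive AuxTape (S : Type)
  | out
  | phase
  | timer
  | enc (s : S)

instance {S : Type} [Finite S] : Finite (AuxTape S) :=
  .of_injective (β := Option (Option (Option S)))
    (fun | .out => none | .phase => some none | .timer => some (some none)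
         | .enc s => some (some (some s)))
    (by rintro (_ | _ | _ | _) (_ | _ | _ | _) h <;> simp_all)

/-- The states of a composition. -/
inductive CompState (Q₁ Q₂ : Type)
  | init
  | first (q : Q₁)
  | forth
  | copy
  | back
  | access
  | second (q : Q₂)

instance {Q₁ Q₂ : Type} [Finite Q₁] [Finite Q₂] : Finite (CompState Q₁ Q₂) :=
  .of_injective (β := (Q₁ ⊕ Q₂) ⊕ Fin 5)
    (fun | .init => .inr 0 | .first q => .inl (.inl q) | .forth => .inr 1 | .copy => .inr 2
         | .back => .inr 3 | .access => .inr 4 | .second q => .inl (.inr q))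
    (by rintro (_ | _ | _ | _ | _ | _ | _) (_ | _ | _ | _ | _ | _ | _) h <;> simp_all)

namespace RATM

open Classical in
/-- The symbol described by the cells of the tapes `enc s`. -/
noncomputable def decodeSymbol {S : Type} (f : S → Option Bool) : Option S :=
  if h : ∃ s, f s = some true then some h.choose else none

open Classical in
theorem decodeSymbol_eq {S : Type} (o : Option S) :
    decodeSymbol (fun s => if o = some s then some true else none) = o := by
  unfold decodeSymbol
  cases o with
  | none => simp
  | some a =>
    have h : ∃ s, (if some a = some s then some true else none) = some true := ⟨a, by simp⟩
    rw [dif_pos h]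
    have := h.choose_spec
    by_contra hne
    rw [if_neg (fun e => hne e.symm)] at this
    cases this

variable {G S : Type} (M₁ : RATM (Option S × Option S) S) (M₂ : RATM (Option G × Option S) Empty)

section Actions

/-- The work tapes of the composition. -/
abbrev CompTape : Type := M₁.K ⊕ M₂.K ⊕ AuxTape S

/-- The work alphabet of the composition. -/
abbrev CompSymbol : Type := M₁.A × M₂.A × Option S

abbrev CompAction : Type :=
  RATMAction (CompState M₁.Q M₂.Q) (CompSymbol M₁ M₂) (CompTape M₁ M₂) Empty

variable {M₁ M₂}

abbrev auxTape (a : AuxTape S) : CompTape M₁ M₂ := .inr (.inr a)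

variable (M₁ M₂)

-- A machine has only one random access state, so those of both machines are identified with
-- `access`. The index tape of `phase` tells which machine is meant: blank for the first, `true` for
-- the second, and `false` at the moment of the change.
open Classical in
noncomputable def firstState (q : M₁.Q) : CompState M₁.Q M₂.Q :=
  if q = M₁.ra then .access else .first q

open Classical in
noncomputable def secondState (q : M₂.Q) : CompState M₁.Q M₂.Q :=
  if q = M₂.ra then .access else .second q

@[simp]
theorem firstState_eq_access {q : M₁.Q} : firstState M₁ M₂ q = .access ↔ q = M₁.ra := by
  unfold firstState; split_ifs <;> simp_all

@[simp]
theorem secondState_eq_access {q : M₂.Q} : secondState M₁ M₂ q = .access ↔ q = M₂.ra := by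
  unfold secondState; split_ifs <;> simp_all

variable (w : CompTape M₁ M₂ → CompSymbol M₁ M₂) (x : Option (CompTape M₁ M₂) → Option Bool)

/-- Start the timer and the first machine. -/
noncomputable def initAction : CompAction M₁ M₂ :=
  { RATMAction.keep (firstState M₁ M₂ M₁.start) w x with
    idxWrite := fun
      | some (.inr (.inr .timer)) => some true
      | j => x j
    idxMove := fun
      | some (.inr (.inr .timer)) => .right
      | _ => .stay }

-- Besides the step of `M₁`, the timer gets one more `false`. If a symbol is emitted, its tape `enc
-- s` is marked and the index heads of all tapes `enc` advance together, so column `i` of these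
-- tapes encodes the `i`-th output symbol.
open Classical in
noncomputable def firstAction (a : RATMAction M₁.Q M₁.A M₁.K S) : CompAction M₁ M₂ where
  next := firstState M₁ M₂ a.next
  inMove := a.inMove
  workWrite := fun
    | .inl k => (a.workWrite k, M₂.blank, none)
    | k => w k
  workMove := fun
    | .inl k => a.workMove k
    | _ => .stay
  idxWrite := fun
    | none => a.idxWrite none
    | some (.inl k) => a.idxWrite (some k)
    | some (.inr (.inr .timer)) => some false
    | some (.inr (.inr (.enc s))) =>
      if a.emit = some s then some true else x (some (.inr (.inr (.enc s))))
    | j => x j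
  idxMove := fun
    | none => a.idxMove none
    | some (.inl k) => a.idxMove (some k)
    | some (.inr (.inr .timer)) => .right
    | some (.inr (.inr (.enc _))) => if a.emit.isSome then .right else .stay
    | _ => .stay
  emit := none

/-- First sweep: the timer and the record of the output are rewound. The index head of the input
moves right meanwhile, so that the next two sweeps pass over everything that has to be erased. -/
def forthAction : CompAction M₁ M₂ :=
  { RATMAction.keep .forth w x with
    idxMove := fun
      | none => .right
      | some (.inr (.inr .timer)) => .left
      | some (.inr (.inr (.enc _))) => .left
      | _ => .stay }

/-- Second sweep, with the timer running to the right: one symbol is decoded and copied to `out`,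
while the index tape of the input is erased from right to left. -/
noncomputable def copyAction : CompAction M₁ M₂ :=
  { RATMAction.keep .copy w x with
    workWrite := fun
      | .inr (.inr .out) =>
        (M₁.blank, M₂.blank, decodeSymbol fun s => x (some (.inr (.inr (.enc s)))))
      | k => w k
    workMove := fun
      | .inr (.inr .out) => .right
      | _ => .stay
    idxWrite := fun
      | none => none
      | j => x j
    idxMove := fun
      | none => .left
      | some (.inr (.inr .timer)) => .right
      | some (.inr (.inr (.enc _))) => .right
      | _ => .stay }

/-- Third sweep, with the timer running to the left: the rest of the index tape of the input is
erased and its head returns to cell `0`. -/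
def backAction : CompAction M₁ M₂ :=
  { RATMAction.keep .back w x with
    idxWrite := fun
      | none => none
      | j => x j
    idxMove := fun
      | none => .left
      | some (.inr (.inr .timer)) => .left
      | _ => .stay }

/-- Enter the state `q` and write `b` on the index tape of the tape `phase`. -/
def phaseAction (q : CompState M₁.Q M₂.Q) (b : Bool) : CompAction M₁ M₂ :=
  { RATMAction.keep q w x with
    idxWrite := fun
      | some (.inr (.inr .phase)) => some b
      | j => x j }

/-- The tape `out` makes the same moves as the input tape and its index tape receives the same
digits, so both heads stay in the same column even under random accesses. -/
noncomputable def secondAction (a : RATMAction M₂.Q M₂.A M₂.K Empty) : CompAction M₁ M₂ where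
  next := secondState M₁ M₂ a.next
  inMove := a.inMove
  workWrite := fun
    | .inr (.inl k) => (M₁.blank, a.workWrite k, none)
    | k => w k
  workMove := fun
    | .inr (.inl k) => a.workMove k
    | .inr (.inr .out) => a.inMove
    | _ => .stay
  idxWrite := fun
    | none => a.idxWrite none
    | some (.inr (.inl k)) => a.idxWrite (some k)
    | some (.inr (.inr .out)) => a.idxWrite none
    | j => x j
  idxMove := fun
    | none => a.idxMove none
    | some (.inr (.inl k)) => a.idxMove (some k)
    | some (.inr (.inr .out)) => a.idxMove none
    | _ => .stay
  emit := none

/-- A cell of the input tape of the composition holds a symbol of each of the two preprocessed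
strings. -/
abbrev CompCell (G S : Type) : Type := Option (Option G × Option S) × Option S

/-- Where `M₁` would halt, the composition goes on to the first sweep; it never halts during the
first phase. -/
noncomputable def firstDelta (q : M₁.Q) (i : CompCell G S) : CompAction M₁ M₂ :=
  match M₁.δ q (i.1.bind Prod.snd, i.2) (fun k => (w (.inl k)).1) (fun j => x (j.map .inl)) with
  | some a => firstAction M₁ M₂ w x a
  | none => .keep .forth w x

noncomputable def secondDelta (q : M₂.Q) (i : CompCell G S) : Option (CompAction M₁ M₂) :=
  (M₂.δ q (i.1.bind Prod.fst, (w (auxTape .out)).2.2) (fun k => (w (.inr (.inl k))).2.1)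
    (fun j => x (j.map fun k => .inr (.inl k)))).map (secondAction M₁ M₂ w x)

end Actions

/-- Run `M₁`, and then `M₂` with the output of `M₁` on the second track of its input tape. -/
noncomputable abbrev comp [Finite S] : RATM (CompCell G S) Empty :=
  haveI := M₁.finQ
  haveI := M₁.finA
  haveI := M₁.finK
  haveI := M₂.finQ
  haveI := M₂.finA
  haveI := M₂.finK
  { Q := CompState M₁.Q M₂.Q
    A := CompSymbol M₁ M₂
    blank := (M₁.blank, M₂.blank, none)
    K := CompTape M₁ M₂
    start := .init
    ra := .access
    acc := {q | ∃ q₂ ∈ M₂.acc, q = secondState M₁ M₂ q₂}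
    δ := fun q i w x =>
      match q with
      | .init => some (initAction M₁ M₂ w x)
      | .first q => some (firstDelta M₁ M₂ w x q i)
      | .access =>
        match x (some (auxTape .phase)) with
        | none => some (firstDelta M₁ M₂ w x M₁.ra i)
        | some false => some (phaseAction M₁ M₂ w x (secondState M₁ M₂ M₂.start) true)
        | some true => secondDelta M₁ M₂ w x M₂.ra i
      | .forth =>
        if x (some (auxTape .timer)) = some true then some (.keep .copy w x)
        else some (forthAction M₁ M₂ w x)
      | .copy =>
        if x (some (auxTape .timer)) = none then some (.keep .back w x)
        else some (copyAction M₁ M₂ w x)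
      | .back =>
        if x (some (auxTape .timer)) = some true then some (phaseAction M₁ M₂ w x .access false)
        else some (backAction M₁ M₂ w x)
      | .second q => secondDelta M₁ M₂ w x q i }

variable {M₁ M₂}
variable [Finite S]

/-- The tapes of the second machine are still unused. -/
structure Fresh (c : (comp M₁ M₂).Cfg) : Prop where
  work : ∀ k i, (c.work (.inr (.inl k)) i).2.1 = M₂.blank
  idx : ∀ k i, c.idx (some (.inr (.inl k))) i = none
  idxPos : ∀ k, c.idxPos (some (.inr (.inl k))) = 0
  idxOut : ∀ i, c.idx (some (auxTape .out)) i = none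
  idxPosOut : c.idxPos (some (auxTape .out)) = 0
  idxPosPhase : c.idxPos (some (auxTape .phase)) = 0

open Classical in
/-- The first machine has made `t` steps to the configuration `c₁`. -/
structure SimFirst (t : ℕ) (c₁ : M₁.Cfg) (c : (comp M₁ M₂).Cfg) : Prop extends Fresh c where
  state : c.state = firstState M₁ M₂ c₁.state
  inPos : c.inPos = c₁.inPos
  work₁ : ∀ k i, (c.work (.inl k) i).1 = c₁.work k i
  workPos₁ : ∀ k, c.workPos (.inl k) = c₁.workPos k
  idx₁ : ∀ j, c.idx (j.map .inl) = c₁.idx j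
  idxPos₁ : ∀ j, c.idxPos (j.map .inl) = c₁.idxPos j
  phase : c.idx (some (auxTape .phase)) 0 = none
  workPosOut : c.workPos (auxTape .out) = 0
  workOut : ∀ i, (c.work (auxTape .out) i).2.2 = none
  timer : ∀ i, c.idx (some (auxTape .timer)) i =
    if i = 0 then some true else if i ≤ t then some false else none
  timerPos : c.idxPos (some (auxTape .timer)) = t + 1
  enc : ∀ s i, c.idx (some (auxTape (.enc s))) i = if c₁.out[i]? = some s then some true else none
  encPos : ∀ s, c.idxPos (some (auxTape (.enc s))) = c₁.out.length
  idxPos_le : c₁.idxPos none ≤ t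
  idx_blank : ∀ i, t ≤ i → c₁.idx none i = none
  length_le : c₁.out.length ≤ t

open Classical in
/-- The configuration between the runs of the two machines, in the state `q`. The output of the first
machine is `z`, and it took `t` steps. -/
structure Between (t : ℕ) (z : List S) (q : CompState M₁.Q M₂.Q) (tp ip ep op : ℕ)
    (blank : ℕ → Prop) (w : ℕ → Option S) (c : (comp M₁ M₂).Cfg) : Prop extends Fresh c where
  state : c.state = q
  idx_blank : ∀ i, blank i → c.idx none i = none
  idxPosIn : c.idxPos none = ip
  phase : c.idx (some (auxTape .phase)) 0 = none
  workPosOut : c.workPos (auxTape .out) = op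
  workOut : ∀ i, (c.work (auxTape .out) i).2.2 = w i
  timer : ∀ i, c.idx (some (auxTape .timer)) i =
    if i = 0 then some true else if i ≤ t then some false else none
  timerPos : c.idxPos (some (auxTape .timer)) = tp
  enc : ∀ s i, c.idx (some (auxTape (.enc s))) i = if z[i]? = some s then some true else none
  encPos : ∀ s, c.idxPos (some (auxTape (.enc s))) = ep

/-- The second machine has reached the configuration `c₂`. -/
structure SimSecond (z : List S) (c₂ : M₂.Cfg) (c : (comp M₁ M₂).Cfg) : Prop where
  state : c.state = secondState M₁ M₂ c₂.state
  inPos : c.inPos = c₂.inPos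
  workPosOut : c.workPos (auxTape .out) = c₂.inPos
  work₂ : ∀ k i, (c.work (.inr (.inl k)) i).2.1 = c₂.work k i
  workPos₂ : ∀ k, c.workPos (.inr (.inl k)) = c₂.workPos k
  idx₂ : ∀ j, c.idx (j.map fun k => .inr (.inl k)) = c₂.idx j
  idxPos₂ : ∀ j, c.idxPos (j.map fun k => .inr (.inl k)) = c₂.idxPos j
  idxOut : c.idx (some (auxTape .out)) = c₂.idx none
  idxPosOut : c.idxPos (some (auxTape .out)) = c₂.idxPos none
  phase : c.idx (some (auxTape .phase)) 0 = some true
  idxPosPhase : c.idxPos (some (auxTape .phase)) = 0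
  workOut : ∀ i, (c.work (auxTape .out) i).2.2 = z[i]?

variable {x : ℕ → CompCell G S}

/-- Whether the state is `first q` or `access`, the blank cell of `phase` ensures that the
transition of `M₁` is consulted. -/
theorem SimFirst.delta_eq {t : ℕ} {c₁ : M₁.Cfg} {c : (comp M₁ M₂).Cfg} (h : SimFirst t c₁ c) :
    (comp M₁ M₂).δ c.state (x c.inPos) (fun k => c.work k (c.workPos k))
      (fun j => c.idx j (c.idxPos j)) =
    some (match M₁.δ c₁.state ((x c₁.inPos).1.bind Prod.snd, (x c₁.inPos).2)
        (fun k => c₁.work k (c₁.workPos k)) (fun j => c₁.idx j (c₁.idxPos j)) with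
      | some a => firstAction M₁ M₂ (fun k => c.work k (c.workPos k))
        (fun j => c.idx j (c.idxPos j)) a
      | none => .keep .forth (fun k => c.work k (c.workPos k)) (fun j => c.idx j (c.idxPos j))) := by
  have e : (comp M₁ M₂).δ c.state (x c.inPos) (fun k => c.work k (c.workPos k))
      (fun j => c.idx j (c.idxPos j)) = some (firstDelta M₁ M₂ (fun k => c.work k (c.workPos k))
      (fun j => c.idx j (c.idxPos j)) c₁.state (x c.inPos)) := by
    rw [h.state]
    unfold firstState
    split_ifs with hra
    · simp only [h.idxPosPhase, h.phase, hra]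
    · rfl
  rw [e, firstDelta, h.inPos]
  simp only [h.work₁, h.workPos₁, h.idx₁, h.idxPos₁]

theorem SimSecond.delta_eq {z : List S} {c₂ : M₂.Cfg} {c : (comp M₁ M₂).Cfg}
    (h : SimSecond z c₂ c) :
    (comp M₁ M₂).δ c.state (x c.inPos) (fun k => c.work k (c.workPos k))
      (fun j => c.idx j (c.idxPos j)) =
    (M₂.δ c₂.state ((x c₂.inPos).1.bind Prod.fst, z[c₂.inPos]?)
        (fun k => c₂.work k (c₂.workPos k)) (fun j => c₂.idx j (c₂.idxPos j))).map
      (secondAction M₁ M₂ (fun k => c.work k (c.workPos k)) (fun j => c.idx j (c.idxPos j))) := by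
  have e : (comp M₁ M₂).δ c.state (x c.inPos) (fun k => c.work k (c.workPos k))
      (fun j => c.idx j (c.idxPos j)) = secondDelta M₁ M₂ (fun k => c.work k (c.workPos k))
      (fun j => c.idx j (c.idxPos j)) c₂.state (x c.inPos) := by
    rw [h.state]
    unfold secondState
    split_ifs with hra
    · simp only [h.idxPosPhase, h.phase, hra]
    · rfl
  rw [e, secondDelta, h.inPos]
  simp only [h.work₂, h.workPos₂, h.idx₂, h.idxPos₂, h.workOut, h.workPosOut]

end RATM
end PseudoPolylog

/-! ### Simulation of the two machines and the sweeps between them -/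

namespace PseudoPolylog
namespace RATM

variable {G S : Type} {M₁ : RATM (Option S × Option S) S} {M₂ : RATM (Option G × Option S) Empty}
variable [Finite S] {x : ℕ → CompCell G S}

theorem simFirst_init :
    ∃ c, (comp M₁ M₂).step x (comp M₁ M₂).init = some c ∧ SimFirst 0 M₁.init c := by
  obtain ⟨c, hc, hst, hin, hw, hwp, hidx, hip, -⟩ :=
    RATM.step_of_some (M := comp M₁ M₂) (x := x) (c := (comp M₁ M₂).init)
      (a := initAction M₁ M₂ _ _) rfl
  refine ⟨c, hc, ⟨⟨?_, ?_, ?_, ?_, ?_, ?_⟩, ?_, ?_, ?_, ?_, ?_, ?_, ?_, ?_, ?_, ?_, ?_, ?_, ?_, ?_, ?_, ?_⟩⟩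
  · intro k i; simp [hw, initAction, RATM.init]
  · intro k i; simp [hidx, initAction, RATM.init]
  · intro k; simp [hip, initAction, RATM.init, Move.apply]
  · intro i; simp [hidx, initAction, RATM.init]
  · simp [hip, initAction, RATM.init, Move.apply]
  · simp [hip, initAction, RATM.init, Move.apply]
  · simp [hst, initAction, RATM.init]
  -- If the initial state of `M₁` is its random access state, the composition performs an access
  -- that `M₁` does not perform. All index tapes of `M₁` are blank, so the heads go to cell `0`,
  -- where they already are.
  · rw [hin]
    split_ifs with h
    · rw [indexValue_of_blank]; rfl
      intro i; simp [hidx, initAction, RATM.init]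
    · simp [initAction, RATM.init, Move.apply]
  · intro k i; simp [hw, initAction, RATM.init]
  · intro k
    rw [hwp]
    split_ifs with h
    · rw [indexValue_of_blank]; rfl
      intro i; simp [hidx, initAction, RATM.init]
    · simp [initAction, RATM.init, Move.apply]
  · rintro (_ | k) <;> funext i <;> simp [hidx, initAction, RATM.init]
  · rintro (_ | k) <;> simp [hip, initAction, RATM.init, Move.apply]
  · simp [hidx, initAction, RATM.init]
  · rw [hwp]
    split_ifs with h
    · rw [indexValue_of_blank]
      intro i; simp [hidx, initAction, RATM.init]
    · simp [initAction, RATM.init, Move.apply]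
  · intro i; simp [hw, initAction, RATM.init]
  · intro i; simp only [hidx, initAction, RATM.init, Function.update_apply]; grind
  · simp [hip, initAction, RATM.init, Move.apply]
  · intro s i; simp [hidx, initAction, RATM.init]
  · intro s; simp [hip, initAction, RATM.init, Move.apply]
  · simp [RATM.init]
  · simp [RATM.init]
  · simp [RATM.init]

theorem Move.apply_le (m : Move) (p : ℕ) : m.apply p ≤ p + 1 := by
  cases m <;> simp [Move.apply]; omega

theorem SimFirst.step {t : ℕ} {c₁ c₁' : M₁.Cfg} {c : (comp M₁ M₂).Cfg} (h : SimFirst t c₁ c)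
    (hs : M₁.step (fun i => ((x i).1.bind Prod.snd, (x i).2)) c₁ = some c₁') :
    ∃ c', (comp M₁ M₂).step x c = some c' ∧ SimFirst (t + 1) c₁' c' := by
  have hδ := h.delta_eq (x := x)
  cases ha : M₁.δ c₁.state ((x c₁.inPos).1.bind Prod.snd, (x c₁.inPos).2)
        (fun k => c₁.work k (c₁.workPos k)) (fun j => c₁.idx j (c₁.idxPos j)) with
  | none => rw [RATM.step, ha] at hs; cases hs
  | some a =>
  obtain ⟨c₁'', hc₁, hst₁, hin₁, hw₁, hwp₁, hidx₁, hip₁, hout₁⟩ :=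
    RATM.step_of_some (M := M₁) (x := fun i => ((x i).1.bind Prod.snd, (x i).2)) ha
  obtain rfl : c₁'' = c₁' := Option.some_injective _ (hc₁.symm.trans hs)
  rw [ha] at hδ
  obtain ⟨c', hc, hst, hin, hw, hwp, hidx, hip, -⟩ :=
    RATM.step_of_some (M := comp M₁ M₂) (x := x) (c := c) (a := firstAction M₁ M₂ _ _ a) hδ
  replace hin : c'.inPos = open Classical in if a.next = M₁.ra then indexValue (c'.idx none)
      else a.inMove.apply c.inPos := by
    rw [hin]
    classical exact if_congr (firstState_eq_access M₁ M₂) rfl rfl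
  replace hwp : ∀ k, c'.workPos k = open Classical in
      if a.next = M₁.ra then indexValue (c'.idx (some k))
        else ((firstAction M₁ M₂ (fun k => c.work k (c.workPos k))
          (fun j => c.idx j (c.idxPos j)) a).workMove k).apply (c.workPos k) := by
    intro k
    rw [hwp]
    classical exact if_congr (firstState_eq_access M₁ M₂) rfl rfl
  have hI : ∀ j : Option M₁.K, c'.idx (j.map .inl) = c₁''.idx j := by
    intro j
    rw [hidx, hidx₁, h.idx₁, h.idxPos₁]
    cases j <;> rfl
  have hI0 : c'.idx none = c₁''.idx none := hI none
  have hO : ∀ i, c'.idx (some (auxTape .out)) i = none := by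
    intro i
    simp [hidx, firstAction, h.idxOut, h.idxPosOut, Function.update_apply]
  refine ⟨c', hc, ⟨⟨?_, ?_, ?_, hO, ?_, ?_⟩, ?_, ?_, ?_, ?_, hI, ?_, ?_, ?_, ?_, ?_, ?_, ?_, ?_, ?_, ?_, ?_⟩⟩
  · intro k i; simp [hw, firstAction, Function.update_apply, h.work, apply_ite]
  · intro k i; simp [hidx, firstAction, h.idx, Function.update_apply]
  · intro k; simp [hip, firstAction, Move.apply, h.idxPos]
  · simp [hip, firstAction, Move.apply, h.idxPosOut]
  · simp [hip, firstAction, Move.apply, h.idxPosPhase]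
  · simp [hst, hst₁, firstAction]
  · simp [hin, hin₁, hI0, h.inPos]
  · intro k i
    simp only [hw, hw₁, firstAction, Function.update_apply, h.workPos₁]
    split_ifs
    · rfl
    · exact h.work₁ k i
  · intro k
    have := hI (some k)
    simp only [Option.map_some] at this
    simp [hwp, hwp₁, firstAction, this, h.workPos₁]
  · intro j
    rw [hip, hip₁, h.idxPos₁]
    cases j <;> rfl
  · simp [hidx, firstAction, h.phase, h.idxPosPhase]
  -- The index tape of `out` is still blank, so accesses of `M₁` can only send the head of `out` to
  -- cell `0`.
  · rw [hwp, indexValue_of_blank hO, h.workPosOut]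
    simp [firstAction, Move.apply]
  · intro i
    simp only [hw, firstAction, Function.update_apply]
    split_ifs
    · exact h.workOut _
    · exact h.workOut _
  · intro i
    rw [hidx, h.timerPos, Function.update_apply, h.timer]
    simp only [firstAction]
    split_ifs <;> first | rfl | omega
  · simp [hip, firstAction, h.timerPos, Move.apply]
  · intro s i
    rw [hidx, Function.update_apply, h.enc, h.encPos, hout₁]
    simp only [firstAction, h.encPos]
    rcases he : a.emit with _ | b
    · simp only [reduceCtorEq, if_false, Option.toList_none, List.append_nil, h.enc]
      split_ifs <;> simp_all
    · simp [h.enc, List.getElem?_append]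
      split_ifs <;> grind
  · intro s
    rw [hip, h.encPos, hout₁]
    simp only [firstAction]
    cases a.emit <;> simp [Move.apply]
  · rw [hip₁]
    exact (Move.apply_le _ _).trans (Nat.succ_le_succ h.idxPos_le)
  -- The cell written in this step has number at most `t`, so everything from `t + 1` on remains
  -- blank. This makes the timer long enough for the erasing sweeps.
  · intro i hi
    have := h.idxPos_le
    rw [hidx₁, Function.update_apply, if_neg (by omega)]
    exact h.idx_blank i (by omega)
  · have := h.length_le
    rw [hout₁, List.length_append]
    cases a.emit <;> simp <;> omega

theorem SimFirst.between {t : ℕ} {c₁ : M₁.Cfg} {c : (comp M₁ M₂).Cfg} (h : SimFirst t c₁ c)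
    (hs : M₁.step (fun i => ((x i).1.bind Prod.snd, (x i).2)) c₁ = none) :
    ∃ c', (comp M₁ M₂).step x c = some c' ∧ c₁.idxPos none ≤ t ∧ c₁.out.length ≤ t ∧
      Between t c₁.out .forth (t + 1) (c₁.idxPos none) c₁.out.length 0 (fun i => t ≤ i)
        (fun _ => none) c' := by
  have hδ := h.delta_eq (x := x)
  have ha : M₁.δ c₁.state ((x c₁.inPos).1.bind Prod.snd, (x c₁.inPos).2)
        (fun k => c₁.work k (c₁.workPos k)) (fun j => c₁.idx j (c₁.idxPos j)) = none := by
    simpa [RATM.step] using hs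
  rw [ha] at hδ
  obtain ⟨c', hc, hst, -, hw, hwp, hidx, hip, -⟩ :=
    RATM.step_of_some (a := .keep _ _ _) hδ
  have hidx' : ∀ j, c'.idx j = c.idx j := fun j => by simp [hidx]
  have hip' : ∀ j, c'.idxPos j = c.idxPos j := fun j => by simp [hip, Move.apply]
  have hw' : ∀ k, c'.work k = c.work k := fun k => by simp [hw]
  have hwp' : ∀ k, c'.workPos k = c.workPos k := fun k => by simp [hwp, Move.apply]
  have h0 : c.idx none = c₁.idx none := h.idx₁ none
  have h1 : c.idxPos none = c₁.idxPos none := h.idxPos₁ none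
  refine ⟨c', hc, h.idxPos_le, h.length_le, ⟨⟨?_, ?_, ?_, ?_, ?_, ?_⟩, ?_, ?_, ?_, ?_, ?_, ?_, ?_, ?_, ?_, ?_⟩⟩ <;>
    simp only [hidx', hip', hw', hwp', hst, RATMAction.keep_next, h0, h1]
  exacts [h.work, h.idx, h.idxPos, h.idxOut, h.idxPosOut, h.idxPosPhase, h.idx_blank, h.phase,
    h.workPosOut, h.workOut, h.timer, h.timerPos, h.enc, h.encPos]

theorem Between.keep {t : ℕ} {z : List S} {q q' : CompState M₁.Q M₂.Q} {tp ip ep op : ℕ}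
    {blank : ℕ → Prop} {w : ℕ → Option S} {c : (comp M₁ M₂).Cfg}
    (h : Between t z q tp ip ep op blank w c) (hq : q' ≠ .access)
    (hδ : (comp M₁ M₂).δ q (x c.inPos) (fun k => c.work k (c.workPos k))
      (fun j => c.idx j (c.idxPos j)) = some (.keep q' (fun k => c.work k (c.workPos k))
      (fun j => c.idx j (c.idxPos j)))) :
    ∃ c', (comp M₁ M₂).step x c = some c' ∧ Between t z q' tp ip ep op blank w c' := by
  rw [← h.state] at hδ
  obtain ⟨c', hc, hst, -, hw, hwp, hidx, hip, -⟩ := RATM.step_of_some hδ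
  have hidx' : ∀ j, c'.idx j = c.idx j := fun j => by simp [hidx]
  have hip' : ∀ j, c'.idxPos j = c.idxPos j := fun j => by simp [hip, Move.apply]
  have hw' : ∀ k, c'.work k = c.work k := fun k => by simp [hw]
  have hwp' : ∀ k, c'.workPos k = c.workPos k := fun k => by simp [hwp, Move.apply, hq]
  refine ⟨c', hc, ⟨⟨?_, ?_, ?_, ?_, ?_, ?_⟩, ?_, ?_, ?_, ?_, ?_, ?_, ?_, ?_, ?_, ?_⟩⟩ <;>
    simp only [hidx', hip', hw', hwp', hst, RATMAction.keep_next]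
  exacts [h.work, h.idx, h.idxPos, h.idxOut, h.idxPosOut, h.idxPosPhase, h.idx_blank, h.idxPosIn,
    h.phase, h.workPosOut, h.workOut, h.timer, h.timerPos, h.enc, h.encPos]

/-- Timer position `tp + 1` is not the marked cell `0`, so the sweep continues. The truncated `ep -
1` lets the heads of the record wait at cell `0` once they have arrived. -/
theorem Between.forth {t : ℕ} {z : List S} {tp ip ep : ℕ}
    {blank : ℕ → Prop} {w : ℕ → Option S} {c : (comp M₁ M₂).Cfg}
    (h : Between t z .forth (tp + 1) ip ep 0 blank w c) :
    ∃ c', (comp M₁ M₂).step x c = some c' ∧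
      Between t z .forth tp (ip + 1) (ep - 1) 0 blank w c' := by
  have hδ : (comp M₁ M₂).δ .forth (x c.inPos) (fun k => c.work k (c.workPos k))
      (fun j => c.idx j (c.idxPos j)) = some (forthAction M₁ M₂ (fun k => c.work k (c.workPos k))
      (fun j => c.idx j (c.idxPos j))) := by
    refine if_neg ?_
    beta_reduce
    rw [h.timerPos, h.timer]
    split_ifs <;> simp_all
  rw [← h.state] at hδ
  obtain ⟨c', hc, hst, -, hw, hwp, hidx, hip, -⟩ := RATM.step_of_some hδ
  have hidx' : ∀ j, c'.idx j = c.idx j := fun j => by simp [hidx, forthAction]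
  have hw' : ∀ k, c'.work k = c.work k := fun k => by simp [hw, forthAction]
  have hwp' : ∀ k, c'.workPos k = c.workPos k := fun k => by simp [hwp, Move.apply, forthAction]
  refine ⟨c', hc, ⟨⟨?_, ?_, ?_, ?_, ?_, ?_⟩, ?_, ?_, ?_, ?_, ?_, ?_, ?_, ?_, ?_, ?_⟩⟩ <;>
    try simp only [hidx', hip, hw', hwp', hst, forthAction, RATMAction.keep_next, Move.apply,
      h.idxPosIn, h.timerPos, h.encPos]
  exacts [h.work, h.idx, h.idxPos, h.idxOut, h.idxPosOut, h.idxPosPhase, h.idx_blank,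
    h.phase, h.workPosOut, h.workOut, h.timer, rfl, h.enc, fun _ => trivial]

/-- For `i ≤ t` the timer cell is not blank, so the sweep continues. Beyond the end of `z` the
decoded symbol is `none`, the blank of `out`. -/
theorem Between.copy {t : ℕ} {z : List S} {i ip : ℕ}
    {blank : ℕ → Prop} {w : ℕ → Option S} {c : (comp M₁ M₂).Cfg} (hi : i ≤ t)
    (h : Between t z .copy i ip i i blank w c) :
    ∃ c', (comp M₁ M₂).step x c = some c' ∧
      Between t z .copy (i + 1) (ip - 1) (i + 1) (i + 1) (fun j => blank j ∨ j = ip)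
        (Function.update w i z[i]?) c' := by
  have hδ : (comp M₁ M₂).δ .copy (x c.inPos) (fun k => c.work k (c.workPos k))
      (fun j => c.idx j (c.idxPos j)) = some (copyAction M₁ M₂ (fun k => c.work k (c.workPos k))
      (fun j => c.idx j (c.idxPos j))) := by
    refine if_neg ?_
    beta_reduce
    rw [h.timerPos, h.timer]
    split_ifs <;> simp_all
  rw [← h.state] at hδ
  obtain ⟨c', hc, hst, -, hw, hwp, hidx, hip, -⟩ := RATM.step_of_some hδ
  have hidx' : ∀ j, c'.idx (some j) = c.idx (some j) := fun j => by simp [hidx, copyAction]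
  refine ⟨c', hc, ⟨⟨?_, ?_, ?_, ?_, ?_, ?_⟩, ?_, ?_, ?_, ?_, ?_, ?_, ?_, ?_, ?_, ?_⟩⟩ <;>
    try simp only [hidx', hip, hwp, hst, copyAction, RATMAction.keep_next, Move.apply,
      h.idxPosIn, h.timerPos, h.encPos]
  · intro k i; simp [hw, copyAction, h.work]
  · exact h.idx
  · exact h.idxPos
  · exact h.idxOut
  · exact h.idxPosOut
  · exact h.idxPosPhase
  · intro j hj
    simp only [hidx, copyAction, h.idxPosIn, Function.update_apply]
    split_ifs with e
    · rfl
    · exact h.idx_blank j (hj.resolve_right e)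
  · exact h.phase
  · simp [h.workPosOut]
  · intro j
    simp only [hw, copyAction, h.workPosOut, Function.update_apply, h.enc, h.encPos,
      decodeSymbol_eq]
    split_ifs
    · rfl
    · exact h.workOut j
  · exact h.timer
  · exact h.enc
  · intro _; trivial

theorem Between.back {t : ℕ} {z : List S} {tp ip ep op : ℕ}
    {blank : ℕ → Prop} {w : ℕ → Option S} {c : (comp M₁ M₂).Cfg}
    (h : Between t z .back (tp + 1) ip ep op blank w c) :
    ∃ c', (comp M₁ M₂).step x c = some c' ∧
      Between t z .back tp (ip - 1) ep op (fun j => blank j ∨ j = ip) w c' := by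
  have hδ : (comp M₁ M₂).δ .back (x c.inPos) (fun k => c.work k (c.workPos k))
      (fun j => c.idx j (c.idxPos j)) = some (backAction M₁ M₂ (fun k => c.work k (c.workPos k))
      (fun j => c.idx j (c.idxPos j))) := by
    refine if_neg ?_
    beta_reduce
    rw [h.timerPos, h.timer]
    split_ifs <;> simp_all
  rw [← h.state] at hδ
  obtain ⟨c', hc, hst, -, hw, hwp, hidx, hip, -⟩ := RATM.step_of_some hδ
  have hidx' : ∀ j, c'.idx (some j) = c.idx (some j) := fun j => by simp [hidx, backAction]
  have hw' : ∀ k, c'.work k = c.work k := fun k => by simp [hw, backAction]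
  have hwp' : ∀ k, c'.workPos k = c.workPos k := fun k => by simp [hwp, Move.apply, backAction]
  refine ⟨c', hc, ⟨⟨?_, ?_, ?_, ?_, ?_, ?_⟩, ?_, ?_, ?_, ?_, ?_, ?_, ?_, ?_, ?_, ?_⟩⟩ <;>
    try simp only [hidx', hip, hw', hwp', hst, backAction, RATMAction.keep_next, Move.apply,
      h.idxPosIn, h.timerPos, h.encPos]
  · exact h.work
  · exact h.idx
  · exact h.idxPos
  · exact h.idxOut
  · exact h.idxPosOut
  · exact h.idxPosPhase
  · intro j hj
    simp only [hidx, backAction, h.idxPosIn, Function.update_apply]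
    split_ifs with e
    · rfl
    · exact h.idx_blank j (hj.resolve_right e)
  · exact h.phase
  · exact h.workPosOut
  · exact h.workOut
  · exact h.timer
  · rfl
  · exact h.enc
  · intro _; trivial

/-- The heads are reset by a random access, and the second machine starts. -/
theorem Between.start {t : ℕ} {z : List S} {ep op : ℕ} {c : (comp M₁ M₂).Cfg}
    (h : Between t z .back 0 0 ep op (fun _ => True) (fun i => z[i]?) c) :
    ∃ c', StepsIn ((comp M₁ M₂).step x) 2 c c' ∧ SimSecond z M₂.init c' := by
  have hδ : (comp M₁ M₂).δ .back (x c.inPos) (fun k => c.work k (c.workPos k))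
      (fun j => c.idx j (c.idxPos j)) = some (phaseAction M₁ M₂ (fun k => c.work k (c.workPos k))
      (fun j => c.idx j (c.idxPos j)) .access false) := by
    refine if_pos ?_
    beta_reduce
    rw [h.timerPos, h.timer, if_pos rfl]
  rw [← h.state] at hδ
  obtain ⟨c', hc, hst, hin, hw, hwp, hidx, hip, -⟩ := RATM.step_of_some hδ
  have hwk : ∀ k, c'.work k = c.work k := fun k => by simp [hw, phaseAction]
  have hip' : ∀ k, c'.idxPos k = c.idxPos k := fun k => by simp [hip, Move.apply, phaseAction]
  have hI : ∀ i, c'.idx none i = none := fun i => by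
    simp [hidx, Function.update_apply, phaseAction, h.idx_blank _ trivial]
  have hO : ∀ i, c'.idx (some (auxTape .out)) i = none := fun i => by
    simp [hidx, Function.update_apply, phaseAction, h.idxOut]
  have hK : ∀ k i, c'.idx (some (.inr (.inl k))) i = none := fun k i => by
    simp [hidx, Function.update_apply, phaseAction, h.idx]
  have hP : c'.idx (some (auxTape .phase)) 0 = some false := by
    simp [hidx, phaseAction, h.idxPosPhase]
  simp only [phaseAction, RATMAction.keep_next, if_true] at hin hwp hst
  have hδ' : (comp M₁ M₂).δ .access (x c'.inPos) (fun k => c'.work k (c'.workPos k))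
      (fun j => c'.idx j (c'.idxPos j)) = some (phaseAction M₁ M₂ (fun k => c'.work k (c'.workPos k))
      (fun j => c'.idx j (c'.idxPos j)) (secondState M₁ M₂ M₂.start) true) := by
    simp only [hip', h.idxPosPhase, hP]
  rw [← hst] at hδ'
  obtain ⟨c₂, hc₂, hst₂, hin₂, hw₂, hwp₂, hidx₂, hip₂, -⟩ := RATM.step_of_some hδ'
  have hI₂ : ∀ i, c₂.idx none i = none := fun i => by simp [hidx₂, Function.update_apply, phaseAction, hI]
  have hO₂ : ∀ i, c₂.idx (some (auxTape .out)) i = none := fun i => by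
    simp [hidx₂, Function.update_apply, phaseAction, hO]
  have hK₂ : ∀ k i, c₂.idx (some (.inr (.inl k))) i = none := fun k i => by
    simp [hidx₂, Function.update_apply, phaseAction, hK]
  have hip₂' : ∀ k, c₂.idxPos k = c.idxPos k := fun k => by
    simp [hip₂, Move.apply, phaseAction, hip']
  have hwk₂ : ∀ k, c₂.work k = c.work k := fun k => by simp [hw₂, phaseAction, hwk]
  refine ⟨c₂, .head hc (.single hc₂), ⟨?_, ?_, ?_, ?_, ?_, ?_, ?_, ?_, ?_, ?_, ?_, ?_⟩⟩ <;>
    try simp only [hip₂', hwk₂]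
  · exact hst₂
  -- The head has just been sent to cell `0`. The change to the initial state of `M₂` may count as
  -- another random access, which leads to cell `0` again because the index tape is blank.
  · rw [hin₂, indexValue_of_blank hI₂, hin, indexValue_of_blank hI]
    split_ifs <;> rfl
  · rw [hwp₂, indexValue_of_blank hO₂, hwp, indexValue_of_blank hO]
    split_ifs <;> rfl
  · exact h.work
  · intro k
    rw [hwp₂, indexValue_of_blank (hK₂ k), hwp, indexValue_of_blank (hK k)]
    split_ifs <;> rfl
  · rintro (_ | k) <;> funext i
    · exact hI₂ i
    · exact hK₂ k i
  · rintro (_ | k)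
    · exact h.idxPosIn
    · exact h.idxPos k
  · funext i; exact hO₂ i
  · exact h.idxPosOut
  · simp [hidx₂, phaseAction, hip', h.idxPosPhase]
  · exact h.idxPosPhase
  · exact h.workOut

theorem SimSecond.step {z : List S} {c₂ c₂' : M₂.Cfg} {c : (comp M₁ M₂).Cfg}
    (h : SimSecond z c₂ c)
    (hs : M₂.step (fun i => ((x i).1.bind Prod.fst, z[i]?)) c₂ = some c₂') :
    ∃ c', (comp M₁ M₂).step x c = some c' ∧ SimSecond z c₂' c' := by
  have hδ := h.delta_eq (x := x)
  cases ha : M₂.δ c₂.state ((x c₂.inPos).1.bind Prod.fst, z[c₂.inPos]?)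
        (fun k => c₂.work k (c₂.workPos k)) (fun j => c₂.idx j (c₂.idxPos j)) with
  | none => rw [RATM.step, ha] at hs; cases hs
  | some a =>
  obtain ⟨c₂'', hc₂, hst₂, hin₂, hw₂, hwp₂, hidx₂, hip₂, hout₂⟩ :=
    RATM.step_of_some (M := M₂) (x := fun i => ((x i).1.bind Prod.fst, z[i]?)) ha
  obtain rfl : c₂'' = c₂' := Option.some_injective _ (hc₂.symm.trans hs)
  rw [ha] at hδ
  obtain ⟨c', hc, hst, hin, hw, hwp, hidx, hip, -⟩ :=
    RATM.step_of_some (M := comp M₁ M₂) (x := x) (c := c) (a := secondAction M₁ M₂ _ _ a) hδ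
  replace hin : c'.inPos = open Classical in if a.next = M₂.ra then indexValue (c'.idx none)
      else a.inMove.apply c.inPos := by
    rw [hin]
    classical exact if_congr (secondState_eq_access M₁ M₂) rfl rfl
  replace hwp : ∀ k, c'.workPos k = open Classical in
      if a.next = M₂.ra then indexValue (c'.idx (some k))
        else ((secondAction M₁ M₂ (fun k => c.work k (c.workPos k))
          (fun j => c.idx j (c.idxPos j)) a).workMove k).apply (c.workPos k) := by
    intro k
    rw [hwp]
    classical exact if_congr (secondState_eq_access M₁ M₂) rfl rfl
  have hI : ∀ j : Option M₂.K, c'.idx (j.map fun k => .inr (.inl k)) = c₂''.idx j := by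
    intro j
    rw [hidx, hidx₂, h.idx₂, h.idxPos₂]
    cases j <;> rfl
  have hI0 : c'.idx none = c₂''.idx none := hI none
  have hO : c'.idx (some (auxTape .out)) = c₂''.idx none := by
    rw [hidx, hidx₂, h.idxOut, h.idxPosOut]
    rfl
  refine ⟨c', hc, ⟨?_, ?_, ?_, ?_, ?_, hI, ?_, hO, ?_, ?_, ?_, ?_⟩⟩
  · simp [hst, hst₂, secondAction]
  · simp [hin, hin₂, hI0, h.inPos]
  -- The two heads agree after an access because the index tapes of `out` and of the input agree.
  · simp [hwp, hin₂, secondAction, hO, h.workPosOut]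
  · intro k i
    simp only [hw, hw₂, secondAction, Function.update_apply, h.workPos₂]
    split_ifs
    · rfl
    · exact h.work₂ k i
  · intro k
    have := hI (some k)
    simp only [Option.map_some] at this
    simp [hwp, hwp₂, secondAction, this, h.workPos₂]
  · intro j
    rw [hip, hip₂, h.idxPos₂]
    cases j <;> rfl
  · rw [hip, hip₂, h.idxPosOut]
    rfl
  · simp [hidx, secondAction, h.phase, h.idxPosPhase]
  · simp [hip, secondAction, Move.apply, h.idxPosPhase]
  · intro i
    simp only [hw, secondAction, Function.update_apply]
    split_ifs with e
    · rw [e]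
      exact h.workOut _
    · exact h.workOut _

-- Needed to read off acceptance: the accepting states of the composition are the images of those of
-- `M₂`.
omit [Finite S] in
theorem secondState_injective : Function.Injective (secondState M₁ M₂) := by
  intro p q h
  unfold secondState at h
  split_ifs at h <;> simp_all

/-- The composition decides what the second machine decides on the output of the first one. -/
theorem comp_decidesWithin {z : List S} {t₁ t₂ : ℕ} {p : Prop}
    (h₁ : M₁.OutputsWithin (fun i => ((x i).1.bind Prod.snd, (x i).2)) z t₁)
    (h₂ : M₂.DecidesWithin (fun i => ((x i).1.bind Prod.fst, z[i]?)) p t₂) :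
    (comp M₁ M₂).DecidesWithin x p (4 * t₁ + t₂ + 9) := by
  obtain ⟨c₁, hh₁, rfl⟩ := h₁
  obtain ⟨c₂, hh₂, hp⟩ := h₂
  obtain ⟨⟨n₁, hn₁, hr₁⟩, hend₁⟩ := haltsWithin_iff.1 hh₁
  obtain ⟨⟨n₂, hn₂, hr₂⟩, hend₂⟩ := haltsWithin_iff.1 hh₂
  obtain ⟨a₀, ha₀, hs₀⟩ := simFirst_init (M₁ := M₁) (M₂ := M₂) (x := x)
  obtain ⟨a₁, ha₁, hs₁⟩ := StepsIn.simulate (R := SimFirst) (fun i a b a' h e => h.step e) hs₀ hr₁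
  rw [Nat.zero_add] at hs₁
  obtain ⟨a₂, ha₂, hip, hlen, hs₂⟩ := hs₁.between hend₁
  set ip := c₁.idxPos none with hip_def
  set z := c₁.out with hz
  -- The timer head walks from cell `n₁ + 1` to cell `0`. As the length of `z` is at most `n₁`, the
  -- heads of the record have also reached cell `0`.
  obtain ⟨a₃, ha₃, hs₃⟩ := StepsIn.of_invariant (step := (comp M₁ M₂).step x) (n := n₁ + 1)
    (P := fun i => Between n₁ z .forth (n₁ + 1 - i) (ip + i) (z.length - i) 0 (fun i => n₁ ≤ i)
      fun _ => none)
    (fun i hi c hc => by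
      obtain ⟨tp, htp⟩ : ∃ tp, n₁ + 1 - i = tp + 1 := ⟨n₁ - i, by omega⟩
      rw [htp] at hc
      obtain ⟨c', hc', h⟩ := hc.forth (x := x)
      refine ⟨c', hc', ?_⟩
      convert h using 1 <;> omega) (c := a₂) hs₂
  rw [Nat.sub_self, show z.length - (n₁ + 1) = 0 by omega] at hs₃
  obtain ⟨a₄, ha₄, hs₄⟩ := hs₃.keep (x := x) (q' := .copy) (by simp)
    (if_pos (by beta_reduce; rw [hs₃.timerPos, hs₃.timer, if_pos rfl]))
  -- Cells from `n₁` on were never written by `M₁`; the second disjunct describes the cells to the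
  -- right of the current head, where this sweep has erased. The timer head moves from cell `0` to
  -- the first blank, cell `n₁ + 1`.
  obtain ⟨a₅, ha₅, hs₅⟩ := StepsIn.of_invariant (step := (comp M₁ M₂).step x) (n := n₁ + 1)
    (P := fun i => Between n₁ z .copy i (ip + (n₁ + 1) - i) i i
      (fun j => n₁ ≤ j ∨ ip + (n₁ + 1) < i + j) fun j => if j < i then z[j]? else none)
    (fun i hi c hc => by
      obtain ⟨c', hc', h⟩ := hc.copy (x := x) (by omega)
      refine ⟨c', hc', ?_⟩
      convert h using 1
      · omega
      · funext j
        apply propext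
        omega
      · funext j
        simp only [Function.update_apply]
        split_ifs <;> first | rfl | omega | (subst_vars; rfl)) (c := a₄) (by
      convert hs₄ using 1
      · omega
      · funext j
        apply propext
        omega
      · simp)
  obtain ⟨a₆, ha₆, hs₆⟩ := hs₅.keep (x := x) (q' := .back) (by simp)
    (if_pos (by beta_reduce; rw [hs₅.timerPos, hs₅.timer, if_neg (by omega), if_neg (by omega)]))
  -- All cells beyond `ip` are blank by now. Since `ip ≤ n₁`, another `n₁ + 1` steps erase the
  -- remaining ones and reach cell `0`.
  obtain ⟨a₇, ha₇, hs₇⟩ := StepsIn.of_invariant (step := (comp M₁ M₂).step x) (n := n₁ + 1)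
    (P := fun i => Between n₁ z .back (n₁ + 1 - i) (ip - i) (n₁ + 1) (n₁ + 1)
      (fun j => ip < i + j) fun j => z[j]?)
    (fun i hi c hc => by
      obtain ⟨tp, htp⟩ : ∃ tp, n₁ + 1 - i = tp + 1 := ⟨n₁ - i, by omega⟩
      rw [htp] at hc
      obtain ⟨c', hc', h⟩ := hc.back (x := x)
      refine ⟨c', hc', ?_⟩
      have e₁ : n₁ + 1 - (i + 1) = tp := by omega
      have e₂ : ip - (i + 1) = ip - i - 1 := by omega
      rw [e₁, e₂]
      exact { h with idx_blank := fun j hj => h.idx_blank j (by omega) }) (c := a₆) (by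
      have e : ip + (n₁ + 1) - (n₁ + 1) = ip := by omega
      rw [e] at hs₆
      exact { hs₆ with
        idx_blank := fun j hj => hs₆.idx_blank j (by omega)
        workOut := fun j => by
          rw [hs₆.workOut]
          split_ifs with hj
          · rfl
          · rw [List.getElem?_eq_none (by omega)] })
  rw [Nat.sub_self, show ip - (n₁ + 1) = 0 by omega] at hs₇
  obtain ⟨a₈, ha₈, hs₈⟩ := Between.start (x := x)
    { hs₇ with idx_blank := fun j _ => hs₇.idx_blank j (by omega) }
  obtain ⟨a₉, ha₉, hs₉⟩ := StepsIn.simulate (R := fun _ => SimSecond z)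
    (fun i a b a' h e => h.step e) (i := 0) hs₈ hr₂
  refine ⟨a₉, haltsWithin_iff.2 ⟨⟨_, ?_, (StepsIn.single ha₀).trans <| ha₁.trans <|
    (StepsIn.single ha₂).trans <| ha₃.trans <| (StepsIn.single ha₄).trans <| ha₅.trans <|
    (StepsIn.single ha₆).trans <| ha₇.trans <| ha₈.trans ha₉⟩, ?_⟩, ?_⟩
  -- Four terms `n₁` come from the run of `M₁` and the three sweeps. The constant is `1` for the
  -- start, `1` for leaving `M₁`, `3` for the extra step of each sweep, `2` for the changes between
  -- sweeps and `2` for starting `M₂`.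
  · omega
  · rw [RATM.step, hs₉.delta_eq]
    have : M₂.δ c₂.state ((x c₂.inPos).1.bind Prod.fst, z[c₂.inPos]?)
        (fun k => c₂.work k (c₂.workPos k)) (fun j => c₂.idx j (c₂.idxPos j)) = none := by
      simpa [RATM.step] using hend₂
    rw [this]
    rfl
  · rw [← hp, hs₉.state]
    constructor
    · rintro ⟨q, hq, e⟩
      rwa [secondState_injective e]
    · exact fun h => ⟨_, h, rfl⟩

end RATM
end PseudoPolylog

namespace PseudoPolylog

open Turing Function

/-! ### Program fragments for machines with stacks -/

theorem StepsIn.congr_right {C : Type*} {step : C → Option C} {n : ℕ} {a b b' : C}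
    (h : StepsIn step n a b) (e : b = b') : StepsIn step n a b' :=
  e ▸ h

section Relabel

variable {K : Type} [DecidableEq K] {Γ : K → Type} {σ L L' : Type}

/-- Rename the labels, and continue at `e` instead of halting. -/
def relabel (g : L → L') (e : Option L') : TM2.Stmt Γ L σ → TM2.Stmt Γ L' σ
  | .push k f q => .push k f (relabel g e q)
  | .peek k f q => .peek k f (relabel g e q)
  | .pop k f q => .pop k f (relabel g e q)
  | .load f q => .load f (relabel g e q)
  | .branch f q₁ q₂ => .branch f (relabel g e q₁) (relabel g e q₂)
  | .goto f => .goto fun v => g (f v)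
  | .halt => match e with
    | some l => .goto fun _ => l
    | none => .halt

def relabelCfg (g : L → L') (e : Option L') (c : TM2.Cfg Γ L σ) : TM2.Cfg Γ L' σ :=
  ⟨c.l.elim e fun l => some (g l), c.var, c.stk⟩

theorem stepAux_relabel (g : L → L') (e : Option L') (q : TM2.Stmt Γ L σ) (v : σ)
    (S : ∀ k, List (Γ k)) :
    TM2.stepAux (relabel g e q) v S = relabelCfg g e (TM2.stepAux q v S) := by
  induction q generalizing v S with
  | branch f q₁ q₂ h₁ h₂ =>
    simp only [relabel, TM2.stepAux, h₁, h₂]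
    cases f v <;> rfl
  | goto f => rfl
  | halt => cases e <;> rfl
  | _ => simp_all [relabel, TM2.stepAux]

/-- Runs of a fragment carry over to any program that contains a relabelled copy of it; halting
becomes arrival at the continuation `e`. All sequencing rules rest on this. -/
theorem StepsIn.relabel {code : L → TM2.Stmt Γ L σ} {code' : L' → TM2.Stmt Γ L' σ} {g : L → L'}
    {e : Option L'} (h : ∀ l, code' (g l) = PseudoPolylog.relabel g e (code l)) {n : ℕ}
    {c c' : TM2.Cfg Γ L σ} (hc : StepsIn (TM2.step code) n c c') :
    StepsIn (TM2.step code') n (relabelCfg g e c) (relabelCfg g e c') := by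
  refine hc.map ?_
  rintro ⟨_ | l, v, S⟩ a' ha
  · cases ha
  · cases ha
    change some (TM2.stepAux (code' (g l)) v S) = _
    rw [h, stepAux_relabel]

end Relabel

section PushOption

variable {K : Type} [DecidableEq K] {Γ : K → Type} {σ L : Type}

open Classical in
/-- Push a symbol if there is one. -/
noncomputable def pushOption (k : K) (f : σ → Option (Γ k)) (q : TM2.Stmt Γ L σ) :
    TM2.Stmt Γ L σ :=
  if h : Nonempty (Γ k) then
    .branch (fun v => (f v).isSome) (.push k (fun v => (f v).getD h.some) q) q
  else q

@[simp]
theorem stepAux_pushOption (k : K) (f : σ → Option (Γ k)) (q : TM2.Stmt Γ L σ) (v : σ)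
    (S : ∀ k, List (Γ k)) :
    TM2.stepAux (pushOption k f q) v S =
      TM2.stepAux q v (update S k ((f v).toList ++ S k)) := by
  unfold pushOption
  split_ifs with h
  · cases hf : f v <;> simp [hf]
  · cases hf : f v with
    | none => simp
    | some a => exact absurd ⟨a⟩ h

end PushOption

/-- A program fragment for a machine with the stacks `K`. It ends by halting. -/
structure Frag {K : Type} (Γ : K → Type) (σ : Type) where
  L : Type
  [finL : Finite L]
  entry : L
  code : L → TM2.Stmt Γ L σ

namespace Frag

variable {K : Type} [DecidableEq K] {Γ : K → Type} {σ : Type}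

/-- The contents of the internal memory and of the stacks. -/
abbrev Store (Γ : K → Type) (σ : Type) : Type := σ × ∀ k, List (Γ k)

/-- `F` leads from `s` to `s'` in at most `t` steps. -/
def Runs (F : Frag Γ σ) (s s' : Store Γ σ) (t : ℕ) : Prop :=
  ∃ n ≤ t, StepsIn (TM2.step F.code) n ⟨some F.entry, s.1, s.2⟩ ⟨none, s'.1, s'.2⟩

theorem Runs.mono {F : Frag Γ σ} {s s' : Store Γ σ} {t t' : ℕ} (h : F.Runs s s' t) (ht : t ≤ t') :
    F.Runs s s' t' := by
  obtain ⟨n, hn, h⟩ := h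
  exact ⟨n, hn.trans ht, h⟩

/-- A single statement. -/
def stmt (q : TM2.Stmt Γ Unit σ) : Frag Γ σ where
  L := Unit
  entry := ()
  code _ := q

theorem runs_stmt {q : TM2.Stmt Γ Unit σ} {s s' : Store Γ σ}
    (h : TM2.stepAux q s.1 s.2 = ⟨none, s'.1, s'.2⟩) : (stmt q).Runs s s' 1 :=
  ⟨1, le_rfl, .single (congrArg some h)⟩

/-- One fragment after the other. -/
def seq (F G : Frag Γ σ) : Frag Γ σ :=
  haveI := F.finL
  haveI := G.finL
  { L := F.L ⊕ G.L
    entry := .inl F.entry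
    code := Sum.elim (fun l => relabel .inl (some (.inr G.entry)) (F.code l))
      fun l => relabel .inr none (G.code l) }

theorem Runs.seq {F G : Frag Γ σ} {s s' s'' : Store Γ σ} {t t' : ℕ} (hF : F.Runs s s' t)
    (hG : G.Runs s' s'' t') : (F.seq G).Runs s s'' (t + t') := by
  obtain ⟨m, hm, hF⟩ := hF
  obtain ⟨n, hn, hG⟩ := hG
  exact ⟨m + n, Nat.add_le_add hm hn, .trans
    (hF.relabel (code' := (F.seq G).code) (g := .inl) (e := some (.inr G.entry)) fun _ => rfl)
    (hG.relabel (code' := (F.seq G).code) (g := .inr) (e := none) fun _ => rfl)⟩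

/-- A case distinction. -/
def ite (c : σ → Bool) (F G : Frag Γ σ) : Frag Γ σ :=
  haveI := F.finL
  haveI := G.finL
  { L := Option (F.L ⊕ G.L)
    entry := none
    code := fun
      | none => .branch c (.goto fun _ => some (.inl F.entry)) (.goto fun _ => some (.inr G.entry))
      | some (.inl l) => relabel (fun l => some (.inl l)) none (F.code l)
      | some (.inr l) => relabel (fun l => some (.inr l)) none (G.code l) }

theorem Runs.ite_true {c : σ → Bool} {F G : Frag Γ σ} {s s' : Store Γ σ} {t : ℕ}
    (hF : F.Runs s s' t) (hc : c s.1 = true) : (ite c F G).Runs s s' (t + 1) := by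
  obtain ⟨n, hn, hF⟩ := hF
  refine ⟨n + 1, Nat.succ_le_succ hn, .head (c₁ := ⟨some (some (.inl F.entry)), s.1, s.2⟩) ?_
    (hF.relabel (code' := (ite c F G).code) (g := fun l => some (.inl l)) (e := none) fun _ => rfl)⟩
  simp [ite, hc]

theorem Runs.ite_false {c : σ → Bool} {F G : Frag Γ σ} {s s' : Store Γ σ} {t : ℕ}
    (hG : G.Runs s s' t) (hc : c s.1 = false) : (ite c F G).Runs s s' (t + 1) := by
  obtain ⟨n, hn, hG⟩ := hG
  refine ⟨n + 1, Nat.succ_le_succ hn, .head (c₁ := ⟨some (some (.inr G.entry)), s.1, s.2⟩) ?_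
    (hG.relabel (code' := (ite c F G).code) (g := fun l => some (.inr l)) (e := none) fun _ => rfl)⟩
  simp [ite, hc]

/-- A loop. -/
def loop (c : σ → Bool) (F : Frag Γ σ) : Frag Γ σ :=
  haveI := F.finL
  { L := Option F.L
    entry := none
    code := fun
      | none => .branch c (.goto fun _ => some F.entry) .halt
      | some l => relabel some (some none) (F.code l) }

theorem runs_loop_false {c : σ → Bool} {F : Frag Γ σ} {s : Store Γ σ} (hc : c s.1 = false) :
    (loop c F).Runs s s 1 := by
  refine ⟨1, le_rfl, .single ?_⟩
  simp [loop, hc]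

theorem Runs.loop_true {c : σ → Bool} {F : Frag Γ σ} {s s' s'' : Store Γ σ} {t t' : ℕ}
    (hF : F.Runs s s' t) (hc : c s.1 = true) (hl : (loop c F).Runs s' s'' t') :
    (loop c F).Runs s s'' (t + t' + 1) := by
  obtain ⟨m, hm, hF⟩ := hF
  obtain ⟨n, hn, hl⟩ := hl
  refine ⟨m + n + 1, by omega, .head (c₁ := ⟨some (some F.entry), s.1, s.2⟩) ?_ (.trans
    (hF.relabel (code' := (loop c F).code) (g := some) (e := some none) fun _ => rfl) hl)⟩
  simp [loop, hc]

/-- Remove the symbols of the stack `a` one by one, and push their images on the stacks `b`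
and `b'`. -/
noncomputable def moveTwo (a b b' : K) (φ : Γ a → Option (Γ b)) (ψ : Γ a → Option (Γ b'))
    (get : σ → Option (Γ a)) (put : Option (Γ a) → σ → σ) : Frag Γ σ :=
  stmt (.pop a (fun v o => put o v) (.branch (fun v => (get v).isSome)
    (pushOption b (fun v => (get v).bind φ) (pushOption b' (fun v => (get v).bind ψ)
      (.goto fun _ => ()))) .halt))

/-- The pair `get`, `put` singles out a register of the internal memory. The last pop finds an empty
stack and stores `none`, so the memory is restored exactly when the register was empty at the start.
Popping and pushing reverses the order. -/
theorem runs_moveTwo {a b b' : K} {φ : Γ a → Option (Γ b)} {ψ : Γ a → Option (Γ b')}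
    {get : σ → Option (Γ a)} {put : Option (Γ a) → σ → σ} (hg : ∀ o v, get (put o v) = o)
    (hp : ∀ o o' v, put o (put o' v) = put o v) (hab : b ≠ a) (hab' : b' ≠ a) (hb : b' ≠ b)
    {v : σ} (hv : put none v = v) (S : ∀ k, List (Γ k)) :
    (moveTwo a b b' φ ψ get put).Runs (v, S)
      (v, update (update (update S a []) b (((S a).filterMap φ).reverse ++ S b)) b'
        (((S a).filterMap ψ).reverse ++ S b')) ((S a).length + 1) := by
  -- During the loop the register holds the symbol popped last, so the induction must allow every
  -- memory that agrees with `v` up to this register.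
  suffices h : ∀ (l : List (Γ a)) (w : σ) (S : ∀ k, List (Γ k)), S a = l → put none w = v →
      StepsIn (TM2.step (moveTwo a b b' φ ψ get put).code) (l.length + 1) ⟨some (), w, S⟩
        ⟨none, v, update (update (update S a []) b ((l.filterMap φ).reverse ++ S b)) b'
        ((l.filterMap ψ).reverse ++ S b')⟩ from
    ⟨_, le_rfl, h _ _ _ rfl hv⟩
  intro l
  induction l with
  | nil =>
    intro w S hS hw
    have hgv : get v = none := by rw [← hw, hg]
    refine .single ?_
    have h₁ : update (update S a []) b (S b) = update S a [] := by
      rw [update_eq_iff]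
      simp [update_of_ne hab]
    have h₂ : update (update S a []) b' (S b') = update S a [] := by
      rw [update_eq_iff]
      simp [update_of_ne hab']
    simp [moveTwo, stmt, hS, hgv, hw, h₁, h₂]
  | cons x l ih =>
    intro w S hS hw
    have := ih (put (some x) w) (update (update (update S a l) b ((φ x).toList ++ S b)) b'
      ((ψ x).toList ++ S b')) (by simp [update_of_ne hab.symm, update_of_ne hab'.symm])
      (by rw [hp, hw])
    refine (StepsIn.head ?_ this).congr_right ?_
    · simp [moveTwo, stmt, hS, hg, update_of_ne hab, update_of_ne hab', update_of_ne hb]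
    · congr 1
      funext k
      by_cases h1 : k = b'
      · subst h1
        cases hx : ψ x <;> simp [hx]
      · by_cases h2 : k = b
        · subst h2
          cases hx : φ x <;> simp [hx, update_of_ne h1]
        · by_cases h3 : k = a
          · subst h3
            simp [update_of_ne h1, update_of_ne h2]
          · simp [update_of_ne h1, update_of_ne h2, update_of_ne h3]

/-- Remove the symbols of the stack `a` one by one, and push their images on the stack `b`. -/
noncomputable def move (a b : K) (φ : Γ a → Option (Γ b)) (get : σ → Option (Γ a))
    (put : Option (Γ a) → σ → σ) : Frag Γ σ :=
  stmt (.pop a (fun v o => put o v) (.branch (fun v => (get v).isSome)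
    (pushOption b (fun v => (get v).bind φ) (.goto fun _ => ())) .halt))

theorem runs_move {a b : K} {φ : Γ a → Option (Γ b)}
    {get : σ → Option (Γ a)} {put : Option (Γ a) → σ → σ} (hg : ∀ o v, get (put o v) = o)
    (hp : ∀ o o' v, put o (put o' v) = put o v) (hab : b ≠ a)
    {v : σ} (hv : put none v = v) (S : ∀ k, List (Γ k)) :
    (move a b φ get put).Runs (v, S)
      (v, update (update S a []) b (((S a).filterMap φ).reverse ++ S b)) ((S a).length + 1) := by
  suffices h : ∀ (l : List (Γ a)) (w : σ) (S : ∀ k, List (Γ k)), S a = l → put none w = v →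
      StepsIn (TM2.step (move a b φ get put).code) (l.length + 1) ⟨some (), w, S⟩
        ⟨none, v, update (update S a []) b ((l.filterMap φ).reverse ++ S b)⟩ from
    ⟨_, le_rfl, h _ _ _ rfl hv⟩
  intro l
  induction l with
  | nil =>
    intro w S hS hw
    have hgv : get v = none := by rw [← hw, hg]
    refine .single ?_
    have h₁ : update (update S a []) b (S b) = update S a [] := by
      rw [update_eq_iff]
      simp [update_of_ne hab]
    simp [move, stmt, hS, hgv, hw, h₁]
  | cons x l ih =>
    intro w S hS hw
    have := ih (put (some x) w) (update (update S a l) b ((φ x).toList ++ S b))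
      (by simp [update_of_ne hab.symm]) (by rw [hp, hw])
    refine (StepsIn.head ?_ this).congr_right ?_
    · simp [move, stmt, hS, hg, update_of_ne hab]
    · congr 1
      funext k
      by_cases h2 : k = b
      · subst h2
        cases hx : φ x <;> simp [hx]
      · by_cases h3 : k = a
        · subst h3
          simp [update_of_ne h2]
        · simp [update_of_ne h2, update_of_ne h3]

/-- Empty the stack `a`. -/
def clear (a : K) (get : σ → Option (Γ a)) (put : Option (Γ a) → σ → σ) : Frag Γ σ :=
  stmt (.pop a (fun v o => put o v) (.branch (fun v => (get v).isSome) (.goto fun _ => ()) .halt))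

theorem runs_clear {a : K} {get : σ → Option (Γ a)} {put : Option (Γ a) → σ → σ}
    (hg : ∀ o v, get (put o v) = o) (hp : ∀ o o' v, put o (put o' v) = put o v)
    {v : σ} (hv : put none v = v) (S : ∀ k, List (Γ k)) :
    (clear a get put).Runs (v, S) (v, update S a []) ((S a).length + 1) := by
  suffices h : ∀ (l : List (Γ a)) (w : σ) (S : ∀ k, List (Γ k)), S a = l → put none w = v →
      StepsIn (TM2.step (clear a get put).code) (l.length + 1) ⟨some (), w, S⟩
        ⟨none, v, update S a []⟩ from
    ⟨_, le_rfl, h _ _ _ rfl hv⟩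
  intro l
  induction l with
  | nil =>
    intro w S hS hw
    have hgv : get v = none := by rw [← hw, hg]
    refine .single ?_
    simp [clear, stmt, hS, hgv, hw]
  | cons x l ih =>
    intro w S hS hw
    have := ih (put (some x) w) (update S a l) (by simp) (by rw [hp, hw])
    rw [update_idem] at this
    refine .head ?_ this
    simp [clear, stmt, hS, hg]

end Frag

end PseudoPolylog

namespace PseudoPolylog

open Turing Function

/-! ### Calling a machine as a subroutine -/

section Lift

variable {K K₁ : Type} [DecidableEq K] [DecidableEq K₁] {Γ : K → Type} {σ σ₁ L : Type}

/-- Run a statement on the stacks `e k` and on a part of the internal memory. -/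
def liftStmt (e : K₁ → K) (get : σ → σ₁) (put : σ₁ → σ → σ) :
    TM2.Stmt (fun k => Γ (e k)) L σ₁ → TM2.Stmt Γ L σ
  | .push k f q => .push (e k) (fun v => f (get v)) (liftStmt e get put q)
  | .peek k f q => .peek (e k) (fun v o => put (f (get v) o) v) (liftStmt e get put q)
  | .pop k f q => .pop (e k) (fun v o => put (f (get v) o) v) (liftStmt e get put q)
  | .load f q => .load (fun v => put (f (get v)) v) (liftStmt e get put q)
  | .branch f q₁ q₂ => .branch (fun v => f (get v)) (liftStmt e get put q₁) (liftStmt e get put q₂)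
  | .goto f => .goto fun v => f (get v)
  | .halt => .halt

/-- The part of a configuration that is seen by the subroutine is `c₁`, and the other stacks are as
in `S₀`. -/
structure LiftCfg (e : K₁ → K) (put : σ₁ → σ → σ) (v₀ : σ) (S₀ : ∀ k, List (Γ k))
    (c₁ : TM2.Cfg (fun k => Γ (e k)) L σ₁) (c : TM2.Cfg Γ L σ) : Prop where
  l : c.l = c₁.l
  var : c.var = put c₁.var v₀
  stk : ∀ k, c.stk (e k) = c₁.stk k
  frame : ∀ k, k ∉ Set.range e → c.stk k = S₀ k

variable {e : K₁ → K} {get : σ → σ₁} {put : σ₁ → σ → σ}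

theorem LiftCfg.stepAux (he : Injective e) (hg : ∀ a v, get (put a v) = a)
    (hp : ∀ a b v, put a (put b v) = put a v) (v₀ : σ) (S₀ : ∀ k, List (Γ k))
    (q : TM2.Stmt (fun k => Γ (e k)) L σ₁) (v : σ₁) (T : ∀ k, List (Γ (e k)))
    (S : ∀ k, List (Γ k)) (h : ∀ k, S (e k) = T k) (h' : ∀ k, k ∉ Set.range e → S k = S₀ k) :
    LiftCfg e put v₀ S₀ (TM2.stepAux q v T) (TM2.stepAux (liftStmt e get put q) (put v v₀) S) := by
  have hu : ∀ (T : ∀ k, List (Γ (e k))) (S : ∀ k, List (Γ k)), (∀ k, S (e k) = T k) →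
      ∀ k l k', update S (e k) l (e k') = update T k l k' := by
    intro T S h k l k'
    by_cases hk : k' = k
    · subst hk; simp
    · rw [update_of_ne hk, update_of_ne (he.ne hk), h]
  have hr : ∀ (S : ∀ k, List (Γ k)), (∀ k, k ∉ Set.range e → S k = S₀ k) →
      ∀ j l k, k ∉ Set.range e → update S (e j) l k = S₀ k := by
    intro S h' j l k hk
    rw [update_of_ne (fun h => hk ⟨j, h.symm⟩), h' k hk]
  induction q generalizing v T S with
  | push k f q ih =>
    simp only [liftStmt, TM2.stepAux, hg, h]
    exact ih _ _ _ (hu T S h _ _) (hr S h' _ _)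
  | peek k f q ih =>
    simp only [liftStmt, TM2.stepAux, hg, h, hp]
    exact ih _ _ _ h h'
  | pop k f q ih =>
    simp only [liftStmt, TM2.stepAux, hg, h, hp]
    exact ih _ _ _ (hu T S h _ _) (hr S h' _ _)
  | load f q ih =>
    simp only [liftStmt, TM2.stepAux, hg, hp]
    exact ih _ _ _ h h'
  | branch f q₁ q₂ ih₁ ih₂ =>
    simp only [liftStmt, TM2.stepAux, hg]
    cases f v
    · exact ih₂ _ _ _ h h'
    · exact ih₁ _ _ _ h h'
  | goto f => exact ⟨by simp [liftStmt, hg], rfl, h, h'⟩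
  | halt => exact ⟨rfl, rfl, h, h'⟩

theorem LiftCfg.step (he : Injective e) (hg : ∀ a v, get (put a v) = a)
    (hp : ∀ a b v, put a (put b v) = put a v) {v₀ : σ} {S₀ : ∀ k, List (Γ k)}
    {code : L → TM2.Stmt (fun k => Γ (e k)) L σ₁} {c₁ c₁' : TM2.Cfg (fun k => Γ (e k)) L σ₁}
    {c : TM2.Cfg Γ L σ} (h : LiftCfg e put v₀ S₀ c₁ c) (hs : TM2.step code c₁ = some c₁') :
    ∃ c', TM2.step (fun l => liftStmt e get put (code l)) c = some c' ∧
      LiftCfg e put v₀ S₀ c₁' c' := by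
  obtain ⟨_ | l, v, T⟩ := c₁
  · cases hs
  · cases hs
    obtain ⟨l', v', S⟩ := c
    obtain ⟨hl, hv, hS, hf⟩ := h
    simp only at hl hv hS hf
    subst hl hv
    exact ⟨_, rfl, .stepAux he hg hp v₀ S₀ (code l) v T S hS hf⟩

end Lift

theorem initList_stk_self (tm : FinTM2) (l : List (tm.Γ tm.k₀)) :
    (initList tm l).stk tm.k₀ = l := by
  simp [initList]

theorem initList_stk_ne (tm : FinTM2) (l : List (tm.Γ tm.k₀)) {k : tm.K} (hk : k ≠ tm.k₀) :
    (initList tm l).stk k = [] := by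
  simp [initList, hk]

theorem initList_stk (tm : FinTM2) (l : List (tm.Γ tm.k₀)) :
    (initList tm l).stk = update (fun _ => []) tm.k₀ l := by
  funext k
  by_cases hk : k = tm.k₀
  · subst hk
    rw [update_self, initList_stk_self]
  · rw [update_of_ne hk, initList_stk_ne tm _ hk]

theorem haltList_stk_self (tm : FinTM2) (l : List (tm.Γ tm.k₁)) :
    (haltList tm l).stk tm.k₁ = l := by
  simp [haltList]

theorem haltList_stk_ne (tm : FinTM2) (l : List (tm.Γ tm.k₁)) {k : tm.K} (hk : k ≠ tm.k₁) :
    (haltList tm l).stk k = [] := by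
  simp [haltList, hk]

theorem haltList_stk (tm : FinTM2) (l : List (tm.Γ tm.k₁)) :
    (haltList tm l).stk = update (fun _ => []) tm.k₁ l := by
  funext k
  by_cases hk : k = tm.k₁
  · subst hk
    rw [update_self, haltList_stk_self]
  · rw [update_of_ne hk, haltList_stk_ne tm _ hk]

/-- The machine `tm`, with code `m`, as a fragment of a larger machine. -/
def Frag.call {K K₁ : Type} {Γ : K → Type} {σ σ₁ L : Type} [Finite L] (e : K₁ → K) (get : σ → σ₁)
    (put : σ₁ → σ → σ) (entry : L) (m : L → TM2.Stmt (fun k => Γ (e k)) L σ₁) : Frag Γ σ where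
  L := L
  entry := entry
  code l := liftStmt e get put (m l)

/-- A subroutine touches only the stacks in the range of `e` and its part of the memory, so
everything else is a frame that survives. It must return its memory as it found it, which holds for
the machines called later because they halt in their initial memory. -/
theorem Frag.runs_call {K K₁ : Type} [DecidableEq K] [DecidableEq K₁] {Γ : K → Type}
    {σ σ₁ L : Type} [Finite L] {e : K₁ → K} {get : σ → σ₁} {put : σ₁ → σ → σ} {entry : L}
    {m : L → TM2.Stmt (fun k => Γ (e k)) L σ₁} (he : Injective e)
    (hg : ∀ a v, get (put a v) = a) (hp : ∀ a b v, put a (put b v) = put a v) {v : σ}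
    (hv : put (get v) v = v) {t : ℕ} {S S' : ∀ k, List (Γ k)}
    (h : ∃ n ≤ t, StepsIn (TM2.step m) n ⟨some entry, get v, fun k => S (e k)⟩
      ⟨none, get v, fun k => S' (e k)⟩) (hS : ∀ k, k ∉ Set.range e → S' k = S k) :
    (Frag.call e get put entry m).Runs (v, S) (v, S') t := by
  obtain ⟨n, hn, h⟩ := h
  refine ⟨n, hn, ?_⟩
  obtain ⟨⟨l', v', T⟩, hc', hl, hv', hT, hf⟩ := StepsIn.simulate
    (R := fun _ c₁ c => LiftCfg e put v S c₁ c)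
    (step' := TM2.step (Frag.call e get put entry m).code)
    (fun i a b a' h hs => h.step he hg hp hs) (i := 0)
    (b := ⟨some entry, v, S⟩) ⟨rfl, hv.symm, fun _ => rfl, fun _ _ => rfl⟩ h
  simp only at hl hv' hT hf
  subst hl
  rw [hv] at hv'
  subst hv'
  refine hc'.congr_right ?_
  congr 1
  funext k
  by_cases hk : k ∈ Set.range e
  · obtain ⟨k, rfl⟩ := hk
    exact hT k
  · rw [hf k hk]
    exact (hS k hk).symm

/-! ### Polynomial time -/

section Length

variable {K : Type} [DecidableEq K] {Γ : K → Type} {σ L : Type}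

/-- A bound on the number of symbols pushed by a statement. -/
def pushCount : TM2.Stmt Γ L σ → ℕ
  | .push _ _ q => pushCount q + 1
  | .peek _ _ q => pushCount q
  | .pop _ _ q => pushCount q
  | .load _ q => pushCount q
  | .branch _ q₁ q₂ => pushCount q₁ + pushCount q₂
  | .goto _ => 0
  | .halt => 0

theorem length_stepAux_le (q : TM2.Stmt Γ L σ) (v : σ) (S : ∀ k, List (Γ k)) (k : K) :
    ((TM2.stepAux q v S).stk k).length ≤ (S k).length + pushCount q := by
  induction q generalizing v S with
  | push j f q ih =>
    refine (ih _ _).trans ?_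
    by_cases h : k = j
    · subst h
      simp only [pushCount, update_self, List.length_cons]
      omega
    · simp only [pushCount, update_of_ne h]
      omega
  | pop j f q ih =>
    refine (ih _ _).trans ?_
    by_cases h : k = j
    · subst h
      simp [pushCount]
    · simp [pushCount, update_of_ne h]
  | peek j f q ih => exact ih _ _
  | load f q ih => exact ih _ _
  | branch f q₁ q₂ h₁ h₂ =>
    have := h₁ v S
    have := h₂ v S
    simp only [TM2.stepAux, pushCount]
    cases f v <;> simp only [cond_true, cond_false] <;> omega
  | goto f => simp
  | halt => simp

/-- One step executes one statement, which pushes at most `C` symbols; hence output length is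
controlled by running time. -/
theorem length_le_of_stepsIn {code : L → TM2.Stmt Γ L σ} {C : ℕ} (hC : ∀ l, pushCount (code l) ≤ C)
    {n : ℕ} {c c' : TM2.Cfg Γ L σ} (h : StepsIn (TM2.step code) n c c') (k : K) :
    (c'.stk k).length ≤ (c.stk k).length + n * C := by
  induction h with
  | zero => simp
  | @head n c c₁ c₂ h _ ih =>
    obtain ⟨_ | l, v, S⟩ := c
    · cases h
    · cases h
      have := length_stepAux_le (code l) v S k
      have := hC l
      rw [Nat.succ_mul]
      simp only at ih ⊢
      omega

end Length

/-- A run of a machine that computes a function, without the bundling. -/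
theorem PTIMEComputable.exists_run {A B : Type} {f : List A → List B} (hf : PTIMEComputable f) :
    ∃ (tm : FinTM2) (i : tm.Γ tm.k₀ ≃ A) (o : tm.Γ tm.k₁ ≃ B) (q : Polynomial ℕ), ∀ x,
      ∃ n ≤ q.eval x.length, StepsIn (TM2.step tm.m) n
        ⟨some tm.main, tm.initialState, (initList tm (x.map i.symm)).stk⟩
        ⟨none, tm.initialState, (haltList tm ((f x).map o.symm)).stk⟩ := by
  obtain ⟨⟨⟨tm, i, o⟩, q, h⟩⟩ := hf
  exact ⟨tm, i, o, q, fun x => StepsIn.nonempty_evalsToInTime_iff.1 ⟨h x⟩⟩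

theorem PTIMEComputable.length_bound {A B : Type} {f : List A → List B} (hf : PTIMEComputable f) :
    ∃ p, IsPolyBounded p ∧ ∀ x, (f x).length ≤ p x.length := by
  obtain ⟨tm, i, o, q, h⟩ := hf.exists_run
  have := tm.ΛFin
  let C := Finset.univ.sup fun l => pushCount (tm.m l)
  refine ⟨fun n => n + q.eval n * C, IsPolyBounded.id.add ((IsPolyBounded.eval q).mul (.const C)),
    fun x => ?_⟩
  obtain ⟨n, hn, hr⟩ := h x
  have h₁ : ((haltList tm ((f x).map o.symm)).stk tm.k₁).length ≤
      ((initList tm (x.map i.symm)).stk tm.k₁).length + n * C := length_le_of_stepsIn (C := C)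
    (fun l => Finset.le_sup (f := fun l => pushCount (tm.m l)) (Finset.mem_univ l)) hr tm.k₁
  have h₂ := Nat.mul_le_mul_right C hn
  have h₃ : ((initList tm (x.map i.symm)).stk tm.k₁).length ≤ x.length := by
    by_cases e : tm.k₁ = tm.k₀
    · have : ∀ k (e : k = tm.k₀), ((initList tm (x.map i.symm)).stk k).length = x.length := by
        rintro k rfl
        rw [initList_stk_self, List.length_map]
      exact (this _ e).le
    · rw [initList_stk_ne tm _ e]
      exact Nat.zero_le _
  have h₄ : ((haltList tm ((f x).map o.symm)).stk tm.k₁).length = (f x).length := by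
    rw [haltList_stk_self, List.length_map]
  rw [h₄] at h₁
  change (f x).length ≤ x.length + q.eval x.length * C
  omega

/-- `haltList` demands the initial memory and empty stacks apart from the output stack. This is why
the machines below clear their stacks and registers before they halt. -/
theorem ptimeComputable_of_frag {A B K : Type} [Finite K] [DecidableEq K] {Γ : K → Type} {σ : Type}
    [Finite σ] (F : Frag Γ σ) (k₀ k₁ : K) [Finite (Γ k₀)] (i : A ≃ Γ k₀) (o : B ≃ Γ k₁) (v : σ)
    {f : List A → List B} {T : ℕ → ℕ} (hT : IsPolyBounded T)
    (h : ∀ x, F.Runs (v, update (fun _ => []) k₀ (x.map i))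
      (v, update (fun _ => []) k₁ ((f x).map o)) (T x.length)) : PTIMEComputable f := by
  classical
  have := F.finL
  have := Fintype.ofFinite K
  have := Fintype.ofFinite F.L
  have := Fintype.ofFinite σ
  have := Fintype.ofFinite (Γ k₀)
  obtain ⟨q, hq⟩ := hT
  let tm : FinTM2 :=
    { K := K, k₀ := k₀, k₁ := k₁, Γ := Γ, Λ := F.L, main := F.entry, σ := σ, initialState := v
      m := F.code }
  have hr : ∀ x, Nonempty (StateTransition.EvalsToInTime tm.step (initList tm (x.map i))
      (some (haltList tm ((f x).map o))) (q.eval x.length)) := by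
    intro x
    obtain ⟨n, hn, h⟩ := h x
    refine StepsIn.nonempty_evalsToInTime_iff.2 ⟨n, hn.trans (hq _), ?_⟩
    have e₁ : initList tm (x.map i) = ⟨some F.entry, v, update (fun _ => []) k₀ (x.map i)⟩ :=
      congrArg (TM2.Cfg.mk _ _) (initList_stk tm (x.map i))
    have e₂ : haltList tm ((f x).map o) = ⟨none, v, update (fun _ => []) k₁ ((f x).map o)⟩ :=
      congrArg (TM2.Cfg.mk _ _) (haltList_stk tm ((f x).map o))
    rw [e₁, e₂]
    exact h
  exact ⟨{ tm := tm, inputAlphabet := i.symm, outputAlphabet := o.symm, time := q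
           outputsFun := fun x => (hr x).some }⟩

end PseudoPolylog

namespace PseudoPolylog

/-! ### Logarithmic space is polynomial time -/

namespace StepsIn

variable {C : Type*} {step : C → Option C}

/-- By determinism, no run from `a` is longer than the halting one. -/
theorem le_of_halts {m n : ℕ} {a b c : C} (h : StepsIn step m a b) (hb : step b = none)
    (h' : StepsIn step n a c) : n ≤ m := by
  induction h generalizing n with
  | zero =>
    cases h' with
    | zero => exact le_rfl
    | head e _ => rw [hb] at e; cases e
  | head e _ ih =>
    cases h' with
    | zero => exact Nat.zero_le _
    | head e' h' =>
      rw [e] at e'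
      cases e'
      exact Nat.succ_le_succ (ih hb h')

theorem split {n i : ℕ} {a c : C} (h : StepsIn step n a c) (hi : i ≤ n) :
    ∃ b, StepsIn step i a b ∧ StepsIn step (n - i) b c := by
  induction h generalizing i with
  | zero =>
    obtain rfl : i = 0 := by omega
    exact ⟨_, zero _, zero _⟩
  | @head n a a₁ c e h ih =>
    rcases i with _ | i
    · exact ⟨a, zero a, head e h⟩
    · obtain ⟨b, hb, hb'⟩ := ih (i := i) (by omega)
      exact ⟨b, head e hb, by rwa [Nat.succ_sub_succ]⟩

end StepsIn

namespace Transducer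

variable {I O : Type} {M : Transducer I O} {x : List I}

/-- A configuration without the output. -/
def Cfg.core (c : M.Cfg) : M.Q × ℕ × (ℕ → M.A) × ℕ :=
  (c.state, c.inPos, c.work, c.workPos)

theorem map_core_step {c c' : M.Cfg} (h : c.core = c'.core) :
    (M.step x c).map Cfg.core = (M.step x c').map Cfg.core := by
  obtain ⟨q, i, w, p, o⟩ := c
  obtain ⟨q', i', w', p', o'⟩ := c'
  simp only [Cfg.core, Prod.mk.injEq] at h
  obtain ⟨rfl, rfl, rfl, rfl⟩ := h
  simp only [step, Option.map_map]
  rfl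

/-- The output is write-only and never influences the run, so it can be left out when configurations
are compared. This is essential for counting: the output may be far longer than the space bound. -/
theorem exists_stepsIn_of_core_eq {n : ℕ} {a b a' : M.Cfg} (h : StepsIn (M.step x) n a b)
    (e : a.core = a'.core) : ∃ b', StepsIn (M.step x) n a' b' ∧ b.core = b'.core := by
  have := StepsIn.simulate (R := fun _ (c c' : M.Cfg) => c.core = c'.core) (step' := M.step x)
    (fun _ c c' c₁ hc hs => by
      have := map_core_step (x := x) hc
      rw [hs, Option.map_some] at this
      obtain ⟨c₂, h₂, e₂⟩ := Option.map_eq_some_iff.1 this.symm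
      exact ⟨c₂, h₂, e₂.symm⟩) (i := 0) e h
  exact this

theorem step_eq_some {c c' : M.Cfg} (h : M.step x c = some c') :
    ∃ q m a m' o, M.δ c.state (inputCell x c.inPos) (c.work c.workPos) = some (q, m, a, m', o) ∧
      c' = ⟨q, min (m.apply c.inPos) (x.length + 1), Function.update c.work c.workPos a,
        m'.apply c.workPos, c.out ++ o.toList⟩ := by
  obtain ⟨⟨q, m, a, m', o⟩, hδ, rfl⟩ := Option.map_eq_some_iff.1 h
  exact ⟨q, m, a, m', o, hδ, rfl⟩

theorem inPos_le_of_reaches {c : M.Cfg} (h : StateTransition.Reaches (M.step x) M.init c) :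
    c.inPos ≤ x.length + 1 := by
  induction h with
  | refl => exact Nat.zero_le _
  | tail _ hs _ =>
    obtain ⟨q, m, a, m', o, -, rfl⟩ := step_eq_some hs
    exact min_le_right _ _

theorem work_eq_blank {s : ℕ}
    (hs : ∀ c, StateTransition.Reaches (M.step x) M.init c → c.workPos ≤ s) {c : M.Cfg}
    (h : StateTransition.Reaches (M.step x) M.init c) {j : ℕ} (hj : s < j) :
    c.work j = M.blank := by
  induction h with
  | refl => rfl
  | tail h hs' ih =>
    obtain ⟨q, m, a, m', o, -, rfl⟩ := step_eq_some hs'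
    have := hs _ h
    simp only
    rw [Function.update_of_ne (by omega), ih]

/-- A halting run in space `s` never repeats a configuration. -/
theorem steps_le_of_space {s n : ℕ} {c : M.Cfg}
    (hs : ∀ c, StateTransition.Reaches (M.step x) M.init c → c.workPos ≤ s)
    (h : StepsIn (M.step x) n M.init c) (hc : M.step x c = none) :
    n ≤ Nat.card M.Q * (x.length + 2) * (s + 1) * Nat.card M.A ^ (s + 1) := by
  have := M.finQ
  have := M.finA
  choose f hf hf' using fun i : Fin (n + 1) => h.split (Nat.lt_succ_iff.1 i.2)
  let code : Fin (n + 1) → M.Q × Fin (x.length + 2) × Fin (s + 1) × (Fin (s + 1) → M.A) := fun i =>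
    ((f i).state, ⟨(f i).inPos, Nat.lt_succ_of_le (inPos_le_of_reaches (hf i).reaches)⟩,
      ⟨(f i).workPos, Nat.lt_succ_of_le (hs _ (hf i).reaches)⟩, fun j => (f i).work j)
  -- If the configurations at times `i < j` had equal cores, the last `n - j` steps could be
  -- replayed from time `i` and would halt there, although the actual run goes on for `n - i` steps.
  have key : ∀ i j : Fin (n + 1), i < j → code i ≠ code j := by
    intro i j hij e
    have hcore : (f j).core = (f i).core := by
      simp only [code, Prod.mk.injEq, Fin.mk.injEq] at e
      obtain ⟨h₁, h₂, h₃, h₄⟩ := e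
      simp only [Cfg.core, Prod.mk.injEq]
      refine ⟨h₁.symm, h₂.symm, funext fun k => ?_, h₃.symm⟩
      by_cases hk : k < s + 1
      · exact (congrFun h₄ ⟨k, hk⟩).symm
      · rw [work_eq_blank hs (hf i).reaches (by omega), work_eq_blank hs (hf j).reaches (by omega)]
    obtain ⟨b, hb, e'⟩ := exists_stepsIn_of_core_eq (hf' j) hcore
    have hb' : M.step x b = none := by
      have := map_core_step (x := x) e'
      rw [hc] at this
      exact Option.map_eq_none_iff.1 this.symm
    have := hb.le_of_halts hb' (hf' i)
    have := j.2
    have : (i : ℕ) < j := hij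
    omega
  have inj : Function.Injective code := by
    intro i j e
    rcases lt_trichotomy i j with h | h | h
    · exact absurd e (key i j h)
    · exact h
    · exact absurd e.symm (key j i h)
  have := Nat.card_le_card_of_injective code inj
  simp only [Nat.card_prod, Nat.card_fun, Nat.card_eq_fintype_card, Fintype.card_fin] at this
  rw [← mul_assoc, ← mul_assoc] at this
  omega

end Transducer

/-- The number of configurations is polynomial: state, input position and work position contribute
polynomial factors, and the tape contents contribute a constant raised to a logarithm. -/
theorem LogspaceComputable.exists_polytime {I O : Type} {f : List I → List O}
    (hf : LogspaceComputable f) :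
    ∃ (M : Transducer I O) (T : ℕ → ℕ), IsPolyBounded T ∧ ∀ x : List I,
      ∃ n ≤ T x.length, ∃ c, StepsIn (M.step x) n M.init c ∧ M.step x c = none ∧ c.out = f x := by
  obtain ⟨M, s, hs, h⟩ := hf
  refine ⟨M, fun n => Nat.card M.Q * (n + 2) * (s n + 1) * Nat.card M.A ^ (s n + 1), ?_, ?_⟩
  · have h₁ : IsPolyBounded fun n => Nat.card M.A ^ (s n + 1) := by
      simpa only [pow_succ] using (hs.isPolyBounded_pow (Nat.card M.A)).mul (.const _)
    exact (((IsPolyBounded.const _).mul (IsPolyBounded.id.add (.const 2))).mul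
      (hs.isPolyBounded.add (.const 1))).mul h₁
  · intro x
    obtain ⟨hx, c, hr, hc, ho⟩ := h x
    obtain ⟨n, hn⟩ := StepsIn.exists_of_reaches hr
    exact ⟨n, Transducer.steps_le_of_space hx hn hc, c, hn, hc, ho⟩

end PseudoPolylog

namespace PseudoPolylog

open Turing Function

/-! ### Evaluating a circuit from its description -/

/-- The item of the description of a circuit that is being read. -/
inductive Pending (S : Type)
  | idle
  | inp (a : S)
  | const (b : Bool)
  | not
  | and
  | andSecond (b : Bool)
  | or
  | orSecond (b : Bool)
  | port (a : S)

namespace Pending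

variable {S : Type}

open Classical in
/-- The value of the item, given the input symbol and the value of the gate it refers to. -/
noncomputable def value (a : Option S) (b : Bool) : Pending S → Bool
  | .idle => false
  | .inp c => decide (a = some c)
  | .const c => c
  | .not => !b
  | .and => b
  | .andSecond c => c && b
  | .or => b
  | .orSecond c => c || b
  | .port _ => b

/-- The value that is appended to the list of the values of the gates when `c` is read. -/
def appended (c : Option (DescSymbol S)) (b : Bool) : Pending S → Option Bool
  | .idle => none
  | .port _ => none
  | _ => match c with
    | some .sep => none
    | _ => some b

/-- The symbol that is appended to the output. -/
def emitted (b : Bool) : Pending S → Option S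
  | .port a => if b then some a else none
  | _ => none

/-- The next item. -/
def next (c : Option (DescSymbol S)) (b : Bool) (p : Pending S) : Pending S :=
  match c with
  | none => .idle
  | some .tick => .idle
  | some .sep => match p with
    | .and => .andSecond b
    | .or => .orSecond b
    | _ => .idle
  | some (.inp a) => .inp a
  | some (.const b) => .const b
  | some .not => .not
  | some .and => .and
  | some .or => .or
  | some (.port a) => .port a

end Pending

/-- The state of the evaluation of a circuit from its description. -/
structure EvalState (S : Type) where
  pending : Pending S
  /-- the argument that has been read so far -/
  cursor : ℕ
  values : List Bool
  out : List S

namespace EvalState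

variable {S : Type} (x : List S)

noncomputable def value (s : EvalState S) : Bool :=
  s.pending.value x[s.cursor]? (s.values.getD s.cursor false)

/-- Read a symbol that is not a tick, or the end of the description. -/
noncomputable def flush (s : EvalState S) (c : Option (DescSymbol S)) : EvalState S where
  pending := s.pending.next c (s.value x)
  cursor := 0
  values := s.values ++ (s.pending.appended c (s.value x)).toList
  out := s.out ++ (s.pending.emitted (s.value x)).toList

noncomputable def read (s : EvalState S) : DescSymbol S → EvalState S
  | .tick => { s with cursor := s.cursor + 1 }
  | c => s.flush x (some c)

theorem foldl_ticks (s : EvalState S) (n : ℕ) :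
    (ticks n).foldl (read x) s = { s with cursor := s.cursor + n } := by
  induction n generalizing s with
  | zero => rfl
  | succ n ih =>
    rw [ticks, List.replicate_succ, List.foldl_cons]
    refine (ih _).trans ?_
    simp only [read, Nat.add_assoc, Nat.add_comm 1]

/-- An item is complete only when the next one begins, so states are compared after a hypothetical
flush. The first symbol of a gate's description is neither a tick nor a separator and finishes the
previous item just as the end of the description would. -/
theorem foldl_describe_gate (s : EvalState S) (g : Gate S) :
    ((g.describe.foldl (read x) s).flush x none).values =
        (s.flush x none).values ++ [g.eval x (s.flush x none).values] ∧
      ((g.describe.foldl (read x) s).flush x none).out = (s.flush x none).out := by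
  cases g <;> simp only [Gate.describe, List.foldl_cons, List.foldl_append, List.foldl_nil,
    foldl_ticks] <;> simp [read, flush, Pending.next, Pending.appended,
    Pending.emitted, value, Pending.value, Gate.eval]
  exact decide_eq_decide.2 (by rw [Nat.zero_add])

theorem foldl_describe_port (s : EvalState S) (p : S × ℕ) :
    (((DescSymbol.port p.1 :: ticks p.2).foldl (read x) s).flush x none).values =
        (s.flush x none).values ∧
      (((DescSymbol.port p.1 :: ticks p.2).foldl (read x) s).flush x none).out =
        (s.flush x none).out ++
          if (s.flush x none).values.getD p.2 false then [p.1] else [] := by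
  simp [foldl_ticks, read, flush, Pending.next, Pending.appended,
    Pending.emitted, value, Pending.value]
  split_ifs <;> simp_all

def init : EvalState S := ⟨.idle, 0, [], []⟩

/-- Since gates are topologically ordered and precede the ports, every value that an item refers to
is available when the item is completed, and one pass suffices. -/
theorem foldl_describe (C : Circuit S) :
    ((C.describe.foldl (read x) init).flush x none).out = C.eval x := by
  have hg : ∀ (l : List (Gate S)) (s : EvalState S),
      (((l.flatMap Gate.describe).foldl (read x) s).flush x none).values =
        l.foldl (fun v g => v ++ [g.eval x v]) (s.flush x none).values ∧
      (((l.flatMap Gate.describe).foldl (read x) s).flush x none).out = (s.flush x none).out := by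
    intro l
    induction l with
    | nil => intro s; exact ⟨rfl, rfl⟩
    | cons g l ih =>
      intro s
      rw [List.flatMap_cons, List.foldl_append, List.foldl_cons]
      obtain ⟨h₁, h₂⟩ := ih (g.describe.foldl (read x) s)
      obtain ⟨h₃, h₄⟩ := foldl_describe_gate x s g
      rw [h₁, h₂, h₃, h₄]
      exact ⟨rfl, rfl⟩
  have hp : ∀ (l : List (S × ℕ)) (s : EvalState S),
      (((l.flatMap fun p => .port p.1 :: ticks p.2).foldl (read x) s).flush x none).out =
        (s.flush x none).out ++
          (l.filter fun p => (s.flush x none).values.getD p.2 false).map Prod.fst := by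
    intro l
    induction l with
    | nil => intro s; simp
    | cons p l ih =>
      intro s
      obtain ⟨h₃, h₄⟩ := foldl_describe_port x s p
      rw [List.flatMap_cons, List.foldl_append, ih, h₃, h₄, List.filter_cons]
      split_ifs <;> simp
  rw [Circuit.describe, List.foldl_append, hp, (hg _ _).1, (hg _ _).2]
  simp [init, flush, Pending.emitted, Pending.appended, Circuit.eval, Circuit.values]

theorem length_values_flush_le (s : EvalState S) (c : Option (DescSymbol S)) :
    (s.flush x c).values.length ≤ s.values.length + 1 := by
  simp only [flush, List.length_append]
  cases s.pending.appended c (s.value x) <;> simp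

theorem length_out_flush_le (s : EvalState S) (c : Option (DescSymbol S)) :
    (s.flush x c).out.length ≤ s.out.length + 1 := by
  simp only [flush, List.length_append]
  cases s.pending.emitted (s.value x) <;> simp

theorem length_values_read_le (s : EvalState S) (c : DescSymbol S) :
    (s.read x c).values.length ≤ s.values.length + 1 := by
  cases c <;> first | exact Nat.le_succ _ | exact length_values_flush_le x s _

theorem length_out_read_le (s : EvalState S) (c : DescSymbol S) :
    (s.read x c).out.length ≤ s.out.length + 1 := by
  cases c <;> first | exact Nat.le_succ _ | exact length_out_flush_le x s _

end EvalState

/-! ### A machine that constructs and evaluates a circuit -/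

/-- The pairs `x`, `xt` and `v`, `vt` are the input and the gate values, split at the cursor; `inL`,
`inR` and `wL`, `wR` are the two tapes of the transducer, split at the head. The left part of a
split list is stored in reverse. The stacks `descR` and `outR` collect outputs in reverse order. -/
inductive NCTape
  | x
  | xt
  | inL
  | inR
  | wL
  | wR
  | descR
  | desc
  | v
  | vt
  | outR
  | out
  deriving DecidableEq

instance : Finite NCTape :=
  .of_injective (β := Fin 12)
    (fun | .x => 0 | .xt => 1 | .inL => 2 | .inR => 3 | .wL => 4 | .wR => 5 | .descR => 6
         | .desc => 7 | .v => 8 | .vt => 9 | .outR => 10 | .out => 11)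
    (by rintro (_ | _) (_ | _) h <;> first | rfl | (exfalso; revert h; decide))

instance : Finite Move :=
  .of_injective (β := Fin 3) (fun | .left => 0 | .stay => 1 | .right => 2)
    (by rintro (_ | _) (_ | _) h <;> first | rfl | (exfalso; revert h; decide))

instance {I : Type} [Finite I] : Finite (InputCell I) :=
  .of_injective (β := I ⊕ Bool)
    (fun | .leftEnd => .inr true | .rightEnd => .inr false | .sym a => .inl a)
    (by rintro (_ | _) (_ | _) h <;> simp_all)

instance {S : Type} [Finite S] : Finite (DescSymbol S) :=
  .of_injective (β := (S ⊕ S) ⊕ Bool ⊕ Fin 5)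
    (fun | .tick => .inr (.inr 0) | .sep => .inr (.inr 1) | .inp a => .inl (.inl a)
         | .const b => .inr (.inl b) | .not => .inr (.inr 2) | .and => .inr (.inr 3)
         | .or => .inr (.inr 4) | .port a => .inl (.inr a))
    (by rintro (_ | _) (_ | _) h <;> simp_all)

instance {S : Type} [Finite S] : Finite (Pending S) :=
  .of_injective (β := (S ⊕ S) ⊕ (Bool ⊕ Bool ⊕ Bool) ⊕ Fin 4)
    (fun | .idle => .inr (.inr 0) | .inp a => .inl (.inl a) | .const b => .inr (.inl (.inl b))
         | .not => .inr (.inr 1) | .and => .inr (.inr 2)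
         | .andSecond b => .inr (.inl (.inr (.inl b))) | .or => .inr (.inr 3)
         | .orSecond b => .inr (.inl (.inr (.inr b))) | .port a => .inl (.inr a))
    (by rintro (_ | _) (_ | _) h <;> simp_all)

end PseudoPolylog

namespace PseudoPolylog

open Turing Function

/-- The alphabets of the stacks. -/
abbrev NCTape.Symbol (A S : Type) : NCTape → Type
  | .x => S
  | .xt => S
  | .inL => InputCell Unit
  | .inR => InputCell Unit
  | .wL => A
  | .wR => A
  | .descR => DescSymbol S
  | .desc => DescSymbol S
  | .v => Bool
  | .vt => Bool
  | .outR => S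
  | .out => S

/-- The contents of the stacks. -/
structure NCStacks (A S : Type) where
  x : List S := []
  xt : List S := []
  inL : List (InputCell Unit) := []
  inR : List (InputCell Unit) := []
  wL : List A := []
  wR : List A := []
  descR : List (DescSymbol S) := []
  desc : List (DescSymbol S) := []
  v : List Bool := []
  vt : List Bool := []
  outR : List S := []
  out : List S := []

namespace NCStacks

variable {A S : Type}

def stk (T : NCStacks A S) : ∀ k, List (NCTape.Symbol A S k)
  | .x => T.x
  | .xt => T.xt
  | .inL => T.inL
  | .inR => T.inR
  | .wL => T.wL
  | .wR => T.wR
  | .descR => T.descR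
  | .desc => T.desc
  | .v => T.v
  | .vt => T.vt
  | .outR => T.outR
  | .out => T.out

variable (T : NCStacks A S)

@[simp] theorem stk_x : T.stk .x = T.x := rfl
@[simp] theorem stk_xt : T.stk .xt = T.xt := rfl
@[simp] theorem stk_inL : T.stk .inL = T.inL := rfl
@[simp] theorem stk_inR : T.stk .inR = T.inR := rfl
@[simp] theorem stk_wL : T.stk .wL = T.wL := rfl
@[simp] theorem stk_wR : T.stk .wR = T.wR := rfl
@[simp] theorem stk_descR : T.stk .descR = T.descR := rfl
@[simp] theorem stk_desc : T.stk .desc = T.desc := rfl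
@[simp] theorem stk_v : T.stk .v = T.v := rfl
@[simp] theorem stk_vt : T.stk .vt = T.vt := rfl
@[simp] theorem stk_outR : T.stk .outR = T.outR := rfl
@[simp] theorem stk_out : T.stk .out = T.out := rfl

@[simp] theorem update_x (l : List S) : update T.stk .x l = { T with x := l }.stk := by
  funext k; cases k <;> rfl
@[simp] theorem update_xt (l : List S) : update T.stk .xt l = { T with xt := l }.stk := by
  funext k; cases k <;> rfl
@[simp] theorem update_inL (l : List (InputCell Unit)) :
    update T.stk .inL l = { T with inL := l }.stk := by
  funext k; cases k <;> rfl
@[simp] theorem update_inR (l : List (InputCell Unit)) :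
    update T.stk .inR l = { T with inR := l }.stk := by
  funext k; cases k <;> rfl
@[simp] theorem update_wL (l : List A) : update T.stk .wL l = { T with wL := l }.stk := by
  funext k; cases k <;> rfl
@[simp] theorem update_wR (l : List A) : update T.stk .wR l = { T with wR := l }.stk := by
  funext k; cases k <;> rfl
@[simp] theorem update_descR (l : List (DescSymbol S)) :
    update T.stk .descR l = { T with descR := l }.stk := by
  funext k; cases k <;> rfl
@[simp] theorem update_desc (l : List (DescSymbol S)) :
    update T.stk .desc l = { T with desc := l }.stk := by
  funext k; cases k <;> rfl
@[simp] theorem update_v (l : List Bool) : update T.stk .v l = { T with v := l }.stk := by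
  funext k; cases k <;> rfl
@[simp] theorem update_vt (l : List Bool) : update T.stk .vt l = { T with vt := l }.stk := by
  funext k; cases k <;> rfl
@[simp] theorem update_outR (l : List S) : update T.stk .outR l = { T with outR := l }.stk := by
  funext k; cases k <;> rfl
@[simp] theorem update_out (l : List S) : update T.stk .out l = { T with out := l }.stk := by
  funext k; cases k <;> rfl

end NCStacks

/-- The internal memory. -/
structure NCMem (Q A S : Type) where
  state : Q
  cell : Option (InputCell Unit) := none
  cellL : Option (InputCell Unit) := none
  sym : Option A := none
  symL : Option A := none
  act : Option (Q × Move × A × Move × Option (DescSymbol S)) := none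
  run : Bool := true
  pending : Pending S := .idle
  read : Option (DescSymbol S) := none
  val : Bool := false
  bit : Option Bool := none
  letter : Option S := none

instance {Q A S : Type} [Finite Q] [Finite A] [Finite S] : Finite (NCMem Q A S) :=
  .of_injective (β := Q × Option (InputCell Unit) × Option (InputCell Unit) × Option A × Option A ×
      Option (Q × Move × A × Move × Option (DescSymbol S)) × Bool × Pending S ×
      Option (DescSymbol S) × Bool × Option Bool × Option S)
    (fun m => (m.state, m.cell, m.cellL, m.sym, m.symL, m.act, m.run, m.pending, m.read, m.val,
      m.bit, m.letter))
    (by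
      rintro ⟨⟩ ⟨⟩ h
      simp only [Prod.mk.injEq] at h
      simp only [NCMem.mk.injEq]
      exact h)

/-! ### Fragments that transfer or clear the stacks of the circuit machine -/

namespace NCMachine

variable {S : Type} (M : Transducer Unit (DescSymbol S))

abbrev NCFrag : Type 1 := Frag (NCTape.Symbol M.A S) (NCMem M.Q M.A S)

abbrev NCStmt : Type := TM2.Stmt (NCTape.Symbol M.A S) Unit (NCMem M.Q M.A S)

/-- Move the stack `xt` to the stack `x`. -/
noncomputable def rewindX : NCFrag M :=
  Frag.move (Γ := NCTape.Symbol M.A S) .xt .x some NCMem.letter fun o m => { m with letter := o }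

theorem runs_rewindX {m : NCMem M.Q M.A S} (hm : m.letter = none) (T : NCStacks M.A S) :
    (rewindX M).Runs (m, T.stk)
      (m, { T with xt := [], x := T.xt.reverse ++ T.x }.stk) (T.xt.length + 1) := by
  have h := Frag.runs_move (Γ := NCTape.Symbol M.A S) (σ := NCMem M.Q M.A S)
    (a := .xt) (b := .x) (φ := some) (get := NCMem.letter)
    (put := fun o m => { m with letter := o }) (fun _ _ => rfl) (fun _ _ _ => rfl) (by simp)
    (v := m) (by cases m; simp_all) T.stk
  simp at h
  exact h

/-- Move the stack `vt` to the stack `v`. -/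
noncomputable def rewindV : NCFrag M :=
  Frag.move (Γ := NCTape.Symbol M.A S) .vt .v some NCMem.bit fun o m => { m with bit := o }

theorem runs_rewindV {m : NCMem M.Q M.A S} (hm : m.bit = none) (T : NCStacks M.A S) :
    (rewindV M).Runs (m, T.stk)
      (m, { T with vt := [], v := T.vt.reverse ++ T.v }.stk) (T.vt.length + 1) := by
  have h := Frag.runs_move (Γ := NCTape.Symbol M.A S) (σ := NCMem M.Q M.A S)
    (a := .vt) (b := .v) (φ := some) (get := NCMem.bit)
    (put := fun o m => { m with bit := o }) (fun _ _ => rfl) (fun _ _ _ => rfl) (by simp)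
    (v := m) (by cases m; simp_all) T.stk
  simp at h
  exact h

/-- Move the stack `v` to the stack `vt`. -/
noncomputable def advanceV : NCFrag M :=
  Frag.move (Γ := NCTape.Symbol M.A S) .v .vt some NCMem.bit fun o m => { m with bit := o }

theorem runs_advanceV {m : NCMem M.Q M.A S} (hm : m.bit = none) (T : NCStacks M.A S) :
    (advanceV M).Runs (m, T.stk)
      (m, { T with v := [], vt := T.v.reverse ++ T.vt }.stk) (T.v.length + 1) := by
  have h := Frag.runs_move (Γ := NCTape.Symbol M.A S) (σ := NCMem M.Q M.A S)
    (a := .v) (b := .vt) (φ := some) (get := NCMem.bit)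
    (put := fun o m => { m with bit := o }) (fun _ _ => rfl) (fun _ _ _ => rfl) (by simp)
    (v := m) (by cases m; simp_all) T.stk
  simp at h
  exact h

/-- Move the stack `outR` to the stack `out`. -/
noncomputable def reverseOut : NCFrag M :=
  Frag.move (Γ := NCTape.Symbol M.A S) .outR .out some NCMem.letter
    fun o m => { m with letter := o }

theorem runs_reverseOut {m : NCMem M.Q M.A S} (hm : m.letter = none) (T : NCStacks M.A S) :
    (reverseOut M).Runs (m, T.stk)
      (m, { T with outR := [], out := T.outR.reverse ++ T.out }.stk) (T.outR.length + 1) := by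
  have h := Frag.runs_move (Γ := NCTape.Symbol M.A S) (σ := NCMem M.Q M.A S)
    (a := .outR) (b := .out) (φ := some) (get := NCMem.letter)
    (put := fun o m => { m with letter := o }) (fun _ _ => rfl) (fun _ _ _ => rfl) (by simp)
    (v := m) (by cases m; simp_all) T.stk
  simp at h
  exact h

/-- Move the stack `descR` to the stack `desc`. -/
noncomputable def reverseDesc : NCFrag M :=
  Frag.move (Γ := NCTape.Symbol M.A S) .descR .desc some NCMem.read fun o m => { m with read := o }

theorem runs_reverseDesc {m : NCMem M.Q M.A S} (hm : m.read = none) (T : NCStacks M.A S) :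
    (reverseDesc M).Runs (m, T.stk)
      (m, { T with descR := [], desc := T.descR.reverse ++ T.desc }.stk) (T.descR.length + 1) := by
  have h := Frag.runs_move (Γ := NCTape.Symbol M.A S) (σ := NCMem M.Q M.A S)
    (a := .descR) (b := .desc) (φ := some) (get := NCMem.read)
    (put := fun o m => { m with read := o }) (fun _ _ => rfl) (fun _ _ _ => rfl) (by simp)
    (v := m) (by cases m; simp_all) T.stk
  simp at h
  exact h

def clearX : NCFrag M :=
  Frag.clear (Γ := NCTape.Symbol M.A S) .x NCMem.letter fun o m => { m with letter := o }

theorem runs_clearX {m : NCMem M.Q M.A S} (hm : m.letter = none) (T : NCStacks M.A S) :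
    (clearX M).Runs (m, T.stk) (m, { T with x := [] }.stk) (T.x.length + 1) := by
  have h := Frag.runs_clear (Γ := NCTape.Symbol M.A S) (σ := NCMem M.Q M.A S)
    (a := .x) (get := NCMem.letter)
    (put := fun o m => { m with letter := o }) (fun _ _ => rfl) (fun _ _ _ => rfl)
    (v := m) (by cases m; simp_all) T.stk
  simp at h
  exact h

def clearV : NCFrag M :=
  Frag.clear (Γ := NCTape.Symbol M.A S) .v NCMem.bit fun o m => { m with bit := o }

theorem runs_clearV {m : NCMem M.Q M.A S} (hm : m.bit = none) (T : NCStacks M.A S) :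
    (clearV M).Runs (m, T.stk) (m, { T with v := [] }.stk) (T.v.length + 1) := by
  have h := Frag.runs_clear (Γ := NCTape.Symbol M.A S) (σ := NCMem M.Q M.A S)
    (a := .v) (get := NCMem.bit)
    (put := fun o m => { m with bit := o }) (fun _ _ => rfl) (fun _ _ _ => rfl)
    (v := m) (by cases m; simp_all) T.stk
  simp at h
  exact h

def clearInL : NCFrag M :=
  Frag.clear (Γ := NCTape.Symbol M.A S) .inL NCMem.cell fun o m => { m with cell := o }

theorem runs_clearInL {m : NCMem M.Q M.A S} (hm : m.cell = none) (T : NCStacks M.A S) :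
    (clearInL M).Runs (m, T.stk) (m, { T with inL := [] }.stk) (T.inL.length + 1) := by
  have h := Frag.runs_clear (Γ := NCTape.Symbol M.A S) (σ := NCMem M.Q M.A S)
    (a := .inL) (get := NCMem.cell)
    (put := fun o m => { m with cell := o }) (fun _ _ => rfl) (fun _ _ _ => rfl)
    (v := m) (by cases m; simp_all) T.stk
  simp at h
  exact h

def clearInR : NCFrag M :=
  Frag.clear (Γ := NCTape.Symbol M.A S) .inR NCMem.cell fun o m => { m with cell := o }

theorem runs_clearInR {m : NCMem M.Q M.A S} (hm : m.cell = none) (T : NCStacks M.A S) :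
    (clearInR M).Runs (m, T.stk) (m, { T with inR := [] }.stk) (T.inR.length + 1) := by
  have h := Frag.runs_clear (Γ := NCTape.Symbol M.A S) (σ := NCMem M.Q M.A S)
    (a := .inR) (get := NCMem.cell)
    (put := fun o m => { m with cell := o }) (fun _ _ => rfl) (fun _ _ _ => rfl)
    (v := m) (by cases m; simp_all) T.stk
  simp at h
  exact h

def clearWL : NCFrag M :=
  Frag.clear (Γ := NCTape.Symbol M.A S) .wL NCMem.sym fun o m => { m with sym := o }

theorem runs_clearWL {m : NCMem M.Q M.A S} (hm : m.sym = none) (T : NCStacks M.A S) :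
    (clearWL M).Runs (m, T.stk) (m, { T with wL := [] }.stk) (T.wL.length + 1) := by
  have h := Frag.runs_clear (Γ := NCTape.Symbol M.A S) (σ := NCMem M.Q M.A S)
    (a := .wL) (get := NCMem.sym)
    (put := fun o m => { m with sym := o }) (fun _ _ => rfl) (fun _ _ _ => rfl)
    (v := m) (by cases m; simp_all) T.stk
  simp at h
  exact h

def clearWR : NCFrag M :=
  Frag.clear (Γ := NCTape.Symbol M.A S) .wR NCMem.sym fun o m => { m with sym := o }

theorem runs_clearWR {m : NCMem M.Q M.A S} (hm : m.sym = none) (T : NCStacks M.A S) :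
    (clearWR M).Runs (m, T.stk) (m, { T with wR := [] }.stk) (T.wR.length + 1) := by
  have h := Frag.runs_clear (Γ := NCTape.Symbol M.A S) (σ := NCMem M.Q M.A S)
    (a := .wR) (get := NCMem.sym)
    (put := fun o m => { m with sym := o }) (fun _ _ => rfl) (fun _ _ _ => rfl)
    (v := m) (by cases m; simp_all) T.stk
  simp at h
  exact h

noncomputable def copyX : NCFrag M :=
  Frag.moveTwo (Γ := NCTape.Symbol M.A S) .x .xt .inR some
    (fun _ => some (InputCell.sym ())) NCMem.letter fun o m => { m with letter := o }

theorem runs_copyX {m : NCMem M.Q M.A S} (hm : m.letter = none) (T : NCStacks M.A S) :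
    (copyX M).Runs (m, T.stk) (m, { T with
      x := []
      xt := T.x.reverse ++ T.xt
      inR := List.replicate T.x.length (InputCell.sym ()) ++ T.inR }.stk) (T.x.length + 1) := by
  have h := Frag.runs_moveTwo (Γ := NCTape.Symbol M.A S) (σ := NCMem M.Q M.A S)
    (a := .x) (b := .xt) (b' := .inR) (φ := some)
    (ψ := fun _ => some (InputCell.sym ())) (get := NCMem.letter)
    (put := fun o m => { m with letter := o })
    (fun _ _ => rfl) (fun _ _ _ => rfl) (by simp) (by simp) (by simp)
    (v := m) (by cases m; simp_all) T.stk
  simp at h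
  exact h

def pushInR (c : InputCell Unit) : NCFrag M :=
  Frag.stmt (Γ := NCTape.Symbol M.A S) (.push .inR (fun _ => c) .halt)

theorem runs_pushInR (c : InputCell Unit) (m : NCMem M.Q M.A S) (T : NCStacks M.A S) :
    (pushInR M c).Runs (m, T.stk) (m, { T with inR := c :: T.inR }.stk) 1 :=
  Frag.runs_stmt (by simp)

/-- Write an input tape of the same length as `x`. -/
noncomputable def writeInput : NCFrag M :=
  ((pushInR M .rightEnd).seq (copyX M)).seq ((rewindX M).seq (pushInR M .leftEnd))

def inputTape (n : ℕ) : List (InputCell Unit) :=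
  .leftEnd :: (List.replicate n (.sym ()) ++ [.rightEnd])

theorem runs_writeInput {m : NCMem M.Q M.A S} (hm : m.letter = none) (x : List S) :
    (writeInput M).Runs (m, ({ x := x } : NCStacks M.A S).stk)
      (m, ({ x := x, inR := inputTape x.length } : NCStacks M.A S).stk) (2 * x.length + 4) := by
  have h₁ := runs_pushInR M .rightEnd m { x := x }
  have h₂ := runs_copyX M hm { x := x, inR := [.rightEnd] }
  have h₃ := runs_rewindX M hm
    { xt := x.reverse, inR := List.replicate x.length (.sym ()) ++ [.rightEnd] }
  have h₄ := runs_pushInR M .leftEnd m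
    { x := x, inR := List.replicate x.length (.sym ()) ++ [.rightEnd] }
  simp only [List.append_nil, List.reverse_reverse, List.length_reverse] at h₂ h₃
  exact ((h₁.seq h₂).seq (h₃.seq h₄)).mono (by omega)

end NCMachine
end PseudoPolylog

namespace PseudoPolylog

open Turing Function

/-! #### Zippers -/

namespace Zipper

variable {α : Type}

def keepL : Move → Option α → Option α
  | .left, _ => none
  | _, l => l

def keepR : Move → Option α → Option α
  | .right, _ => none
  | _, c => c

def moveL : Move → Option α → Option α
  | .left, l => l
  | _, _ => none

def moveR : Move → Option α → Option α
  | .right, c => c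
  | _, _ => none

/-- The cells to the left of the head, in reverse order, after the symbol `c` has been written and
the head has been moved. -/
def shiftL (m : Move) (c : Option α) (L : List α) : List α :=
  (moveR m c).toList ++ ((keepL m L.head?).toList ++ L.tail)

/-- The cells from the head on after the symbol `c` has been written and the head has been moved. -/
def shiftR (m : Move) (c : Option α) (L R : List α) : List α :=
  (moveL m L.head?).toList ++ ((keepR m c).toList ++ R.tail)

/-- The number of cells to the left of the head is its position; on an empty left part a move to the
left does nothing, in accordance with the truncation in `Move.apply`. -/
theorem length_shiftL (m : Move) (c : α) (L : List α) :
    (shiftL m (some c) L).length = m.apply L.length := by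
  cases m <;> cases L <;> rfl

theorem shiftL_append_shiftR (m : Move) (c : α) (L R : List α) :
    (shiftL m (some c) L).reverse ++ shiftR m (some c) L R = L.reverse ++ c :: R.tail := by
  cases m <;> cases L <;> simp [shiftL, shiftR, keepL, keepR, moveL, moveR]

theorem length_shift_le (m : Move) (c : Option α) (L R : List α) :
    (shiftL m c L).length + (shiftR m c L R).length ≤ L.length + R.length + 1 := by
  cases m <;> cases L <;> cases R <;> cases c <;>
    simp [shiftL, shiftR, keepL, keepR, moveL, moveR] <;> omega

theorem length_shift_stay_none_le (L R : List α) :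
    (shiftL .stay none L).length + (shiftR .stay none L R).length ≤ L.length + R.length := by
  cases L <;> cases R <;> simp [shiftL, shiftR, keepL, keepR, moveL, moveR]

theorem length_shift_head (m : Move) (L R : List α) :
    (shiftL m R.head? L).length + (shiftR m R.head? L R).length = L.length + R.length := by
  cases m <;> cases L <;> cases R <;>
    simp [shiftL, shiftR, keepL, keepR, moveL, moveR] <;> omega

theorem head?_getD (L R : List α) (b : α) :
    R.head?.getD b = (L.reverse ++ R).getD L.length b := by
  rw [List.getD_append_right _ _ _ _ (by simp)]
  cases R <;> simp

/-- Holds also for empty `R`: unvisited cells are not stored, and the default value `b` plays the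
role of the blank. -/
theorem getD_cons_tail (L R : List α) (a b : α) (j : ℕ) :
    (L.reverse ++ a :: R.tail).getD j b =
      update (fun j => (L.reverse ++ R).getD j b) L.length a j := by
  rw [update_apply]
  rcases lt_trichotomy j L.length with h | h | h
  · rw [if_neg (by omega), List.getD_append _ _ _ _ (by simpa), List.getD_append _ _ _ _ (by simpa)]
  · subst h
    rw [if_pos rfl, List.getD_append_right _ _ _ _ (by simp)]
    simp
  · obtain ⟨i, rfl⟩ : ∃ i, j = L.length + 1 + i := ⟨j - L.length - 1, by omega⟩
    rw [if_neg (by omega), List.getD_append_right _ _ _ _ (by simp; omega),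
      List.getD_append_right _ _ _ _ (by simp; omega), List.length_reverse,
      show L.length + 1 + i - L.length = i + 1 by omega]
    cases R <;> simp

end Zipper

namespace NCMachine

variable {S : Type} (M : Transducer Unit (DescSymbol S))

/-! #### The simulation of the transducer -/

/-- What the transducer does in one step. -/
abbrev TransducerAction : Type := M.Q × Move × M.A × Move × Option (DescSymbol S)

/-- The symbol written on the work tape. -/
abbrev written (a : TransducerAction M) : M.A := a.2.2.1

/-- The movement of the input head, which does not leave the tape. -/
def inShift : Option (InputCell Unit) → Option (TransducerAction M) → Move
  | some .rightEnd, some (_, .right, _) => .stay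
  | _, some (_, m, _) => m
  | _, none => .stay

def workShift : Option (TransducerAction M) → Move
  | some (_, _, _, m, _) => m
  | none => .stay

/-- The scanned cell and its left neighbour are popped on both tapes, and each is pushed back on the
side where it belongs after the move. This keeps a whole step of the transducer within one
statement. -/
noncomputable def simStmt : NCStmt M :=
  .pop .inR (fun m o => { m with cell := o }) <|
  .pop .inL (fun m o => { m with cellL := o }) <|
  .pop .wR (fun m o => { m with sym := o }) <|
  .pop .wL (fun m o => { m with symL := o }) <|
  .load (fun m => { m with act := m.cell.bind fun c => M.δ m.state c (m.sym.getD M.blank) }) <|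
  pushOption .descR (fun m => m.act.bind fun a => a.2.2.2.2) <|
  pushOption .inL (fun m => Zipper.keepL (inShift M m.cell m.act) m.cellL) <|
  pushOption .inR (fun m => Zipper.keepR (inShift M m.cell m.act) m.cell) <|
  pushOption .inL (fun m => Zipper.moveR (inShift M m.cell m.act) m.cell) <|
  pushOption .inR (fun m => Zipper.moveL (inShift M m.cell m.act) m.cellL) <|
  pushOption .wL (fun m => Zipper.keepL (workShift M m.act) m.symL) <|
  pushOption .wR (fun m => Zipper.keepR (workShift M m.act) (m.act.map (written M))) <|
  pushOption .wL (fun m => Zipper.moveR (workShift M m.act) (m.act.map (written M))) <|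
  pushOption .wR (fun m => Zipper.moveL (workShift M m.act) m.symL) <|
  .load (fun m => { state := m.act.elim m.state Prod.fst, run := m.act.isSome }) .halt

theorem runs_simStmt (q : M.Q) (T : NCStacks M.A S)
    (act : Option (TransducerAction M))
    (h : (T.inR.head?.bind fun c => M.δ q c (T.wR.head?.getD M.blank)) = act) :
    (Frag.stmt (simStmt M)).Runs ({ state := q }, T.stk)
      ({ state := act.elim q Prod.fst, run := act.isSome },
        { T with
          descR := (act.bind fun a => a.2.2.2.2).toList ++ T.descR
          inL := Zipper.shiftL (inShift M T.inR.head? act) T.inR.head? T.inL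
          inR := Zipper.shiftR (inShift M T.inR.head? act) T.inR.head? T.inL T.inR
          wL := Zipper.shiftL (workShift M act) (act.map (written M)) T.wL
          wR := Zipper.shiftR (workShift M act) (act.map (written M)) T.wL T.wR }.stk) 1 := by
  refine Frag.runs_stmt ?_
  subst h
  simp [simStmt, Zipper.shiftL, Zipper.shiftR]

theorem getElem?_inputTape (x : List Unit) {p : ℕ} (hp : p ≤ x.length + 1) :
    (inputTape x.length)[p]? = some (inputCell x p) := by
  unfold inputTape inputCell
  rcases p with _ | p
  · rfl
  · simp only [List.getElem?_cons_succ, Nat.add_sub_cancel, Nat.succ_ne_zero, if_false]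
    by_cases h : p < x.length
    · rw [List.getElem?_append_left (by simpa), List.getElem?_eq_getElem h]
      simp [h]
    · obtain rfl : p = x.length := by omega
      simp

theorem length_inputTape (n : ℕ) : (inputTape n).length = n + 2 := by
  simp [inputTape]

/-- The stacks represent the configuration `c` of the transducer. -/
structure SimStacks (x : List S) (u : List Unit) (i : ℕ) (c : M.Cfg) (T : NCStacks M.A S) : Prop where
  eq : T = { x := x, inL := T.inL, inR := T.inR, wL := T.wL, wR := T.wR, descR := c.out.reverse }
  tape : T.inL.reverse ++ T.inR = inputTape u.length
  inPos : T.inL.length = c.inPos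
  inPos_le : c.inPos ≤ u.length + 1
  work : ∀ j, c.work j = (T.wL.reverse ++ T.wR).getD j M.blank
  workPos : T.wL.length = c.workPos
  length_le : T.wL.length + T.wR.length ≤ i
  length_out_le : c.out.length ≤ i

variable {M} {x : List S} {u : List Unit} {i : ℕ} {c c' : M.Cfg} {T : NCStacks M.A S}

theorem SimStacks.head?_inR (h : SimStacks M x u i c T) :
    T.inR.head? = some (inputCell u c.inPos) := by
  rw [← getElem?_inputTape u h.inPos_le, ← h.tape, ← h.inPos,
    List.getElem?_append_right (by simp)]
  simp [List.head?_eq_getElem?]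

theorem SimStacks.delta_eq (h : SimStacks M x u i c T) :
    (T.inR.head?.bind fun a => M.δ c.state a (T.wR.head?.getD M.blank)) =
      M.δ c.state (inputCell u c.inPos) (c.work c.workPos) := by
  rw [h.head?_inR, Option.bind_some, Zipper.head?_getD T.wL, h.work, h.workPos]

theorem SimStacks.step (h : SimStacks M x u i c T) (hs : M.step u c = some c') :
    ∃ T', SimStacks M x u (i + 1) c' T' ∧
      (Frag.stmt (simStmt M)).Runs ({ state := c.state }, T.stk) ({ state := c'.state }, T'.stk) 1 := by
  obtain ⟨q, m, a, m', o, hδ, rfl⟩ := Transducer.step_eq_some hs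
  refine ⟨_, ?_, runs_simStmt M c.state T _ (h.delta_eq.trans hδ)⟩
  have hcell := h.head?_inR
  have hR : T.inR = inputCell u c.inPos :: T.inR.tail := by
    cases hT : T.inR with
    | nil => rw [hT] at hcell; cases hcell
    | cons b l => rw [hT] at hcell; cases hcell; rfl
  have hlen : T.inL.length + T.inR.length = u.length + 2 := by
    rw [← length_inputTape, ← h.tape]; simp
  refine ⟨?_, ?_, ?_, ?_, ?_, ?_, ?_, ?_⟩
  · rw [h.eq]
    cases o <;> simp
  · simp only [hcell]
    rw [Zipper.shiftL_append_shiftR, ← hR, h.tape]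
  · simp only [hcell]
    rw [Zipper.length_shiftL, h.inPos]
    have hle := h.inPos_le
    -- The transducer clamps the head by position, whereas `inShift` only sees the scanned symbol.
    -- They agree because the right end marker is scanned exactly at the last position.
    have hend : inputCell u c.inPos = .rightEnd ↔ c.inPos = u.length + 1 := by
      unfold inputCell
      split_ifs with h0
      · simp [h0]
      · by_cases hlt : c.inPos - 1 < u.length
        · rw [List.getElem?_eq_getElem hlt]
          simp
          omega
        · rw [List.getElem?_eq_none (by omega)]
          simp
          omega
    cases hc : inputCell u c.inPos <;> cases m <;>
      simp only [hc, reduceCtorEq, false_iff, true_iff] at hend <;>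
      simp only [inShift, Move.apply] <;> omega
  · exact min_le_right _ _
  · intro j
    simp only [Option.map_some]
    rw [Zipper.shiftL_append_shiftR, Zipper.getD_cons_tail, ← h.workPos]
    congr 1
    funext j
    exact h.work j
  · simp only [Option.map_some, workShift]
    rw [Zipper.length_shiftL, h.workPos]
  · have := Zipper.length_shift_le (workShift M (some (q, m, a, m', o))) (some a) T.wL T.wR
    have := h.length_le
    simp only [Option.map_some, written]
    omega
  · have := h.length_out_le
    cases o <;> simp <;> omega

/-- When no action exists, the scanned work symbol is dropped, which does not matter because the
work stacks are cleared next. Only lengths of these stacks have to be tracked, for the cost of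
clearing. -/
theorem SimStacks.halt (h : SimStacks M x u i c T) (hs : M.step u c = none) :
    ∃ T' : NCStacks M.A S, T' = {
        x := x, inL := T'.inL, inR := T'.inR, wL := T'.wL, wR := T'.wR,
        descR := c.out.reverse } ∧ T'.inL.length + T'.inR.length ≤ u.length + 2 ∧
      T'.wL.length + T'.wR.length ≤ i ∧ c.out.length ≤ i ∧
      (Frag.stmt (simStmt M)).Runs ({ state := c.state }, T.stk)
        ({ state := c.state, run := false }, T'.stk) 1 := by
  have hδ : M.δ c.state (inputCell u c.inPos) (c.work c.workPos) = none := by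
    simpa [Transducer.step] using hs
  have hlen : T.inL.length + T.inR.length = u.length + 2 := by
    rw [← length_inputTape, ← h.tape]; simp
  refine ⟨_, ?_, ?_, ?_, h.length_out_le, runs_simStmt M c.state T _ (h.delta_eq.trans hδ)⟩
  · rw [h.eq]
    simp
  · exact (Zipper.length_shift_head _ _ _).le.trans hlen.le
  · exact (Zipper.length_shift_stay_none_le _ _).trans h.length_le

theorem runs_loop_simStmt {n : ℕ} (h : SimStacks M x u i c T) (hs : StepsIn (M.step u) n c c')
    (hc : M.step u c' = none) :
    ∃ T' : NCStacks M.A S, T' = {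
        x := x, inL := T'.inL, inR := T'.inR, wL := T'.wL, wR := T'.wR,
        descR := c'.out.reverse } ∧ T'.inL.length + T'.inR.length ≤ u.length + 2 ∧
      T'.wL.length + T'.wR.length ≤ i + n ∧ c'.out.length ≤ i + n ∧
      (Frag.loop NCMem.run (Frag.stmt (simStmt M))).Runs ({ state := c.state }, T.stk)
        ({ state := c'.state, run := false }, T'.stk) (2 * n + 3) := by
  induction hs generalizing i T with
  | zero =>
    obtain ⟨T', h₁, h₂, h₃, h₄, hr⟩ := h.halt hc
    exact ⟨T', h₁, h₂, h₃, h₄, hr.loop_true rfl (Frag.runs_loop_false rfl)⟩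
  | @head n _ _ _ hs _ ih =>
    obtain ⟨T₁, hT₁, hr₁⟩ := h.step hs
    obtain ⟨T', h₁, h₂, h₃, h₄, hr⟩ := ih hT₁ hc
    exact ⟨T', h₁, h₂, by omega, by omega, (hr₁.loop_true rfl hr).mono (by omega)⟩

variable (M)

/-- Write the description of the circuit on the stack `desc`. -/
noncomputable def construct : NCFrag M :=
  (writeInput M).seq <| (Frag.loop NCMem.run (Frag.stmt (simStmt M))).seq <|
  (clearInL M).seq <| (clearInR M).seq <| (clearWL M).seq <| (clearWR M).seq (reverseDesc M)

/-- A transducer emits at most one symbol per step, so its running time also bounds the length of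
the description. -/
theorem runs_construct {n : ℕ} (hs : StepsIn (M.step (List.replicate x.length ())) n M.init c)
    (hc : M.step (List.replicate x.length ()) c = none) :
    (construct M).Runs ({ state := M.start }, ({ x := x } : NCStacks M.A S).stk)
        ({ state := c.state, run := false }, ({ x := x, desc := c.out } : NCStacks M.A S).stk)
        (4 * x.length + 5 * n + 20) ∧ c.out.length ≤ n := by
  have h₀ := runs_writeInput M (m := { state := M.start }) rfl x
  obtain ⟨T, hT, h₁, h₂, h₃, hr⟩ := runs_loop_simStmt (M := M) (x := x)
    (u := List.replicate x.length ()) (i := 0) (T := { x := x, inR := inputTape x.length })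
    ⟨rfl, by simp, rfl, Nat.zero_le _, fun j => rfl, rfl, le_rfl, le_rfl⟩ hs hc
  rw [Nat.zero_add] at h₂ h₃
  rw [List.length_replicate] at h₁
  have h₄ := runs_clearInL M (m := { state := c.state, run := false }) rfl T
  have h₅ := runs_clearInR M (m := { state := c.state, run := false }) rfl { T with inL := [] }
  have h₆ := runs_clearWL M (m := { state := c.state, run := false }) rfl
    { T with inL := [], inR := [] }
  have h₇ := runs_clearWR M (m := { state := c.state, run := false }) rfl
    { T with inL := [], inR := [], wL := [] }
  have h₈ := runs_reverseDesc M (m := { state := c.state, run := false }) rfl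
    { T with inL := [], inR := [], wL := [], wR := [] }
  have e : ({ T with
      inL := [], inR := [], wL := [], wR := [], descR := [],
      desc := T.descR.reverse ++ T.desc } : NCStacks M.A S) = { x := x, desc := c.out } := by
    rw [hT]; simp
  have hd : T.descR.length = c.out.length := by rw [hT]; simp
  simp only [e] at h₈
  refine ⟨(h₀.seq (hr.seq (h₄.seq (h₅.seq (h₆.seq (h₇.seq h₈)))))).mono ?_, h₃⟩
  simp only [hd]
  omega

end NCMachine
end PseudoPolylog

namespace PseudoPolylog

open Turing Function

namespace NCMachine

variable {S : Type} (M : Transducer Unit (DescSymbol S))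

/-! #### The evaluation of the circuit -/

def isTick : Option (DescSymbol S) → Bool
  | some .tick => true
  | _ => false

def startEval : NCFrag M :=
  Frag.stmt (Γ := NCTape.Symbol M.A S) (.load (fun m => { m with run := true }) .halt)

def readDesc : NCFrag M :=
  Frag.stmt (Γ := NCTape.Symbol M.A S)
    (.pop .desc (fun m o => { m with read := o, run := o.isSome }) .halt)

/-- Advance the cursors on the input and on the values of the gates. -/
noncomputable def tickFrag : NCFrag M :=
  Frag.stmt (Γ := NCTape.Symbol M.A S) <|
    .pop .x (fun m o => { m with letter := o }) <|
    .pop .v (fun m o => { m with bit := o }) <|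
    pushOption .xt NCMem.letter <|
    pushOption .vt NCMem.bit <|
    .load (fun m => { m with letter := none, bit := none, read := none }) .halt

/-- The cursor advances on `x` and `v` together, so the tops of these stacks are the input symbol
and the gate value to which the pending item may refer; an exhausted list gives `none` and `false`.
-/
noncomputable def valueFrag : NCFrag M :=
  Frag.stmt (Γ := NCTape.Symbol M.A S) <|
    .peek .x (fun m o => { m with letter := o }) <|
    .peek .v (fun m o => { m with bit := o }) <|
    .load (fun m => { m with
      val := m.pending.value m.letter (m.bit.getD false), letter := none, bit := none }) <|
    pushOption .outR (fun m => m.pending.emitted m.val) .halt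

noncomputable def appendFrag : NCFrag M :=
  Frag.stmt (Γ := NCTape.Symbol M.A S) <|
    pushOption .vt (fun m => m.pending.appended m.read m.val) <|
    .load (fun m => { m with
      pending := m.pending.next m.read m.val, val := false, read := none }) .halt

/-- A new gate value belongs at the end of the list, the bottom of `v`. After all of `v` has been
moved to `vt` that end is on top; rewinding afterwards also resets the cursor. -/
noncomputable def flushFrag : NCFrag M :=
  (valueFrag M).seq <| (rewindX M).seq <| (advanceV M).seq <| (appendFrag M).seq (rewindV M)

noncomputable def evalBody : NCFrag M :=
  (readDesc M).seq (Frag.ite (fun m => isTick m.read) (tickFrag M) (flushFrag M))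

/-- The stacks that represent the state `s` of the evaluation on input `x`, when `l` remains to be
read. -/
def evalStacks (A : Type) (x : List S) (s : EvalState S) (l : List (DescSymbol S)) :
    NCStacks A S where
  x := x.drop s.cursor
  xt := (x.take s.cursor).reverse
  desc := l
  v := s.values.drop s.cursor
  vt := (s.values.take s.cursor).reverse
  outR := s.out.reverse

variable (x : List S) (s : EvalState S) (q : M.Q)

theorem toList_getElem?_append_reverse_take {α : Type} (l : List α) (n : ℕ) :
    l[n]?.toList ++ (l.take n).reverse = (l.take (n + 1)).reverse := by
  rw [List.take_add_one, List.reverse_append]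
  cases l[n]? <;> rfl

theorem runs_tickFrag (l : List (DescSymbol S)) :
    (tickFrag M).Runs
      ({ state := q, pending := s.pending, read := some .tick }, (evalStacks M.A x s l).stk)
      ({ state := q, pending := s.pending }, (evalStacks M.A x (s.read x .tick) l).stk) 1 := by
  refine Frag.runs_stmt ?_
  simp [evalStacks, EvalState.read, toList_getElem?_append_reverse_take]

theorem runs_flushFrag (c : Option (DescSymbol S)) (l : List (DescSymbol S)) :
    (flushFrag M).Runs
      ({ state := q, pending := s.pending, read := c, run := c.isSome },
        (evalStacks M.A x s l).stk)
      ({ state := q, pending := (s.flush x c).pending, run := c.isSome },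
        (evalStacks M.A x (s.flush x c) l).stk) (x.length + 2 * s.values.length + 6) := by
  let m₁ : NCMem M.Q M.A S :=
    { state := q, pending := s.pending, read := c, run := c.isSome, val := s.value x }
  let m₂ : NCMem M.Q M.A S :=
    { state := q, pending := (s.flush x c).pending, run := c.isSome }
  let T₁ : NCStacks M.A S :=
    { evalStacks M.A x s l with outR := (s.flush x c).out.reverse }
  have h₁ : (valueFrag M).Runs
      ({ state := q, pending := s.pending, read := c, run := c.isSome },
        (evalStacks M.A x s l).stk) (m₁, T₁.stk) 1 := by
    refine Frag.runs_stmt ?_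
    simp [m₁, T₁, evalStacks, EvalState.value, EvalState.flush, List.head?_drop,
      List.getD_eq_getElem?_getD]
    cases Pending.emitted _ s.pending <;> rfl
  have h₂ := runs_rewindX M (m := m₁) rfl T₁
  have h₃ := runs_advanceV M (m := m₁) rfl { T₁ with xt := [], x := T₁.xt.reverse ++ T₁.x }
  let T₃ : NCStacks M.A S :=
    { T₁ with xt := [], x := T₁.xt.reverse ++ T₁.x, v := [], vt := T₁.v.reverse ++ T₁.vt }
  let T₄ : NCStacks M.A S := { T₃ with vt := (s.flush x c).values.reverse }
  have h₄ : (appendFrag M).Runs (m₁, T₃.stk) (m₂, T₄.stk) 1 := by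
    refine Frag.runs_stmt ?_
    simp [m₁, m₂, T₁, T₃, T₄, evalStacks, EvalState.flush]
    rw [← List.reverse_append, List.take_append_drop]
    cases Pending.appended _ _ s.pending <;> rfl
  have h₅ := runs_rewindV M (m := m₂) rfl T₄
  have e : ({ T₄ with vt := [], v := T₄.vt.reverse ++ T₄.v } : NCStacks M.A S) =
      evalStacks M.A x (s.flush x c) l := by
    simp [T₄, T₃, T₁, evalStacks, EvalState.flush]
  rw [e] at h₅
  refine (h₁.seq (h₂.seq (h₃.seq (h₄.seq h₅)))).mono ?_
  have := EvalState.length_values_flush_le x s c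
  simp [T₁, T₄, evalStacks]
  omega

theorem runs_evalBody_cons (c : DescSymbol S) (l : List (DescSymbol S)) :
    (evalBody M).Runs ({ state := q, pending := s.pending }, (evalStacks M.A x s (c :: l)).stk)
      ({ state := q, pending := (s.read x c).pending }, (evalStacks M.A x (s.read x c) l).stk)
      (x.length + 2 * s.values.length + 8) := by
  have h₁ : (readDesc M).Runs
      ({ state := q, pending := s.pending }, (evalStacks M.A x s (c :: l)).stk)
      ({ state := q, pending := s.pending, read := some c }, (evalStacks M.A x s l).stk) 1 := by
    refine Frag.runs_stmt ?_
    simp [evalStacks]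
  have h₂ := runs_flushFrag M x s q (some c) l
  refine (h₁.seq (t' := x.length + 2 * s.values.length + 7) ?_).mono (by omega)
  cases c <;> first
    | exact ((runs_tickFrag M x s q l).ite_true rfl).mono (by omega)
    | exact h₂.ite_false rfl

theorem runs_evalBody_nil :
    (evalBody M).Runs ({ state := q, pending := s.pending }, (evalStacks M.A x s []).stk)
      ({ state := q, run := false }, (evalStacks M.A x (s.flush x none) []).stk)
      (x.length + 2 * s.values.length + 8) := by
  have h₁ : (readDesc M).Runs
      ({ state := q, pending := s.pending }, (evalStacks M.A x s []).stk)
      ({ state := q, pending := s.pending, run := false }, (evalStacks M.A x s []).stk) 1 := by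
    refine Frag.runs_stmt ?_
    simp [evalStacks]
  exact (h₁.seq ((runs_flushFrag M x s q none []).ite_false rfl)).mono (by omega)

/-- Each symbol adds at most one gate value, so `B` bounds the list of values throughout and each
round costs at most a rewinding of both lists. -/
theorem runs_loop_evalBody {B : ℕ} (l : List (DescSymbol S)) (hB : s.values.length + l.length ≤ B) :
    (Frag.loop NCMem.run (evalBody M)).Runs
      ({ state := q, pending := s.pending }, (evalStacks M.A x s l).stk)
      ({ state := q, run := false },
        (evalStacks M.A x ((l.foldl (EvalState.read x) s).flush x none) []).stk)
      ((l.length + 1) * (x.length + 2 * B + 9) + 1) := by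
  induction l generalizing s with
  | nil =>
    refine ((runs_evalBody_nil M x s q).loop_true rfl (Frag.runs_loop_false rfl)).mono ?_
    simp at hB ⊢
    omega
  | cons c l ih =>
    have := EvalState.length_values_read_le x s c
    rw [List.length_cons] at hB
    refine ((runs_evalBody_cons M x s q c l).loop_true rfl (ih _ (by omega))).mono ?_
    rw [List.length_cons, Nat.add_mul (l.length + 1) 1]
    omega

theorem length_values_foldl_le (l : List (DescSymbol S)) :
    (l.foldl (EvalState.read x) s).values.length ≤ s.values.length + l.length ∧
      (l.foldl (EvalState.read x) s).out.length ≤ s.out.length + l.length := by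
  induction l generalizing s with
  | nil => simp
  | cons c l ih =>
    have h₁ := EvalState.length_values_read_le x s c
    have h₂ := EvalState.length_out_read_le x s c
    have := ih (s.read x c)
    simp only [List.foldl_cons, List.length_cons]
    omega

/-- Reset the memory. -/
def resetMem : NCFrag M :=
  Frag.stmt (Γ := NCTape.Symbol M.A S) (.load (fun _ => { state := M.start }) .halt)

/-- Evaluate the circuit described on the stack `desc`. -/
noncomputable def evaluate : NCFrag M :=
  (startEval M).seq <| (Frag.loop NCMem.run (evalBody M)).seq <|
  (clearX M).seq <| (clearV M).seq <| (reverseOut M).seq (resetMem M)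

theorem runs_evaluate (C : Circuit S) :
    (evaluate M).Runs
      ({ state := q, run := false }, ({ x := x, desc := C.describe } : NCStacks M.A S).stk)
      ({ state := M.start }, ({ out := C.eval x } : NCStacks M.A S).stk)
      ((C.describe.length + 1) * (x.length + 2 * C.describe.length + 9) + x.length +
        2 * C.describe.length + 8) := by
  have h₁ : (startEval M).Runs
      ({ state := q, run := false }, ({ x := x, desc := C.describe } : NCStacks M.A S).stk)
      ({ state := q, pending := (EvalState.init (S := S)).pending },
        (evalStacks M.A x .init C.describe).stk) 1 := by
    refine Frag.runs_stmt ?_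
    simp [evalStacks, EvalState.init]
  have h₂ := runs_loop_evalBody M x .init q (B := C.describe.length) C.describe
    (by simp [EvalState.init])
  set s := (C.describe.foldl (EvalState.read x) .init).flush x none with hs
  have hv : s.values.length ≤ C.describe.length + 1 :=
    (EvalState.length_values_flush_le x _ _).trans
      (by simpa [EvalState.init] using (length_values_foldl_le x .init C.describe).1)
  have ho : s.out.length ≤ C.describe.length + 1 :=
    (EvalState.length_out_flush_le x _ _).trans
      (by simpa [EvalState.init] using (length_values_foldl_le x .init C.describe).2)
  -- After the final flush nothing is left on `xt` and `vt`, so only `x` and `v` remain to be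
  -- cleared.
  have hc : s.cursor = 0 := rfl
  let T := evalStacks M.A x s []
  have h₃ := runs_clearX M (m := { state := q, run := false }) rfl T
  have h₄ := runs_clearV M (m := { state := q, run := false }) rfl { T with x := [] }
  have h₅ := runs_reverseOut M (m := { state := q, run := false }) rfl
    { T with x := [], v := [] }
  have h₆ : (resetMem M).Runs ({ state := q, run := false }, NCStacks.stk
      { T with x := [], v := [], outR := [], out := T.outR.reverse ++ T.out })
      ({ state := M.start }, ({ out := C.eval x } : NCStacks M.A S).stk) 1 := by
    refine Frag.runs_stmt ?_
    simp [T, evalStacks, hc, s, EvalState.foldl_describe]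
  refine (h₁.seq (h₂.seq (h₃.seq (h₄.seq (h₅.seq h₆))))).mono ?_
  simp [T, evalStacks, hc]
  omega

end NCMachine

/-- The circuit for the length of the input is constructed by running the transducer on that length
in unary, and is then evaluated on the input itself. -/
theorem NCComputable.ptimeComputable {S : Type} [Finite S] {f : List S → List S}
    (hf : NCComputable f) : PTIMEComputable f := by
  obtain ⟨C, hC, -, -, hf⟩ := hf
  obtain ⟨M, T, hT, hM⟩ := hC.exists_polytime
  have := M.finQ
  have := M.finA
  have : Finite (NCTape.Symbol M.A S .x) := ‹Finite S›
  refine ptimeComputable_of_frag ((NCMachine.construct M).seq (NCMachine.evaluate M)) .x .out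
    (.refl S) (.refl S) { state := M.start }
    (T := fun n => (4 * n + 5 * T n + 20) + ((T n + 1) * (n + 2 * T n + 9) + n + 2 * T n + 8))
    ?_ fun x => ?_
  · have h₁ : IsPolyBounded fun n : ℕ => n := .id
    exact ((((IsPolyBounded.const 4).mul h₁).add ((IsPolyBounded.const 5).mul hT)).add
      (.const 20)).add ((((hT.add (.const 1)).mul ((h₁.add ((IsPolyBounded.const 2).mul hT)).add
      (.const 9))).add h₁).add ((IsPolyBounded.const 2).mul hT) |>.add (.const 8))
  · obtain ⟨n, hn, c, hr, hc, ho⟩ := hM (List.replicate x.length ())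
    simp only [List.length_replicate] at hn ho
    obtain ⟨h₁, hl⟩ := NCMachine.runs_construct M (x := x) hr hc
    rw [ho] at h₁ hl
    have h₂ := NCMachine.runs_evaluate M x c.state (C x.length)
    have h := h₁.seq h₂
    have hin : ({ x := x } : NCStacks M.A S).stk =
        update (β := fun k => List (NCTape.Symbol M.A S k)) (fun _ => []) .x
          (x.map (Equiv.refl S)) := by
      funext k; cases k <;> simp
    have hout : ({ out := (C x.length).eval x } : NCStacks M.A S).stk =
        update (β := fun k => List (NCTape.Symbol M.A S k)) (fun _ => []) .out
          ((f x).map (Equiv.refl S)) := by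
      funext k; cases k <;> simp [hf]
    rw [hin, hout] at h
    refine h.mono ?_
    have hl := hl.trans hn
    gcongr

end PseudoPolylog

namespace PseudoPolylog

open Turing Function

/-! ### Combining two machines -/

section Join

variable {K₁ K₂ K₃ : Type} {Γ₁ : K₁ → Type} {Γ₂ : K₂ → Type} {Γ₃ : K₃ → Type}

/-- The stacks of two machines and additional stacks. -/
def joinStk (S₁ : ∀ k, List (Γ₁ k)) (S₂ : ∀ k, List (Γ₂ k)) (S₃ : ∀ k, List (Γ₃ k)) :
    ∀ k, List (Sum.elim Γ₁ (Sum.elim Γ₂ Γ₃) k)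
  | .inl k => S₁ k
  | .inr (.inl k) => S₂ k
  | .inr (.inr k) => S₃ k

variable (S₁ : ∀ k, List (Γ₁ k)) (S₂ : ∀ k, List (Γ₂ k)) (S₃ : ∀ k, List (Γ₃ k))

@[simp] theorem joinStk_inl (k : K₁) : joinStk S₁ S₂ S₃ (.inl k) = S₁ k := rfl
@[simp] theorem joinStk_inr_inl (k : K₂) : joinStk S₁ S₂ S₃ (.inr (.inl k)) = S₂ k := rfl
@[simp] theorem joinStk_inr_inr (k : K₃) : joinStk S₁ S₂ S₃ (.inr (.inr k)) = S₃ k := rfl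

variable [DecidableEq K₁] [DecidableEq K₂] [DecidableEq K₃]

@[simp] theorem update_joinStk_inl (k : K₁) (l : List (Γ₁ k)) :
    update (joinStk S₁ S₂ S₃) (.inl k) l = joinStk (update S₁ k l) S₂ S₃ := by
  funext j
  rcases j with j | j | j
  · by_cases h : j = k
    · subst h
      exact (update_self ..).trans (update_self (f := S₁) ..).symm
    · exact (update_of_ne (by simpa) ..).trans (update_of_ne (f := S₁) h ..).symm
  · exact update_of_ne (by simp) ..
  · exact update_of_ne (by simp) ..

@[simp] theorem update_joinStk_inr_inl (k : K₂) (l : List (Γ₂ k)) :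
    update (joinStk S₁ S₂ S₃) (.inr (.inl k)) l = joinStk S₁ (update S₂ k l) S₃ := by
  funext j
  rcases j with j | j | j
  · exact update_of_ne (by simp) ..
  · by_cases h : j = k
    · subst h
      exact (update_self ..).trans (update_self (f := S₂) ..).symm
    · exact (update_of_ne (by simpa) ..).trans (update_of_ne (f := S₂) h ..).symm
  · exact update_of_ne (by simp) ..

@[simp] theorem update_joinStk_inr_inr (k : K₃) (l : List (Γ₃ k)) :
    update (joinStk S₁ S₂ S₃) (.inr (.inr k)) l = joinStk S₁ S₂ (update S₃ k l) := by
  funext j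
  rcases j with j | j | j
  · exact update_of_ne (by simp) ..
  · exact update_of_ne (by simp) ..
  · by_cases h : j = k
    · subst h
      exact (update_self ..).trans (update_self (f := S₃) ..).symm
    · exact (update_of_ne (by simpa) ..).trans (update_of_ne (f := S₃) h ..).symm

omit [DecidableEq K₁] [DecidableEq K₂] [DecidableEq K₃] in
theorem joinStk_nil : joinStk (fun k => ([] : List (Γ₁ k))) (fun k => ([] : List (Γ₂ k)))
    (fun k => ([] : List (Γ₃ k))) = fun _ => [] := by
  funext j
  rcases j with j | j | j <;> rfl

end Join

section Move

variable {K₁ K₂ K₃ : Type} [DecidableEq K₁] [DecidableEq K₂] [DecidableEq K₃] {Γ₁ : K₁ → Type}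
  {Γ₂ : K₂ → Type} {Γ₃ : K₃ → Type} (S₁ : ∀ k, List (Γ₁ k)) (S₂ : ∀ k, List (Γ₂ k))
  (S₃ : ∀ k, List (Γ₃ k)) {σ : Type}

theorem Frag.Runs.congr_stk {K : Type} [DecidableEq K] {Γ : K → Type} {F : Frag Γ σ}
    {s : Store Γ σ} {v : σ} {S S' : ∀ k, List (Γ k)} {t : ℕ} (h : F.Runs s (v, S) t)
    (e : S = S') : F.Runs s (v, S') t :=
  e ▸ h

/-- The symbol types of the joined machine reduce to those of the parts only by unfolding
`Sum.elim`. The stack equation is therefore composed as a term, up to definitional equality, rather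
than by rewriting. -/
theorem runs_move_fst_trd {k : K₁} {j : K₃} {φ : Γ₁ k → Option (Γ₃ j)} {get : σ → Option (Γ₁ k)}
    {put : Option (Γ₁ k) → σ → σ} (hg : ∀ o v, get (put o v) = o)
    (hp : ∀ o o' v, put o (put o' v) = put o v) {v : σ} (hv : put none v = v) :
    (Frag.move (Γ := Sum.elim Γ₁ (Sum.elim Γ₂ Γ₃)) (.inl k) (.inr (.inr j)) φ get put).Runs
      (v, joinStk S₁ S₂ S₃)
      (v, joinStk (update S₁ k []) S₂ (update S₃ j (((S₁ k).filterMap φ).reverse ++ S₃ j)))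
      ((S₁ k).length + 1) := by
  have h := Frag.runs_move (Γ := Sum.elim Γ₁ (Sum.elim Γ₂ Γ₃)) (a := .inl k) (b := .inr (.inr j))
    (φ := φ) hg hp (by simp) hv (joinStk S₁ S₂ S₃)
  exact h.congr_stk ((congrArg (fun S => update S _ _) (update_joinStk_inl ..)).trans
    (update_joinStk_inr_inr ..))

theorem runs_move_trd_fst {k : K₁} {j : K₃} {φ : Γ₃ j → Option (Γ₁ k)} {get : σ → Option (Γ₃ j)}
    {put : Option (Γ₃ j) → σ → σ} (hg : ∀ o v, get (put o v) = o)
    (hp : ∀ o o' v, put o (put o' v) = put o v) {v : σ} (hv : put none v = v) :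
    (Frag.move (Γ := Sum.elim Γ₁ (Sum.elim Γ₂ Γ₃)) (.inr (.inr j)) (.inl k) φ get put).Runs
      (v, joinStk S₁ S₂ S₃)
      (v, joinStk (update S₁ k (((S₃ j).filterMap φ).reverse ++ S₁ k)) S₂ (update S₃ j []))
      ((S₃ j).length + 1) := by
  have h := Frag.runs_move (Γ := Sum.elim Γ₁ (Sum.elim Γ₂ Γ₃)) (a := .inr (.inr j)) (b := .inl k)
    (φ := φ) hg hp (by simp) hv (joinStk S₁ S₂ S₃)
  exact h.congr_stk ((congrArg (fun S => update S _ _) (update_joinStk_inr_inr ..)).trans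
    (update_joinStk_inl ..))

theorem runs_move_trd_snd {k : K₂} {j : K₃} {φ : Γ₃ j → Option (Γ₂ k)} {get : σ → Option (Γ₃ j)}
    {put : Option (Γ₃ j) → σ → σ} (hg : ∀ o v, get (put o v) = o)
    (hp : ∀ o o' v, put o (put o' v) = put o v) {v : σ} (hv : put none v = v) :
    (Frag.move (Γ := Sum.elim Γ₁ (Sum.elim Γ₂ Γ₃)) (.inr (.inr j)) (.inr (.inl k)) φ get put).Runs
      (v, joinStk S₁ S₂ S₃)
      (v, joinStk S₁ (update S₂ k (((S₃ j).filterMap φ).reverse ++ S₂ k)) (update S₃ j []))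
      ((S₃ j).length + 1) := by
  have h := Frag.runs_move (Γ := Sum.elim Γ₁ (Sum.elim Γ₂ Γ₃)) (a := .inr (.inr j))
    (b := .inr (.inl k)) (φ := φ) hg hp (by simp) hv (joinStk S₁ S₂ S₃)
  exact h.congr_stk ((congrArg (fun S => update S _ _) (update_joinStk_inr_inr ..)).trans
    (update_joinStk_inr_inl ..))

theorem runs_move_trd_trd {i j : K₃} {φ : Γ₃ i → Option (Γ₃ j)} {get : σ → Option (Γ₃ i)}
    {put : Option (Γ₃ i) → σ → σ} (hg : ∀ o v, get (put o v) = o)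
    (hp : ∀ o o' v, put o (put o' v) = put o v) (hij : j ≠ i) {v : σ} (hv : put none v = v) :
    (Frag.move (Γ := Sum.elim Γ₁ (Sum.elim Γ₂ Γ₃)) (.inr (.inr i)) (.inr (.inr j)) φ get put).Runs
      (v, joinStk S₁ S₂ S₃)
      (v, joinStk S₁ S₂ (update (update S₃ i []) j (((S₃ i).filterMap φ).reverse ++ S₃ j)))
      ((S₃ i).length + 1) := by
  have h := Frag.runs_move (Γ := Sum.elim Γ₁ (Sum.elim Γ₂ Γ₃)) (a := .inr (.inr i))
    (b := .inr (.inr j)) (φ := φ) hg hp (by simpa) hv (joinStk S₁ S₂ S₃)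
  exact h.congr_stk ((congrArg (fun S => update S _ _) (update_joinStk_inr_inr ..)).trans
    (update_joinStk_inr_inr ..))

theorem runs_moveTwo_trd {i j j' : K₃} {φ : Γ₃ i → Option (Γ₃ j)} {ψ : Γ₃ i → Option (Γ₃ j')}
    {get : σ → Option (Γ₃ i)} {put : Option (Γ₃ i) → σ → σ} (hg : ∀ o v, get (put o v) = o)
    (hp : ∀ o o' v, put o (put o' v) = put o v) (hij : j ≠ i) (hij' : j' ≠ i) (hj : j' ≠ j)
    {v : σ} (hv : put none v = v) :
    (Frag.moveTwo (Γ := Sum.elim Γ₁ (Sum.elim Γ₂ Γ₃)) (.inr (.inr i)) (.inr (.inr j))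
      (.inr (.inr j')) φ ψ get put).Runs
      (v, joinStk S₁ S₂ S₃)
      (v, joinStk S₁ S₂ (update (update (update S₃ i []) j (((S₃ i).filterMap φ).reverse ++ S₃ j))
        j' (((S₃ i).filterMap ψ).reverse ++ S₃ j')))
      ((S₃ i).length + 1) := by
  have h := Frag.runs_moveTwo (Γ := Sum.elim Γ₁ (Sum.elim Γ₂ Γ₃)) (a := .inr (.inr i))
    (b := .inr (.inr j)) (b' := .inr (.inr j')) (φ := φ) (ψ := ψ) hg hp (by simpa) (by simpa)
    (by simpa) hv (joinStk S₁ S₂ S₃)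
  exact h.congr_stk ((congrArg (fun S => update (update S _ _) _ _) (update_joinStk_inr_inr ..)).trans
    ((congrArg (fun S => update S _ _) (update_joinStk_inr_inr ..)).trans (update_joinStk_inr_inr ..)))

end Move

section Call

variable (tm₁ tm₂ : FinTM2) {K₃ : Type} [DecidableEq K₃] (Γ₃ : K₃ → Type) (R : Type)

abbrev JoinSymbol : tm₁.K ⊕ tm₂.K ⊕ K₃ → Type := Sum.elim tm₁.Γ (Sum.elim tm₂.Γ Γ₃)

abbrev JoinFrag : Type 1 := Frag (JoinSymbol tm₁ tm₂ Γ₃) (tm₁.σ × tm₂.σ × R)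

def callFirst : JoinFrag tm₁ tm₂ Γ₃ R :=
  haveI := tm₁.ΛFin
  Frag.call (Γ := JoinSymbol tm₁ tm₂ Γ₃) (σ := tm₁.σ × tm₂.σ × R) Sum.inl Prod.fst
    (fun a v => (a, v.2)) tm₁.main tm₁.m

def callSecond : JoinFrag tm₁ tm₂ Γ₃ R :=
  haveI := tm₂.ΛFin
  Frag.call (Γ := JoinSymbol tm₁ tm₂ Γ₃) (σ := tm₁.σ × tm₂.σ × R) (fun k => Sum.inr (Sum.inl k))
    (fun v => v.2.1) (fun a v => (v.1, a, v.2.2)) tm₂.main tm₂.m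

variable {tm₁ tm₂ Γ₃ R}

theorem runs_callFirst {a : List (tm₁.Γ tm₁.k₀)} {b : List (tm₁.Γ tm₁.k₁)} {t : ℕ}
    (h : ∃ n ≤ t, StepsIn (TM2.step tm₁.m) n ⟨some tm₁.main, tm₁.initialState, (initList tm₁ a).stk⟩
      ⟨none, tm₁.initialState, (haltList tm₁ b).stk⟩)
    (w : tm₂.σ × R) (S₂ : ∀ k, List (tm₂.Γ k)) (S₃ : ∀ k, List (Γ₃ k)) :
    (callFirst tm₁ tm₂ Γ₃ R).Runs
      ((tm₁.initialState, w), joinStk (update (fun _ => []) tm₁.k₀ a) S₂ S₃)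
      ((tm₁.initialState, w), joinStk (update (fun _ => []) tm₁.k₁ b) S₂ S₃) t := by
  rw [initList_stk, haltList_stk] at h
  have := tm₁.ΛFin
  refine Frag.runs_call (Γ := JoinSymbol tm₁ tm₂ Γ₃) (σ := tm₁.σ × tm₂.σ × R) (e := Sum.inl)
    (get := Prod.fst) (put := fun a v => (a, v.2)) (v := (tm₁.initialState, w))
    (S := joinStk (update (fun _ => []) tm₁.k₀ a) S₂ S₃)
    (S' := joinStk (update (fun _ => []) tm₁.k₁ b) S₂ S₃) Sum.inl_injective
    (fun _ _ => rfl) (fun _ _ _ => rfl) rfl h ?_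
  rintro (k | k | k) hk
  · exact (hk ⟨k, rfl⟩).elim
  · rfl
  · rfl

theorem runs_callSecond {a : List (tm₂.Γ tm₂.k₀)} {b : List (tm₂.Γ tm₂.k₁)} {t : ℕ}
    (h : ∃ n ≤ t, StepsIn (TM2.step tm₂.m) n ⟨some tm₂.main, tm₂.initialState, (initList tm₂ a).stk⟩
      ⟨none, tm₂.initialState, (haltList tm₂ b).stk⟩)
    (v : tm₁.σ) (w : R) (S₁ : ∀ k, List (tm₁.Γ k)) (S₃ : ∀ k, List (Γ₃ k)) :
    (callSecond tm₁ tm₂ Γ₃ R).Runs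
      ((v, tm₂.initialState, w), joinStk S₁ (update (fun _ => []) tm₂.k₀ a) S₃)
      ((v, tm₂.initialState, w), joinStk S₁ (update (fun _ => []) tm₂.k₁ b) S₃) t := by
  rw [initList_stk, haltList_stk] at h
  have := tm₂.ΛFin
  refine Frag.runs_call (Γ := JoinSymbol tm₁ tm₂ Γ₃) (σ := tm₁.σ × tm₂.σ × R)
    (e := fun k => Sum.inr (Sum.inl k)) (get := fun v => v.2.1)
    (put := fun a v => (v.1, a, v.2.2)) (v := (v, tm₂.initialState, w))
    (S := joinStk S₁ (update (fun _ => []) tm₂.k₀ a) S₃)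
    (S' := joinStk S₁ (update (fun _ => []) tm₂.k₁ b) S₃)
    (Sum.inr_injective.comp Sum.inl_injective)
    (fun _ _ => rfl) (fun _ _ _ => rfl) rfl h ?_
  rintro (k | k | k) hk
  · rfl
  · exact (hk ⟨k, rfl⟩).elim
  · rfl

end Call

/-- The output of the first machine passes through one extra stack, whose two reversals cancel. No
cleaning is needed in between, because each machine leaves only its output behind. -/
theorem PTIMEComputable.comp {A B C : Type} [Finite B] {f : List A → List B} {g : List B → List C}
    (hg : PTIMEComputable g) (hf : PTIMEComputable f) : PTIMEComputable fun x => g (f x) := by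
  obtain ⟨l, hl, hfl⟩ := hf.length_bound
  obtain ⟨tm₁, i₁, o₁, q₁, h₁⟩ := hf.exists_run
  obtain ⟨tm₂, i₂, o₂, q₂, h₂⟩ := hg.exists_run
  have := tm₁.kFin
  have := tm₂.kFin
  have := tm₁.σFin
  have := tm₂.σFin
  have : Finite (JoinSymbol tm₁ tm₂ (fun _ : Unit => B) (.inl tm₁.k₀)) :=
    @Finite.of_fintype _ tm₁.Γk₀Fin
  let v : tm₁.σ × tm₂.σ × Option B := (tm₁.initialState, tm₂.initialState, none)
  let F₁ : JoinFrag tm₁ tm₂ (fun _ : Unit => B) (Option B) :=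
    Frag.move (Γ := JoinSymbol tm₁ tm₂ (fun _ : Unit => B)) (.inl tm₁.k₁) (.inr (.inr ()))
      (fun a => some (o₁ a)) (fun v => v.2.2.map o₁.symm) fun a v => (v.1, v.2.1, a.map o₁)
  let F₂ : JoinFrag tm₁ tm₂ (fun _ : Unit => B) (Option B) :=
    Frag.move (Γ := JoinSymbol tm₁ tm₂ (fun _ : Unit => B)) (.inr (.inr ())) (.inr (.inl tm₂.k₀))
      (fun a => some (i₂.symm a)) (fun v => v.2.2) fun a v => (v.1, v.2.1, a)
  refine ptimeComputable_of_frag ((callFirst tm₁ tm₂ _ _).seq <| F₁.seq <| F₂.seq <|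
      callSecond tm₁ tm₂ _ _) (.inl tm₁.k₀) (.inr (.inl tm₂.k₁)) i₁.symm o₂.symm v
    (T := fun n => q₁.eval n + (l n + 1 + (l n + 1 + q₂.eval (l n)))) ?_ fun x => ?_
  · exact (IsPolyBounded.eval q₁).add ((hl.add (.const 1)).add ((hl.add (.const 1)).add
      (IsPolyBounded.eval q₂ |>.comp hl)))
  · have r₁ := runs_callFirst (Γ₃ := fun _ : Unit => B) (R := Option B) (h₁ x)
      (tm₂.initialState, none) (fun _ => []) (fun _ => [])
    have r₂ : F₁.Runs _ _ _ := runs_move_fst_trd (v := v)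
      (update (fun _ => []) tm₁.k₁ ((f x).map o₁.symm)) (fun _ => []) (fun _ => [])
      (by rintro (_ | o) v <;> simp) (by simp) rfl
    have r₃ : F₂.Runs _ _ _ := runs_move_trd_snd (v := v)
      (fun _ => []) (fun _ => []) (fun _ => (f x).reverse) (by simp) (by simp) rfl
    have r₄ := runs_callSecond (Γ₃ := fun _ : Unit => B) (R := Option B) (h₂ (f x))
      tm₁.initialState none (fun _ => []) (fun _ => [])
    have e : update (fun _ : Unit => (f x).reverse) () [] = fun _ => [] := by
      funext; simp
    have e' : update (fun _ : Unit => ([] : List B)) () (f x).reverse = fun _ => (f x).reverse := by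
      funext; simp
    simp [List.filterMap_map, e, e'] at r₂ r₃
    have hin : update (β := fun k => List (JoinSymbol tm₁ tm₂ (fun _ : Unit => B) k))
        (fun _ => []) (.inl tm₁.k₀) (x.map i₁.symm) =
        joinStk (update (fun _ => []) tm₁.k₀ (x.map i₁.symm)) (fun _ => []) (fun _ => []) :=
      (congrArg (fun S => update S _ _) joinStk_nil.symm).trans (update_joinStk_inl ..)
    have hout : update (β := fun k => List (JoinSymbol tm₁ tm₂ (fun _ : Unit => B) k))
        (fun _ => []) (.inr (.inl tm₂.k₁)) ((g (f x)).map o₂.symm) =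
        joinStk (fun _ => []) (update (fun _ => []) tm₂.k₁ ((g (f x)).map o₂.symm)) (fun _ => []) :=
      (congrArg (fun S => update S _ _) joinStk_nil.symm).trans (update_joinStk_inr_inl ..)
    have r := r₁.seq (r₂.seq (r₃.seq r₄))
    rw [← hin, ← hout] at r
    have hl := hfl x
    have hq := eval_le_eval_of_le q₂ hl
    exact r.mono (by omega)

end PseudoPolylog

namespace PseudoPolylog

open Turing Function

/-! #### Zipping the outputs of two machines -/

inductive ZipTape
  | inp
  | fst
  | snd
  | outR
  | out
  deriving DecidableEq

instance : Finite ZipTape :=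
  .of_injective (β := Fin 5)
    (fun | .inp => 0 | .fst => 1 | .snd => 2 | .outR => 3 | .out => 4)
    (by rintro (_ | _) (_ | _) h <;> first | rfl | (exfalso; revert h; decide))

abbrev ZipTape.Symbol (A Z : Type) : ZipTape → Type
  | .inp => A
  | .fst => A
  | .snd => A
  | .outR => Z
  | .out => Z

def zipStk {A Z : Type} (inp fst snd : List A) (outR out : List Z) :
    ∀ k, List (ZipTape.Symbol A Z k)
  | .inp => inp
  | .fst => fst
  | .snd => snd
  | .outR => outR
  | .out => out

section

variable {A Z : Type} (inp fst snd l : List A) (outR out m : List Z)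

@[simp] theorem zipStk_inp : zipStk inp fst snd outR out .inp = inp := rfl
@[simp] theorem zipStk_fst : zipStk inp fst snd outR out .fst = fst := rfl
@[simp] theorem zipStk_snd : zipStk inp fst snd outR out .snd = snd := rfl
@[simp] theorem zipStk_outR : zipStk inp fst snd outR out .outR = outR := rfl
@[simp] theorem zipStk_out : zipStk inp fst snd outR out .out = out := rfl

@[simp] theorem update_zipStk_inp : update (zipStk inp fst snd outR out) .inp l =
    zipStk l fst snd outR out := by
  funext k; cases k <;> rfl
@[simp] theorem update_zipStk_fst : update (zipStk inp fst snd outR out) .fst l =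
    zipStk inp l snd outR out := by
  funext k; cases k <;> rfl
@[simp] theorem update_zipStk_snd : update (zipStk inp fst snd outR out) .snd l =
    zipStk inp fst l outR out := by
  funext k; cases k <;> rfl
@[simp] theorem update_zipStk_outR : update (zipStk inp fst snd outR out) .outR m =
    zipStk inp fst snd m out := by
  funext k; cases k <;> rfl
@[simp] theorem update_zipStk_out : update (zipStk inp fst snd outR out) .out m =
    zipStk inp fst snd outR m := by
  funext k; cases k <;> rfl

theorem zipStk_nil : zipStk ([] : List A) [] [] ([] : List Z) [] = fun _ => [] := by
  funext k; cases k <;> rfl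

end

structure ZipMem (A B C : Type) where
  inp : Option A := none
  fst : Option B := none
  snd : Option C := none
  pair : Option (Option B × Option C) := none

instance {A B C : Type} [Finite A] [Finite B] [Finite C] : Finite (ZipMem A B C) :=
  .of_injective (β := Option A × Option B × Option C × Option (Option B × Option C))
    (fun m => (m.inp, m.fst, m.snd, m.pair))
    (by
      rintro ⟨⟩ ⟨⟩ h
      simp only [Prod.mk.injEq] at h
      simp only [ZipMem.mk.injEq]
      exact h)

section ZipStacks

variable {K₁ K₂ : Type} [DecidableEq K₁] [DecidableEq K₂] {Γ₁ : K₁ → Type} {Γ₂ : K₂ → Type}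
  {A B C σ₁ σ₂ : Type} (k₁ : K₁) (k₂ : K₂) (o₁ : Γ₁ k₁ ≃ B) (o₂ : Γ₂ k₂ ≃ C)

def zipPush : TM2.Stmt (Sum.elim Γ₁ (Sum.elim Γ₂ (ZipTape.Symbol A (Option B × Option C)))) Unit
    (σ₁ × σ₂ × ZipMem A B C) :=
  .branch (fun v => v.2.2.fst.isSome || v.2.2.snd.isSome)
    (.push (.inr (.inr .outR)) (fun v => ((v.2.2.fst, v.2.2.snd) : Option B × Option C))
      (.goto fun _ => ()))
    .halt

/-- Zip the stacks `k₁` and `k₂`. -/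
def zipStmt : TM2.Stmt (Sum.elim Γ₁ (Sum.elim Γ₂ (ZipTape.Symbol A (Option B × Option C)))) Unit
    (σ₁ × σ₂ × ZipMem A B C) :=
  .pop (.inl k₁) (fun v (o : Option (Γ₁ k₁)) => (v.1, v.2.1, { v.2.2 with fst := o.map o₁ })) <|
  .pop (.inr (.inl k₂))
    (fun v (o : Option (Γ₂ k₂)) => (v.1, v.2.1, { v.2.2 with snd := o.map o₂ })) zipPush

def zipFrag : Frag (Sum.elim Γ₁ (Sum.elim Γ₂ (ZipTape.Symbol A (Option B × Option C))))
    (σ₁ × σ₂ × ZipMem A B C) :=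
  Frag.stmt (zipStmt k₁ k₂ o₁ o₂)

theorem stepAux_zipStmt (a : σ₁) (b : σ₂) (m : ZipMem A B C) (S₁ : ∀ k, List (Γ₁ k))
    (S₂ : ∀ k, List (Γ₂ k)) (S₃ : ∀ k, List (ZipTape.Symbol A (Option B × Option C) k)) :
    TM2.stepAux (zipStmt k₁ k₂ o₁ o₂) (a, b, m) (joinStk S₁ S₂ S₃) =
    TM2.stepAux zipPush
      (a, b, { m with fst := (S₁ k₁).head?.map o₁, snd := (S₂ k₂).head?.map o₂ })
      (joinStk (update S₁ k₁ (S₁ k₁).tail) (update S₂ k₂ (S₂ k₂).tail) S₃) :=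
  (congrArg (TM2.stepAux (Γ := Sum.elim Γ₁ (Sum.elim Γ₂ (ZipTape.Symbol A (Option B × Option C))))
    (Λ := Unit) (.pop (.inr (.inl k₂)) (fun (v : σ₁ × σ₂ × ZipMem A B C) (o : Option (Γ₂ k₂)) =>
      (v.1, v.2.1, { v.2.2 with snd := o.map o₂ })) zipPush)
      (a, b, { m with fst := (S₁ k₁).head?.map o₁ }))
    (update_joinStk_inl S₁ S₂ S₃ k₁ (S₁ k₁).tail)).trans
  (congrArg (TM2.stepAux zipPush
      (a, b, { m with fst := (S₁ k₁).head?.map o₁, snd := (S₂ k₂).head?.map o₂ }))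
    (update_joinStk_inr_inl (update S₁ k₁ (S₁ k₁).tail) S₂ S₃ k₂ (S₂ k₂).tail))

theorem stepAux_zipPush (a : σ₁) (b : σ₂) (m : ZipMem A B C) (S₁ : ∀ k, List (Γ₁ k))
    (S₂ : ∀ k, List (Γ₂ k)) (r : List (Option B × Option C))
    (hm : (m.fst.isSome || m.snd.isSome) = true) :
    TM2.stepAux zipPush (a, b, m) (joinStk S₁ S₂ (zipStk [] [] [] r [])) =
      ⟨some (), (a, b, m), joinStk S₁ S₂ (zipStk [] [] [] ((m.fst, m.snd) :: r) [])⟩ := by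
  simp only [zipPush, TM2.stepAux, hm, cond_true]
  congr 1
  exact (update_joinStk_inr_inr ..).trans (congrArg _ (update_zipStk_outR ..))

/-- The loop stops when both pops fail, which also leaves both registers empty. Popping from the top
pairs the strings from their first symbols on, so the result is collected in reverse. -/
theorem runs_zipFrag (a : σ₁) (b : σ₂) (l₁ : List (Γ₁ k₁)) (l₂ : List (Γ₂ k₂))
    (r : List (Option B × Option C)) :
    (zipFrag k₁ k₂ o₁ o₂).Runs ((a, b, ({} : ZipMem A B C)), joinStk (update (fun _ => []) k₁ l₁)
        (update (fun _ => []) k₂ l₂) (zipStk [] [] [] r []))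
      ((a, b, {}), joinStk (fun _ => []) (fun _ => [])
        (zipStk [] [] [] ((List.zipWithAll Prod.mk (l₁.map o₁) (l₂.map o₂)).reverse ++ r) []))
      (l₁.length + l₂.length + 1) := by
  suffices h : ∀ (n : ℕ) (l₁ : List (Γ₁ k₁)) (l₂ : List (Γ₂ k₂)) (r : List (Option B × Option C))
      (m : ZipMem A B C), { m with fst := none, snd := none } = ({} : ZipMem A B C) →
      l₁.length + l₂.length ≤ n → ∃ j ≤ n + 1,
      StepsIn (TM2.step (zipFrag k₁ k₂ o₁ o₂).code) j
        ⟨some (), (a, b, m), joinStk (update (fun _ => []) k₁ l₁)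
          (update (fun _ => []) k₂ l₂) (zipStk [] [] [] r [])⟩
        ⟨none, (a, b, {}), joinStk (fun _ => []) (fun _ => [])
          (zipStk [] [] [] ((List.zipWithAll Prod.mk (l₁.map o₁) (l₂.map o₂)).reverse ++ r) [])⟩ from
    h _ l₁ l₂ r {} rfl le_rfl
  intro n
  induction n with
  | zero =>
    intro l₁ l₂ r m hm hl
    obtain rfl : l₁ = [] := List.length_eq_zero_iff.1 (by omega)
    obtain rfl : l₂ = [] := List.length_eq_zero_iff.1 (by omega)
    refine ⟨1, le_rfl, .single (congrArg some ((stepAux_zipStmt k₁ k₂ o₁ o₂ a b m _ _ _).trans ?_))⟩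
    simp [zipPush, TM2.stepAux, hm]
    rfl
  | succ n ih =>
    intro l₁ l₂ r m hm hl
    -- A round with a nonempty stack decreases the total length `n`, even if only one of the two
    -- stacks is nonempty.
    by_cases hs : (l₁.head?.isSome || l₂.head?.isSome) = true
    · obtain ⟨j, hj, h⟩ := ih l₁.tail l₂.tail ((l₁.head?.map o₁, l₂.head?.map o₂) :: r)
        { m with fst := l₁.head?.map o₁, snd := l₂.head?.map o₂ } hm (by
          cases l₁ <;> cases l₂ <;> simp at hs hl ⊢ <;> omega)
      have e := (stepAux_zipStmt k₁ k₂ o₁ o₂ a b m (update (fun _ => []) k₁ l₁)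
        (update (fun _ => []) k₂ l₂) (zipStk [] [] [] r [])).trans
        (stepAux_zipPush _ _ _ _ _ _ (by simpa using hs))
      simp only [update_self, update_idem] at e
      refine ⟨j + 1, by omega, .head (congrArg some e) (h.congr_right ?_)⟩
      cases l₁ <;> cases l₂ <;> simp at hs ⊢
    · obtain ⟨rfl, rfl⟩ : l₁ = [] ∧ l₂ = [] := by simpa using hs
      obtain ⟨j, hj, h⟩ := ih [] [] r m hm (by simp)
      exact ⟨j, by omega, h⟩

end ZipStacks

end PseudoPolylog

namespace PseudoPolylog

open Turing Function

theorem length_zipWithAll_le {B C D : Type} (f : Option B → Option C → D) (b : List B) (c : List C) :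
    (List.zipWithAll f b c).length ≤ b.length + c.length := by
  induction b generalizing c with
  | nil => simp
  | cons a b ih =>
    cases c with
    | nil => simp
    | cons a' c =>
      have := ih c
      simp only [List.zipWithAll_cons_cons, List.length_cons]
      omega

/-- Running a machine consumes its input, so the input is first duplicated. The shorter output is
padded with `none`, so that both strings can be recovered from the tracks. -/
theorem PTIMEComputable.zipWithAll {A B C : Type} [Finite A] [Finite B] [Finite C]
    {f : List A → List B} {g : List A → List C} (hf : PTIMEComputable f) (hg : PTIMEComputable g) :
    PTIMEComputable fun x => List.zipWithAll Prod.mk (f x) (g x) := by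
  obtain ⟨p, hp, hfp⟩ := hf.length_bound
  obtain ⟨p', hp', hgp⟩ := hg.length_bound
  obtain ⟨tm₁, i₁, o₁, q₁, h₁⟩ := hf.exists_run
  obtain ⟨tm₂, i₂, o₂, q₂, h₂⟩ := hg.exists_run
  have := tm₁.kFin
  have := tm₂.kFin
  have := tm₁.σFin
  have := tm₂.σFin
  let Z := Option B × Option C
  let Γ₃ : ZipTape → Type := ZipTape.Symbol A Z
  have : Finite (JoinSymbol tm₁ tm₂ Γ₃ (.inr (.inr .inp))) := ‹Finite A›
  let R := ZipMem A B C
  let v : tm₁.σ × tm₂.σ × R := (tm₁.initialState, tm₂.initialState, {})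
  let F₁ : JoinFrag tm₁ tm₂ Γ₃ R :=
    Frag.moveTwo (Γ := JoinSymbol tm₁ tm₂ Γ₃) (.inr (.inr .inp)) (.inr (.inr .fst))
      (.inr (.inr .snd)) (fun a => some a) (fun a => some a) (fun v => v.2.2.inp)
      fun a v => (v.1, v.2.1, { v.2.2 with inp := a })
  let F₂ : JoinFrag tm₁ tm₂ Γ₃ R :=
    Frag.move (Γ := JoinSymbol tm₁ tm₂ Γ₃) (.inr (.inr .fst)) (.inl tm₁.k₀)
      (fun a => some (i₁.symm a)) (fun v => v.2.2.inp)
      fun a v => (v.1, v.2.1, { v.2.2 with inp := a })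
  let F₃ : JoinFrag tm₁ tm₂ Γ₃ R :=
    Frag.move (Γ := JoinSymbol tm₁ tm₂ Γ₃) (.inr (.inr .snd)) (.inr (.inl tm₂.k₀))
      (fun a => some (i₂.symm a)) (fun v => v.2.2.inp)
      fun a v => (v.1, v.2.1, { v.2.2 with inp := a })
  let F₄ : JoinFrag tm₁ tm₂ Γ₃ R :=
    Frag.move (Γ := JoinSymbol tm₁ tm₂ Γ₃) (.inr (.inr .outR)) (.inr (.inr .out))
      (fun a => some a) (fun v => v.2.2.pair) fun a v => (v.1, v.2.1, { v.2.2 with pair := a })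
  let F₅ : JoinFrag tm₁ tm₂ Γ₃ R := zipFrag tm₁.k₁ tm₂.k₁ o₁ o₂
  refine ptimeComputable_of_frag (F₁.seq <| F₂.seq <| F₃.seq <| (callFirst tm₁ tm₂ Γ₃ R).seq <|
    (callSecond tm₁ tm₂ Γ₃ R).seq <| F₅.seq F₄) (.inr (.inr .inp)) (.inr (.inr .out)) (.refl A)
    (.refl Z) v (T := fun n => (n + 1) + ((n + 1) + ((n + 1) + (q₁.eval n + (q₂.eval n +
      ((p n + p' n + 1) + (p n + p' n + 1))))))) ?_ fun x => ?_
  · have h := IsPolyBounded.id.add (.const 1)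
    have h' := (hp.add hp').add (.const 1)
    exact h.add (h.add (h.add ((IsPolyBounded.eval q₁).add
      ((IsPolyBounded.eval q₂).add (h'.add h')))))
  · have r₁ : F₁.Runs _ _ _ := runs_moveTwo_trd (v := v) (fun _ => []) (fun _ => [])
      (zipStk x [] [] [] []) (by simp) (by simp) (by simp) (by simp) (by simp) rfl
    have r₂ : F₂.Runs _ _ _ := runs_move_trd_fst (v := v) (fun _ => []) (fun _ => [])
      (zipStk [] x.reverse x.reverse [] []) (by simp) (by simp) rfl
    have r₃ : F₃.Runs _ _ _ := runs_move_trd_snd (v := v)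
      (update (fun _ => []) tm₁.k₀ (x.map i₁.symm)) (fun _ => [])
      (zipStk [] [] x.reverse [] []) (by simp) (by simp) rfl
    have r₄ := runs_callFirst (Γ₃ := Γ₃) (R := R) (h₁ x) (tm₂.initialState, {})
      (update (fun _ => []) tm₂.k₀ (x.map i₂.symm)) (zipStk [] [] [] [] [])
    have r₅ := runs_callSecond (Γ₃ := Γ₃) (R := R) (h₂ x) tm₁.initialState {}
      (update (fun _ => []) tm₁.k₁ ((f x).map o₁.symm)) (zipStk [] [] [] [] [])
    have r₆ : F₅.Runs _ _ _ := runs_zipFrag (A := A) tm₁.k₁ tm₂.k₁ o₁ o₂ tm₁.initialState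
      tm₂.initialState ((f x).map o₁.symm) ((g x).map o₂.symm) []
    have r₇ : F₄.Runs _ _ _ := runs_move_trd_trd (v := v) (fun _ => []) (fun _ => [])
      (zipStk [] [] [] (List.zipWithAll Prod.mk (f x) (g x)).reverse [])
      (by simp) (by simp) (by simp) rfl
    simp [Γ₃] at r₁ r₂ r₃ r₆ r₇
    have r₈ := r₇.congr_stk (S' := joinStk (fun _ => []) (fun _ => [])
      (zipStk [] [] [] [] (List.zipWithAll Prod.mk (f x) (g x))))
      (congrArg (fun l => joinStk _ _ (zipStk [] [] [] [] l)) List.filterMap_some)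
    have hin : update (β := fun k => List (JoinSymbol tm₁ tm₂ Γ₃ k)) (fun _ => [])
        (.inr (.inr .inp)) (x.map (Equiv.refl A)) =
        joinStk (fun _ => []) (fun _ => []) (zipStk x [] [] [] []) :=
      (congrArg (fun S => update S _ _) joinStk_nil.symm).trans ((update_joinStk_inr_inr ..).trans
        (congrArg (joinStk _ _) (by
          rw [← zipStk_nil]
          exact (update_zipStk_inp ..).trans (congrArg (zipStk · [] [] [] []) (List.map_id x)))))
    have hout : update (β := fun k => List (JoinSymbol tm₁ tm₂ Γ₃ k)) (fun _ => [])
        (.inr (.inr .out)) ((List.zipWithAll Prod.mk (f x) (g x)).map (Equiv.refl Z)) =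
        joinStk (fun _ => []) (fun _ => [])
          (zipStk [] [] [] [] (List.zipWithAll Prod.mk (f x) (g x))) :=
      (congrArg (fun S => update S _ _) joinStk_nil.symm).trans ((update_joinStk_inr_inr ..).trans
        (congrArg (joinStk _ _) (by
          rw [← zipStk_nil]
          exact (update_zipStk_out ..).trans
            (congrArg (zipStk (A := A) [] [] [] []) (List.map_id _)))))
    have r := r₁.seq (r₂.seq (r₃.seq (r₄.seq (r₅.seq (r₆.seq r₈)))))
    rw [← hin, ← hout] at r
    have h₁ := hfp x
    have h₂ := hgp x
    have h₃ := length_zipWithAll_le Prod.mk (f x) (g x)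
    exact r.mono (by omega)

theorem RATM.DecidesWithin.mono {I O : Type} {M : RATM I O} {x : ℕ → I} {p : Prop} {t t' : ℕ}
    (h : M.DecidesWithin x p t) (ht : t ≤ t') : M.DecidesWithin x p t' := by
  obtain ⟨c, ⟨⟨h⟩, hc⟩, hp⟩ := h
  exact ⟨c, ⟨⟨⟨h.toEvalsTo, h.steps_le_m.trans ht⟩⟩, hc⟩, hp⟩

end PseudoPolylog

/-! ### The closure theorem -/

open PseudoPolylog in
theorem theorem7 (S : Type) [Finite S] (X Y : Set (List S × List S))
    (hred : PseudoPolylog.PsPLReducible X Y) (hY : Y ∈ PseudoPolylog.PsPL S) :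
    X ∈ PseudoPolylog.PsPL S := by
  obtain ⟨f₁, f₂, g, hf₁, hf₂, ⟨M₁, T₁, hT₁, hM₁⟩, hred⟩ := hred
  obtain ⟨G, hG, pre, hpre, M₂, T₂, hT₂, hM₂⟩ := hY
  have hf₁ := hf₁.ptimeComputable
  have hf₂ := hf₂.ptimeComputable
  obtain ⟨p₁, hp₁, hl₁⟩ := hf₁.length_bound
  obtain ⟨p₂, hp₂, hl₂⟩ := hf₂.length_bound
  refine ⟨Option G × Option S, inferInstance,
    fun D => List.zipWithAll Prod.mk (pre (f₁ D)) (f₂ D), (hpre.comp hf₁).zipWithAll hf₂,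
    RATM.comp M₁ M₂, fun n => 4 * (Finset.range (p₂ n + 1)).sup T₁ +
      (Finset.range (p₁ n + 1)).sup T₂ + 9,
    (((hT₁.sup_comp hp₂).const_mul 4).add (hT₂.sup_comp hp₁)).add (.const 9), fun D P => ?_⟩
  have h₁ := hM₁ (f₂ D) P
  have h₂ := hM₂ (f₁ D) (g (f₂ D) P)
  rw [← hred] at h₂
  have ht₁ : T₁ (f₂ D).length ≤ (Finset.range (p₂ D.length + 1)).sup T₁ :=
    Finset.le_sup (by have := hl₂ D; simp; omega)
  have ht₂ : T₂ (f₁ D).length ≤ (Finset.range (p₁ D.length + 1)).sup T₂ :=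
    Finset.le_sup (by have := hl₁ D; simp; omega)
  -- The padding of the shorter track reads as blank, exactly like the cells beyond the end of the
  -- string; each machine therefore sees the input tape that it expects.
  have e : ∀ i : ℕ, (List.zipWithAll Prod.mk (pre (f₁ D)) (f₂ D))[i]?.bind Prod.snd = (f₂ D)[i]? ∧
      (List.zipWithAll Prod.mk (pre (f₁ D)) (f₂ D))[i]?.bind Prod.fst = (pre (f₁ D))[i]? := by
    intro i
    rw [List.getElem?_zipWithAll]
    cases (pre (f₁ D))[i]? <;> cases (f₂ D)[i]? <;> exact ⟨rfl, rfl⟩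
  have e₁ : (fun i => ((pairTape (List.zipWithAll Prod.mk (pre (f₁ D)) (f₂ D)) P i).1.bind Prod.snd,
      (pairTape (List.zipWithAll Prod.mk (pre (f₁ D)) (f₂ D)) P i).2)) = pairTape (f₂ D) P :=
    funext fun i => Prod.ext (e i).1 rfl
  have e₂ : (fun i => ((pairTape (List.zipWithAll Prod.mk (pre (f₁ D)) (f₂ D)) P i).1.bind Prod.fst,
      (g (f₂ D) P)[i]?)) = pairTape (pre (f₁ D)) (g (f₂ D) P) :=
    funext fun i => Prod.ext (e i).2 rfl
  rw [← e₁] at h₁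
  rw [← e₂] at h₂
  exact (RATM.comp_decidesWithin h₁ h₂).mono (by dsimp only; omega)
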